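/- **Setting.** Let $\mathcal X,\mathcal Y,\mathcal U$ be finite dimensional real inner product spaces, $X\subset\mathcal X$ nonempty convex, $Y\subset\mathcal Y$ nonempty convex compact with diameter $D_y:=\sup_{y,y'\in Y}\|y-y'\|$, and let $h$ be a proper lower semicontinuous convex function with domain $X$. Let $\Omega\supseteq X$ be open, let $\Phi$ be real-valued and continuous on $\Omega\times Y$ such that $\nabla_x\Phi$ exists and is continuous on $\Omega\times Y$ and, for each $x\in\Omega$, $-\Phi(x,\cdot)$ (extended by $+\infty$ off $Y$) is lower semicontinuous and convex. Let $L_x,L_y>0$, $m\in(0,L_x]$ be such that for all $x,x'\in X$, $y,y'\in Y$ $$\Phi(x,y)-\Phi(x',y)-\langle\nabla_x\Phi(x',y),x-x'\rangle\ge-\tfrac m2\|x-x'\|^2,\qquad \|\nabla_x\Phi(x,y)-\nabla_x\Phi(x',y')\|\le L_x\|x-x'\|+L_y\|y-y'\|.$$ Let $p(x)=\max_{y\in Y}\Phi(x,y)$, $\hat p=p+h$, let $\mathcal A:\mathcal X\to\mathcal U$ be linear, $\mathcal A\neq0$, $b\in\mathcal U$, $\mathcal F=\{x\in X:\mathcal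 Ax=b\}\ne\emptyset$, and let $\hat c\ge0$ satisfy $\hat\phi_{\hat c}:=\inf_{x\in X}\{\hat p(x)+\frac{\hat c}2\|\mathcal Ax-b\|^2\}>-\infty$. The problem is $\min\{p(x)+h(x):x\in X,\ \mathcal Ax=b\}$. Let $(x_0,y_0)\in X\times Y$, $\rho_x,\rho_y,\eta>0$ and $\xi>0$ with $\xi\ge D_y/\rho_y$. Put $$p_\xi(x)=\max_{y\in Y}\Big\{\Phi(x,y)-\tfrac1{2\xi}\|y-y_0\|^2\Big\},\quad y_\xi(x)=\text{the maximizer},\quad L_\xi=L_y\big(\xi L_y+\sqrt{\xi(L_x+m)}\big)+L_x,$$ $\lambda=\frac1{4m}$, $\sigma=\frac12$, $\log_1^+t=\max\{1,\log t\}$, and $$R:=\inf_{x'\in\mathcal F}\Big\{\tfrac12\|x_0-x'\|^2+\tfrac1{4m}\big[\hat p(x')-\hat\phi_{\hat c}\big]\Big\},\qquad \Omega_{\xi,\eta}:=1+\frac{\sqrt\xi L_y+\sqrt{L_x}}{\sqrt m}+\Big(R+\frac{D_y^2}{m\xi}\Big)^{1/2}\frac{\|\mathcal A\|}\eta .$$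 **Oracles.** $\Phi,h,X,Y$ are accessed only through the evaluation of $\Phi(x,y)$, $\nabla_x\Phi(x,y)$, $h(x)$ and the exact solution of $\min_{x\in X}\{th(x)+\frac12\|x-a\|^2\}$ and $\max_{y\in Y}\{t\Phi(a,y)-\frac12\|y-a'\|^2\}$ for given $t>0$. An oracle call is a collection of $O(1)$ such evaluations in which each type occurs at least once; up to a universal factor this counts single evaluations. **ACG method** for $\psi=\psi_s+\psi_n$ with constants $(\mu,L)$ from $z_0$: $y_0=z_0$, $A_0=0$, $\Gamma_0\equiv0$, and for $j\ge0$ $$A_{j+1}=A_j+\tfrac{1}{2L}\Big(\mu A_j+1+\sqrt{(\mu A_j+1)^2+4L(\mu A_j+1)A_j}\Big),\quad \theta_j=\tfrac{A_j}{A_{j+1}},\quad \tilde z_j=\theta_jz_j+(1-\theta_j)y_j,$$ $$\Gamma_{j+1}=\theta_j\Gamma_j+(1-\theta_j)\big[\psi_s(\tilde z_j)+\langle\nabla\psi_s(\tilde z_j),\cdot-\tilde z_j\rangle\big],\quad y_{j+1}=\arg\min\Big\{\Gamma_{j+1}+\psi_n+\tfrac{1}{2A_{j+1}}\|\cdot-y_0\|^2\Big\},$$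 $z_{j+1}=\theta_jz_j+(1-\theta_j)y_{j+1}$, $u_{j+1}=\frac{y_0-y_{j+1}}{A_{j+1}}$, $\varepsilon_{j+1}=\psi(z_{j+1})-\Gamma_{j+1}(y_{j+1})-\psi_n(y_{j+1})-\langle u_{j+1},z_{j+1}-y_{j+1}\rangle$. **QP-AIPP-S scheme.** Start with $c=\hat c+L_\xi/\|\mathcal A\|^2$. For the current $c$ let $f_c=p_\xi+\frac c2\|\mathcal A\cdot-b\|^2$, $M=L_\xi+c\|\mathcal A\|^2$, $M_\lambda=M+\lambda^{-1}$, $\hat\rho=\rho_x/4$, $\hat\varepsilon=\rho_x^2/(32M_\lambda)$, $k=1$, and run the AIPP method from $x_0$: (1) run ACG from $z_0=x_{k-1}$ with $(\mu,L)=(\frac12,\lambda M+\frac12)$, $\psi_s=\lambda f_c+\frac14\|\cdot-x_{k-1}\|^2$, $\psi_n=\lambda h+\frac14\|\cdot-x_{k-1}\|^2$ until its first iterate $(x,u,\varepsilon)=(z_j,u_j,\varepsilon_j)$ with $j\ge\lceil6\sqrt{2\lambda M+1}\,\rceil$ and $$\|u\|^2+2\varepsilon\le\sigma\|x_{k-1}-x+u\|^2;\qquad(*)$$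 (2) if $\|x_{k-1}-x+u\|>\lambda\hat\rho/5$, set $x_k=x$, $k\leftarrow k+1$ and go to (1); (3) otherwise continue this ACG run until the first iterate (the current one included) that satisfies $(*)$ and $\varepsilon\le\lambda\hat\varepsilon$; (4) with this $x$, set $\bar x=\arg\min_{x'}\{\langle\nabla f_c(x),x'-x\rangle+h(x')+\frac{M_\lambda}2\|x'-x\|^2\}$ and $\bar u=M_\lambda(x-\bar x)+\nabla f_c(\bar x)-\nabla f_c(x)$. If $\|\mathcal A\bar x-b\|>\eta$, replace $c$ by $2c$ and rerun AIPP from $x_0$; otherwise output $(\bar u,\bar v,\bar x,\bar y,\bar r)$ with $\bar y=y_\xi(\bar x)$, $\bar v=(y_0-\bar y)/\xi$, $\bar r=c(\mathcal A\bar x-b)$. Here $p_\xi(x)$ and $\nabla p_\xi(x)$ are computed as $\Phi(x,y_\xi(x))-\frac1{2\xi}\|y_\xi(x)-y_0\|^2$ and $\nabla_x\Phi(x,y_\xi(x))$. **Proposition 4.2.** The function $p_\xi$ is differentiable at every point of $X$ and these formulas give its value and gradient there. The scheme terminates, and: (a) it makes $$O\left(\Omega_{\xi,\eta}\left[\frac{m^2R}{\rho_x^2}+\frac{mD_y^2}{\xi\rho_x^2}+\log_1^+(\Omega_{\xi,\eta})\right]\right)$$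 oracle calls, where the constant in $O(\cdot)$ is a universal constant times $1+\hat c\,\|\mathcal A\|^2/m$; (b) its output satisfies $\bar u\in\nabla_x\Phi(\bar x,\bar y)+\mathcal A^*\bar r+\partial h(\bar x)$, $\bar v\in\partial[-\Phi(\bar x,\cdot)](\bar y)$, $\|\bar u\|\le\rho_x$, $\|\bar v\|\le\rho_y$ and $\|\mathcal A\bar x-b\|\le\eta$. In particular, for fixed problem data, $(m,L_x,L_y,\hat c)$ and $(x_0,y_0)$, and every $K$ there is a constant $C$, independent of the tolerances and of $\xi$, such that whenever $D_y/\rho_y\le\xi\le K/\rho_y$, $\rho_y\le K$ and $\log_1^+(\Omega_{\xi,\eta})\le K\rho_x^{-2}$, the number of oracle calls is at most $C(\rho_x^{-2}\rho_y^{-1/2}+\rho_x^{-2}\eta^{-1})$. -/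

import Mathlib

namespace QPAIPPS

universe u v w a b

/-- `log₁⁺(t) = max {1, log t}`. -/
noncomputable def logPlus (t : ℝ) : ℝ := max 1 (Real.log t)

/-! ## Convex analysis

An extended-valued function `ψ : Z → (-∞, ∞]` with effective domain `S` is represented by `S` and by
a real-valued function whose values off `S` are irrelevant (they stand for `+∞`). -/

section Convex

variable {E : Type u} [NormedAddCommGroup E] [InnerProductSpace ℝ E]

/-- The function equal to `ψ` on `S` and to `+∞` off `S` is proper, convex and lower semicontinuous
(its epigraph is closed), and its effective domain is `S`. -/
def ClosedConvexOn (S : Set E) (ψ : E → ℝ) : Prop :=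
  S.Nonempty ∧ ConvexOn ℝ S ψ ∧ IsClosed {q : E × ℝ | q.1 ∈ S ∧ ψ q.1 ≤ q.2}

/-- The subdifferential at `z` of the function equal to `ψ` on `S` and to `+∞` off `S`. -/
def subdiff (S : Set E) (ψ : E → ℝ) (z : E) : Set E :=
  {g | z ∈ S ∧ ∀ z' ∈ S, ψ z + inner ℝ g (z' - z) ≤ ψ z'}

end Convex

/-- A minimizer of `g` over `S` (an arbitrary point if there is none). -/
noncomputable def argminOn {α : Type u} [Nonempty α] (S : Set α) (g : α → ℝ) : α :=
  Classical.epsilon fun x => x ∈ S ∧ ∀ x' ∈ S, g x ≤ g x'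

/-! ## The problem `min {p(x) + h(x) : x ∈ X, A x = b}`, `p(x) = max {Φ(x, y) : y ∈ Y}` -/

/-- The data of the problem. Only the values of `Φ` near `X × Y` and those of `h` on `X` matter. -/
structure Problem (E : Type u) (F : Type v) (U : Type w)
    [NormedAddCommGroup E] [InnerProductSpace ℝ E]
    [NormedAddCommGroup F] [InnerProductSpace ℝ F]
    [NormedAddCommGroup U] [InnerProductSpace ℝ U] where
  X : Set E
  Y : Set F
  Φ : E → F → ℝ
  h : E → ℝ
  A : E →L[ℝ] U
  b : U

section ProblemDefs

variable {E : Type u} {F : Type v} {U : Type w}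
  [NormedAddCommGroup E] [InnerProductSpace ℝ E] [CompleteSpace E]
  [NormedAddCommGroup F] [InnerProductSpace ℝ F]
  [NormedAddCommGroup U] [InnerProductSpace ℝ U] [CompleteSpace U]

/-- The partial gradient `∇ₓ Φ(x, y)`. -/
noncomputable def Problem.gradPhi (P : Problem E F U) (x : E) (y : F) : E :=
  gradient (fun x' => P.Φ x' y) x

/-- The max function `p`. -/
noncomputable def Problem.p (P : Problem E F U) (x : E) : ℝ :=
  sSup ((fun y => P.Φ x y) '' P.Y)

/-- The objective function `p̂ = p + h` (on `X`). -/
noncomputable def Problem.phat (P : Problem E F U) (x : E) : ℝ := P.p x + P.h x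

/-- The smoothed max function `p_ξ(x) = max {Φ(x, y) - ‖y - y₀‖² / (2 ξ) : y ∈ Y}`. -/
noncomputable def Problem.pSmooth (P : Problem E F U) (ξ : ℝ) (y₀ : F) (x : E) : ℝ :=
  sSup ((fun y => P.Φ x y - 1 / (2 * ξ) * ‖y - y₀‖ ^ 2) '' P.Y)

/-- The diameter `D_y` of `Y`. -/
noncomputable def Problem.Dy (P : Problem E F U) : ℝ := Metric.diam P.Y

/-- The optimal value `inf {φ(x) + (c/2) ‖A x - b‖² : x ∈ X}` of the penalty problem. -/
noncomputable def Problem.penaltyValue (P : Problem E F U) (φ : E → ℝ) (c : ℝ) : ℝ :=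
  sInf ((fun x => φ x + c / 2 * ‖P.A x - P.b‖ ^ 2) '' P.X)

/-- `R_c(φ; lam) = inf {‖x₀ - x'‖² / 2 + lam (φ(x') - φ̂_c) : x' ∈ X, A x' = b}`, where `φ̂_c` is the
optimal value of the penalty problem. -/
noncomputable def Problem.R (P : Problem E F U) (c : ℝ) (φ : E → ℝ) (lam : ℝ) (x₀ : E) : ℝ :=
  sInf ((fun x' => 1 / 2 * ‖x₀ - x'‖ ^ 2 + lam * (φ x' - P.penaltyValue φ c)) ''
    {x' | x' ∈ P.X ∧ P.A x' = P.b})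

/-- The standing assumptions on the problem, for the curvature constants `m`, `Lx`, `Ly` and the
penalty constant `chat`. -/
structure Problem.Standing (P : Problem E F U) (m Lx Ly chat : ℝ) : Prop where
  X_nonempty : P.X.Nonempty
  X_convex : Convex ℝ P.X
  Y_nonempty : P.Y.Nonempty
  Y_convex : Convex ℝ P.Y
  Y_compact : IsCompact P.Y
  h_mem : ClosedConvexOn P.X P.h
  Φ_regular : ∃ O : Set E, IsOpen O ∧ P.X ⊆ O ∧
    ContinuousOn (fun q : E × F => P.Φ q.1 q.2) (O ×ˢ P.Y) ∧
    (∀ x ∈ O, ∀ y ∈ P.Y, DifferentiableAt ℝ (fun x' => P.Φ x' y) x) ∧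
    ContinuousOn (fun q : E × F => P.gradPhi q.1 q.2) (O ×ˢ P.Y) ∧
    ∀ x ∈ O, ClosedConvexOn P.Y (fun y => -P.Φ x y)
  m_pos : 0 < m
  Lx_pos : 0 < Lx
  Ly_pos : 0 < Ly
  m_le : m ≤ Lx
  lower_curvature : ∀ x ∈ P.X, ∀ x' ∈ P.X, ∀ y ∈ P.Y,
    -(m / 2) * ‖x - x'‖ ^ 2 ≤ P.Φ x y - (P.Φ x' y + inner ℝ (P.gradPhi x' y) (x - x'))
  grad_lipschitz : ∀ x ∈ P.X, ∀ x' ∈ P.X, ∀ y ∈ P.Y, ∀ y' ∈ P.Y,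
    ‖P.gradPhi x y - P.gradPhi x' y'‖ ≤ Lx * ‖x - x'‖ + Ly * ‖y - y'‖
  A_ne_zero : P.A ≠ 0
  feasible : ∃ x ∈ P.X, P.A x = P.b
  chat_nonneg : 0 ≤ chat
  penalty_bddBelow :
    BddBelow ((fun x => P.phat x + chat / 2 * ‖P.A x - P.b‖ ^ 2) '' P.X)

/-- A quintuple `(u, v, x, y, r)`. -/
structure Quintuple (E : Type u) (F : Type v) (U : Type w) where
  u : E
  v : F
  x : E
  y : F
  r : U

/-- The quintuple is an approximate primal-dual stationary point:
`u ∈ ∇ₓΦ(x, y) + A* r + ∂h(x)`, `v ∈ ∂[-Φ(x, ·)](y)`, `‖u‖ ≤ ρx`, `‖v‖ ≤ ρy`, `‖A x - b‖ ≤ η`.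
Membership in the two subdifferentials contains `x ∈ X` and `y ∈ Y`. -/
structure Problem.IsStationary (P : Problem E F U) (ρx ρy η : ℝ) (q : Quintuple E F U) : Prop where
  u_mem : ∃ g ∈ subdiff P.X P.h q.x,
    q.u = P.gradPhi q.x q.y + ContinuousLinearMap.adjoint P.A q.r + g
  v_mem : q.v ∈ subdiff P.Y (fun y => -P.Φ q.x y) q.y
  u_le : ‖q.u‖ ≤ ρx
  v_le : ‖q.v‖ ≤ ρy
  feas_le : ‖P.A q.x - P.b‖ ≤ η

end ProblemDefs

/-! ## Oracle programs

`Φ`, `h`, `X` and `Y` are accessible to an algorithm only through five oracles. A program is a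
decision tree whose inner nodes are oracle evaluations; arithmetic is free. -/

/-- Programs returning an element of `α`. -/
inductive Prog (E : Type u) (F : Type v) (α : Type a) : Type (max u v a)
  /-- stop and return `r` -/
  | ret (r : α) : Prog E F α
  /-- evaluate `Φ(x, y)` -/
  | evalPhi (x : E) (y : F) (k : ℝ → Prog E F α) : Prog E F α
  /-- evaluate `∇ₓΦ(x, y)` -/
  | evalGrad (x : E) (y : F) (k : E → Prog E F α) : Prog E F α
  /-- evaluate `h(x)` -/
  | evalH (x : E) (k : ℝ → Prog E F α) : Prog E F α
  /-- solve `min {lam h(x') + ‖x' - x‖² / 2 : x' ∈ X}` -/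
  | proxH (lam : ℝ) (x : E) (k : E → Prog E F α) : Prog E F α
  /-- solve `max {lam Φ(x, y') - ‖y' - y‖² / 2 : y' ∈ Y}` -/
  | proxPhi (lam : ℝ) (x : E) (y : F) (k : F → Prog E F α) : Prog E F α

/-- Sequential composition. -/
def Prog.bind {E : Type u} {F : Type v} {α : Type a} {β : Type b} :
    Prog E F α → (α → Prog E F β) → Prog E F β
  | .ret r, f => f r
  | .evalPhi x y k, f => .evalPhi x y fun t => (k t).bind f
  | .evalGrad x y k, f => .evalGrad x y fun t => (k t).bind f
  | .evalH x k, f => .evalH x fun t => (k t).bind f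
  | .proxH lam x k, f => .proxH lam x fun t => (k t).bind f
  | .proxPhi lam x y k, f => .proxPhi lam x y fun t => (k t).bind f

section Exec

variable {E : Type u} {F : Type v} {U : Type w}
  [NormedAddCommGroup E] [InnerProductSpace ℝ E] [CompleteSpace E]
  [NormedAddCommGroup F] [InnerProductSpace ℝ F]
  [NormedAddCommGroup U] [InnerProductSpace ℝ U]

/-- The value that a program returns on the problem `P`, and the number of single oracle evaluations
that it makes. One "oracle call" is a collection of `O(1)` single evaluations in which each of the
five oracles occurs at least once, so that the number of single evaluations and the number of oracle
calls agree up to a universal factor. -/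
noncomputable def Prog.exec (P : Problem E F U) {α : Type a} : Prog E F α → α × ℕ
  | .ret r => (r, 0)
  | .evalPhi x y k =>
      let t := (k (P.Φ x y)).exec P
      (t.1, t.2 + 1)
  | .evalGrad x y k =>
      let t := (k (P.gradPhi x y)).exec P
      (t.1, t.2 + 1)
  | .evalH x k =>
      let t := (k (P.h x)).exec P
      (t.1, t.2 + 1)
  | .proxH lam x k =>
      let t := (k (argminOn P.X fun x' => lam * P.h x' + 1 / 2 * ‖x' - x‖ ^ 2)).exec P
      (t.1, t.2 + 1)
  | .proxPhi lam x y k =>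
      let t := (k (argminOn P.Y fun y' => -(lam * P.Φ x y' - 1 / 2 * ‖y' - y‖ ^ 2))).exec P
      (t.1, t.2 + 1)

end Exec

/-! ## The accelerated composite gradient (ACG) method -/

/-- The quantities `A_j, z_j, y_j, u_j, ε_j` of the ACG method and the affine function
`Γ_j(y) = α_j + ⟨β_j, y⟩`. -/
structure AcgState (E : Type u) where
  A : ℝ
  z : E
  y : E
  α : ℝ
  β : E
  u : E
  ε : ℝ

section Acg

variable {E : Type u} {F : Type v} [NormedAddCommGroup E] [InnerProductSpace ℝ E]

/-- `A_0 = 0`, `y_0 = z_0`, `Γ_0 = 0` (the entries `u_0`, `ε_0` are never used). -/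
def acgStart (z₀ : E) : AcgState E := ⟨0, z₀, z₀, 0, 0, 0, 0⟩

/-- One iteration of the ACG method for `ψ = ψs + ψn`, where `smooth x` computes `ψs(x)` and
`∇ψs(x)`, `value x` computes `ψn(x)`, and `resolvent α x` computes the minimizer of
`ψn(y) + ‖y - x‖² / (2 α)`. Up to a constant,
`Γ(y) + ψn(y) + ‖y - y₀‖² / (2 A) = ψn(y) + ‖y - (y₀ - A β)‖² / (2 A)` for `Γ = α + ⟨β, ·⟩`. -/
noncomputable def acgStep (μ L : ℝ) (smooth : E → Prog E F (ℝ × E)) (value : E → Prog E F ℝ)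
    (resolvent : ℝ → E → Prog E F E) (y₀ : E) (s : AcgState E) : Prog E F (AcgState E) :=
  let t := μ * s.A + 1
  let A' := s.A + (t + √(t ^ 2 + 4 * L * t * s.A)) / (2 * L)
  let z' := (s.A / A') • s.z + ((A' - s.A) / A') • s.y
  (smooth z').bind fun fz =>
    let α₁ := s.A / A' * s.α + (A' - s.A) / A' * (fz.1 - inner ℝ fz.2 z')
    let β₁ := (s.A / A') • s.β + ((A' - s.A) / A') • fz.2
    (resolvent A' (y₀ - A' • β₁)).bind fun y₁ =>
      let z₁ := (s.A / A') • s.z + ((A' - s.A) / A') • y₁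
      (smooth z₁).bind fun fz₁ =>
        (value z₁).bind fun nz₁ =>
          (value y₁).bind fun ny₁ =>
            let u₁ := A'⁻¹ • (y₀ - y₁)
            let ε₁ := (fz₁.1 + nz₁) - (α₁ + inner ℝ β₁ y₁) - ny₁ - inner ℝ u₁ (z₁ - y₁)
            .ret ⟨A', z₁, y₁, α₁, β₁, u₁, ε₁⟩

end Acg

/-! ## The QP-AIPP-S scheme -/

/-- The Lipschitz constant `L_ξ = L_y (ξ L_y + √(ξ (L_x + m))) + L_x` of `∇p_ξ`. -/
noncomputable def Lsmooth (m Lx Ly ξ : ℝ) : ℝ := Ly * (ξ * Ly + √(ξ * (Lx + m))) + Lx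

/-- The input of the scheme (the tolerance `ρ_y` enters only through the condition on `ξ`). -/
structure Input (E : Type u) (F : Type v) (U : Type w)
    [NormedAddCommGroup E] [InnerProductSpace ℝ E]
    [NormedAddCommGroup U] [InnerProductSpace ℝ U] where
  A : E →L[ℝ] U
  b : U
  m : ℝ
  Lx : ℝ
  Ly : ℝ
  chat : ℝ
  ξ : ℝ
  x₀ : E
  y₀ : F
  ρx : ℝ
  η : ℝ

/-- The steps of the AIPP method: `solve` is the loop of step 1, `test` is step 2, `refine` is the
loop of step 3, and `finish` is step 4. -/
inductive Stage
  | solve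
  | test
  | refine
  | finish

/-- The state of the scheme: the penalty parameter `c`, the prox center `x_{k-1}` of the current AIPP
iteration, the number `j` of ACG iterations made so far in the current call of step 1, and the
current ACG iterate. -/
structure State (E : Type u) where
  stage : Stage
  c : ℝ
  center : E
  j : ℕ
  acg : AcgState E

section Scheme

variable {E : Type u} {F : Type v} {U : Type w}
  [NormedAddCommGroup E] [InnerProductSpace ℝ E] [CompleteSpace E]
  [NormedAddCommGroup F] [InnerProductSpace ℝ F]
  [NormedAddCommGroup U] [InnerProductSpace ℝ U] [CompleteSpace U]

/-- The prox stepsize `λ = 1 / (4 m)`. -/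
noncomputable def Input.lam (I : Input E F U) : ℝ := 1 / (4 * I.m)

/-- The inexactness parameter `σ = 1 / 2`. -/
noncomputable def Input.sigma (_I : Input E F U) : ℝ := 1 / 2

/-- `M_c = L_ξ + c ‖A‖²`. -/
noncomputable def Input.M (I : Input E F U) (c : ℝ) : ℝ :=
  Lsmooth I.m I.Lx I.Ly I.ξ + c * ‖I.A‖ ^ 2

/-- Computes `p_ξ(x)` and `∇p_ξ(x) = ∇ₓΦ(x, y_ξ(x))`, where `y_ξ(x)` is the maximizer of
`Φ(x, y) - ‖y - y₀‖² / (2 ξ)` over `Y`. -/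
noncomputable def Input.smoothMax (I : Input E F U) (x : E) : Prog E F (ℝ × E) :=
  .proxPhi I.ξ x I.y₀ fun y =>
    .evalPhi x y fun t =>
      .evalGrad x y fun g =>
        .ret (t - 1 / (2 * I.ξ) * ‖y - I.y₀‖ ^ 2, g)

/-- Computes the value and the gradient of `f_c = p_ξ + (c/2) ‖A · - b‖²` at `x`. -/
noncomputable def Input.penalized (I : Input E F U) (c : ℝ) (x : E) : Prog E F (ℝ × E) :=
  (I.smoothMax x).bind fun f =>
    .ret (f.1 + c / 2 * ‖I.A x - I.b‖ ^ 2,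
      f.2 + c • ContinuousLinearMap.adjoint I.A (I.A x - I.b))

/-- One ACG iteration for the prox subproblem with center `x⁻`, that is, with `z₀ = x⁻`,
`(μ, L) = (1/2, λ M_c + 1/2)`, `ψs = λ f_c + ‖· - x⁻‖² / 4` and `ψn = λ h + ‖· - x⁻‖² / 4`. -/
noncomputable def Input.acg (I : Input E F U) (c : ℝ) (center : E) (s : AcgState E) :
    Prog E F (AcgState E) :=
  acgStep (1 / 2) (I.lam * I.M c + 1 / 2)
    (fun x => (I.penalized c x).bind fun f =>
      .ret (I.lam * f.1 + 1 / 4 * ‖x - center‖ ^ 2, I.lam • f.2 + (1 / 2 : ℝ) • (x - center)))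
    (fun x => .evalH x fun t => .ret (I.lam * t + 1 / 4 * ‖x - center‖ ^ 2))
    (fun α x =>
      let θ := 1 / 2 + 1 / α
      .proxH (I.lam / θ) (θ⁻¹ • ((1 / 2 : ℝ) • center + (1 / α) • x)) fun y => .ret y)
    center s

/-- The inequality `‖u‖² + 2 ε ≤ σ ‖x⁻ - x + u‖²` for the current ACG iterate `(x, u, ε)`. -/
def Input.inexact (I : Input E F U) (center : E) (s : AcgState E) : Prop :=
  ‖s.u‖ ^ 2 + 2 * s.ε ≤ I.sigma * ‖center - s.z + s.u‖ ^ 2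

/-- The start of an AIPP iteration (step 1) with prox center `x`. -/
def State.begin (c : ℝ) (x : E) : State E := ⟨.solve, c, x, 0, acgStart x⟩

open scoped Classical in
/-- One transition of the scheme. The penalty method starts the AIPP method, with the tolerance `ρx`,
from `x₀` for each new value of `c`. -/
noncomputable def Input.step (I : Input E F U) (s : State E) :
    Prog E F (State E ⊕ Quintuple E F U) :=
  let Ml := I.M s.c + 1 / I.lam
  match s.stage with
  | .solve =>
      -- step 1 of AIPP: at least `⌈6 √(2 λ M_c + 1)⌉` ACG iterations, until the inequality holds
      (I.acg s.c s.center s.acg).bind fun t =>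
        .ret (.inl
          (if ⌈6 * √(2 * I.lam * I.M s.c + 1)⌉₊ ≤ s.j + 1 ∧ I.inexact s.center t
            then ⟨.test, s.c, s.center, s.j + 1, t⟩
            else ⟨.solve, s.c, s.center, s.j + 1, t⟩))
  | .test =>
      -- step 2 of AIPP, with `ρ̂ = ρx / 4`
      .ret (.inl
        (if ‖s.center - s.acg.z + s.acg.u‖ ≤ I.lam * (I.ρx / 4) / 5
          then { s with stage := .refine }
          else State.begin s.c s.acg.z))
  | .refine =>
      -- step 3 of AIPP: the ACG call is resumed until, in addition, `ε ≤ λ ε̂`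
      if s.acg.ε ≤ I.ρx ^ 2 / (32 * Ml) * I.lam ∧ I.inexact s.center s.acg
        then .ret (.inl { s with stage := .finish })
        else (I.acg s.c s.center s.acg).bind fun t =>
          .ret (.inl ⟨.refine, s.c, s.center, s.j + 1, t⟩)
  | .finish =>
      -- step 4 of AIPP: a composite gradient step; then the feasibility test of the penalty method
      (I.penalized s.c s.acg.z).bind fun f =>
        .proxH (1 / Ml) (s.acg.z - Ml⁻¹ • f.2) fun x =>
          (I.penalized s.c x).bind fun f' =>
            if I.η < ‖I.A x - I.b‖
              then .ret (.inl (State.begin (2 * s.c) I.x₀))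
              else .proxPhi I.ξ x I.y₀ fun y =>
                .ret (.inr
                  { u := Ml • (s.acg.z - x) + f'.2 - f.2
                    v := I.ξ⁻¹ • (I.y₀ - y)
                    x := x
                    y := y
                    r := s.c • (I.A x - I.b) })

/-- From the state `s`, the scheme terminates with output `q` after `n` single oracle evaluations. -/
inductive Runs (P : Problem E F U) (I : Input E F U) : State E → Quintuple E F U → ℕ → Prop
  | halt {s : State E} {q : Quintuple E F U} {n : ℕ} :
      (I.step s).exec P = (Sum.inr q, n) → Runs P I s q n
  | next {s s' : State E} {q : Quintuple E F U} {n k : ℕ} :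
      (I.step s).exec P = (Sum.inl s', n) → Runs P I s' q k → Runs P I s q (n + k)

/-- The QP-AIPP-S scheme, with the initial penalty parameter `ĉ + L_ξ / ‖A‖²`, terminates with
output `q` after `n` single oracle evaluations. -/
def SchemeOutputs (P : Problem E F U) (I : Input E F U) (q : Quintuple E F U) (n : ℕ) : Prop :=
  Runs P I (State.begin (I.chat + Lsmooth I.m I.Lx I.Ly I.ξ / ‖I.A‖ ^ 2) I.x₀) q n

/-- The input of the scheme for the problem `P`. -/
def Problem.input (P : Problem E F U) (m Lx Ly chat ξ : ℝ) (x₀ : E) (y₀ : F) (ρx η : ℝ) :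
    Input E F U :=
  ⟨P.A, P.b, m, Lx, Ly, chat, ξ, x₀, y₀, ρx, η⟩

/-! ## The complexity bound -/

/-- `Ω_ξ = 1 + (√ξ L_y + √L_x) / √m`. -/
noncomputable def omegaXi (m Lx Ly ξ : ℝ) : ℝ := 1 + (√ξ * Ly + √Lx) / √m

/-- `Ω_{ξ,η} = Ω_ξ + (R + D_y² / (m ξ))^{1/2} ‖A‖ / η` with `R = R_ĉ(p̂; 1/(4m))`. -/
noncomputable def Problem.omega (P : Problem E F U) (m Lx Ly chat ξ : ℝ) (x₀ : E) (η : ℝ) : ℝ :=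
  omegaXi m Lx Ly ξ +
    √(P.R chat P.phat (1 / (4 * m)) x₀ + P.Dy ^ 2 / (m * ξ)) * ‖P.A‖ / η

/-- `Ω_{ξ,η} [m² R / ρx² + m D_y² / (ξ ρx²) + log₁⁺ Ω_{ξ,η}]` with `R = R_ĉ(p̂; 1/(4m))`. -/
noncomputable def Problem.callBound (P : Problem E F U) (m Lx Ly chat ξ : ℝ) (x₀ : E)
    (ρx η : ℝ) : ℝ :=
  P.omega m Lx Ly chat ξ x₀ η *
    (m ^ 2 * P.R chat P.phat (1 / (4 * m)) x₀ / ρx ^ 2 + m * P.Dy ^ 2 / (ξ * ρx ^ 2) +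
      logPlus (P.omega m Lx Ly chat ξ x₀ η))

end Scheme

end QPAIPPS

open QPAIPPS

/-!
The scheme is a penalty method whose inner problems, `f_c + h` with `f_c = p_ξ + (c/2) ‖A · - b‖²`,
are solved by an inexact proximal point method (AIPP); the prox subproblems are solved by ACG.

* *Smoothing.* `-Φ(x, ·) + ‖· - y₀‖² / (2 ξ)` is strongly convex, so that the maximizer `y_ξ(x)` is
  unique and continuous, and Lipschitz on `X`. Danskin's theorem gives `∇p_ξ(x) = ∇ₓΦ(x, y_ξ(x))`,
  which is `L_ξ`-Lipschitz on `X`, and `p_ξ` inherits the lower curvature `m`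
  (`hasGradientAt_pSmooth`, `smoothGrad_lipschitz`, `pSmooth_lower`).
* *ACG.* With `s = √(2 λ M_c + 1)` one has `A_j ≥ j² / (2 s²)` and `A_{j+1} ≥ (1 + 1/s) A_j`. The
  iterates satisfy the three inequalities of `AcgCert`. For `j ≥ 6 s` one has `A_j ≥ 18`, and
  then the inexactness criterion holds automatically (`AcgCert.inexact`) and all later iterates have
  comparable residuals (`AcgCert.dist_le`). So an AIPP iteration costs `O(s)` ACG steps, and the last
  one, which has to reach `ε ≤ λ ε̂`, costs `O(s (1 + log s))` (`proxIter_eps_le`).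
* *AIPP.* An iteration that does not stop decreases `λ (f_c + h)` by a multiple of `(λ ρ_x)²`
  (`AcgCert.descent`). The first iterate already competes with every feasible point
  (`AcgCert.value_le`), which bounds the number of iterations in terms of `R`, independently of `c`
  (`solves_loop`, `solves_aipp`). The final composite gradient step yields a residual of norm at
  most `ρ_x` (`gradient_step`).
* *Penalty.* The same comparison bounds `(c - ĉ) ‖A x̄ - b‖²` by a multiple of
  `m (R + D_y² / (m ξ))`, so that the doubling stops (`solves_penalty`). The costs grow geometrically
  with `√c`, hence add up to a multiple of the last one (`solves_doubling`), which
  `condProxy_le_omega` bounds by `Ω_{ξ,η}`.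
-/

set_option linter.unusedSectionVars false

/-! ### Proximal steps and smooth functions on convex sets -/

theorem argminOn_spec {α : Type*} [Nonempty α] {S : Set α} {g : α → ℝ}
    (h : ∃ x ∈ S, ∀ x' ∈ S, g x ≤ g x') :
    argminOn S g ∈ S ∧ ∀ x' ∈ S, g (argminOn S g) ≤ g x' :=
  Classical.epsilon_spec h

section Convexity

variable {E : Type*} [NormedAddCommGroup E] [InnerProductSpace ℝ E]

theorem norm_sq_combo (a b : ℝ) (hab : a + b = 1) (x y w : E) :
    ‖a • x + b • y - w‖ ^ 2 =
      a * ‖x - w‖ ^ 2 + b * ‖y - w‖ ^ 2 - a * b * ‖y - x‖ ^ 2 := by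
  have h1 : a • x + b • y - w = a • (x - w) + b • (y - w) := by
    have : w = a • w + b • w := by rw [← add_smul, hab, one_smul]
    nth_rewrite 1 [this]
    module
  have h2 : y - x = (y - w) - (x - w) := by abel
  rw [h1, h2]
  generalize x - w = p
  generalize y - w = q
  rw [norm_add_sq_real, norm_sub_sq_real, norm_smul, norm_smul, inner_smul_left, inner_smul_right,
    mul_pow, mul_pow, Real.norm_eq_abs, Real.norm_eq_abs, sq_abs, sq_abs, real_inner_comm q p]
  obtain rfl : b = 1 - a := by linarith
  simp only [conj_trivial]
  ring

/-- The three-point inequality: the objective of a proximal problem is strongly convex, hence it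
grows quadratically away from its minimizer. -/
theorem ConvexOn.prox_three_point {S : Set E} {k : E → ℝ} (hk : ConvexOn ℝ S k) {w y : E}
    (hy : y ∈ S) (hmin : ∀ x ∈ S, k y + 1 / 2 * ‖y - w‖ ^ 2 ≤ k x + 1 / 2 * ‖x - w‖ ^ 2)
    {x : E} (hx : x ∈ S) :
    k y + 1 / 2 * ‖y - w‖ ^ 2 + 1 / 2 * ‖x - y‖ ^ 2 ≤ k x + 1 / 2 * ‖x - w‖ ^ 2 := by
  by_contra! hlt
  set D := ‖x - y‖ ^ 2 with hD
  have hD0 : 0 ≤ D := by positivity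
  -- The failure gap `g > 0` is contradicted at the point `(1 - s) y + s x` with `s D ≤ g`.
  set g := k y + 1 / 2 * ‖y - w‖ ^ 2 + 1 / 2 * D - (k x + 1 / 2 * ‖x - w‖ ^ 2) with hg
  have hg0 : 0 < g := by linarith
  set s := g / (g + D) with hs
  have hgD : 0 < g + D := by linarith
  have hs0 : 0 < s := by positivity
  have hs1 : s ≤ 1 := by rw [hs, div_le_one hgD]; linarith
  have hsD : s * (g + D) = g := by rw [hs]; field_simp
  have hconv := hk.2 hy hx (by linarith : (0 : ℝ) ≤ 1 - s) hs0.le (by ring)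
  have hmem := hk.1 hy hx (by linarith : (0 : ℝ) ≤ 1 - s) hs0.le (by ring)
  have hm := hmin _ hmem
  rw [norm_sq_combo (1 - s) s (by ring) y x w, ← hD] at hm
  simp only [smul_eq_mul] at hconv
  have hfin : s * (1 / 2 * (1 - s) * D) ≤ s * (1 / 2 * D - g) := by
    rw [hg]; nlinarith
  have := le_of_mul_le_mul_left hfin hs0
  nlinarith [mul_pos hs0 hg0]

/-- A closed convex function is bounded below on compact sets. -/
theorem QPAIPPS.ClosedConvexOn.exists_lower_bound {S : Set E} {ψ : E → ℝ}
    (h : ClosedConvexOn S ψ) {K : Set E} (hK : IsCompact K) :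
    ∃ m : ℝ, ∀ x ∈ K, x ∈ S → m ≤ ψ x := by
  refine hK.induction_on (p := fun K => ∃ m : ℝ, ∀ x ∈ K, x ∈ S → m ≤ ψ x) ⟨0, by simp⟩ ?_ ?_ ?_
  · rintro s t hst ⟨m, hm⟩
    exact ⟨m, fun x hx => hm x (hst hx)⟩
  · rintro s t ⟨m, hm⟩ ⟨m', hm'⟩
    refine ⟨min m m', ?_⟩
    rintro x (hx | hx) hxS
    · exact (min_le_left _ _).trans (hm x hx hxS)
    · exact (min_le_right _ _).trans (hm' x hx hxS)
  · intro x _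
    have hout : (x, ψ x - 1) ∈ {q : E × ℝ | q.1 ∈ S ∧ ψ q.1 ≤ q.2}ᶜ := by
      simp
    have hnhds := h.2.2.isOpen_compl.mem_nhds hout
    rw [nhds_prod_eq, Filter.mem_prod_iff] at hnhds
    obtain ⟨U, hU, V, hV, hUV⟩ := hnhds
    refine ⟨U, mem_nhdsWithin_of_mem_nhds hU, ψ x - 1, fun z hz hzS => ?_⟩
    have := hUV (Set.mk_mem_prod hz (mem_of_mem_nhds hV))
    simp only [Set.mem_compl_iff, Set.mem_ofPred_eq, not_and, not_le] at this
    exact (this hzS).le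

/-- Proximal problems of closed convex functions are solvable. -/
theorem QPAIPPS.ClosedConvexOn.exists_prox [FiniteDimensional ℝ E] {S : Set E} {ψ : E → ℝ}
    (h : ClosedConvexOn S ψ) {t : ℝ} (ht : 0 < t) (a : E) :
    ∃ x ∈ S, ∀ x' ∈ S, t * ψ x + 1 / 2 * ‖x - a‖ ^ 2 ≤ t * ψ x' + 1 / 2 * ‖x' - a‖ ^ 2 := by
  obtain ⟨z, hz⟩ := h.1
  obtain ⟨m, hm⟩ := h.exists_lower_bound (isCompact_closedBall z 1)
  have hmz : m ≤ ψ z := hm z (by simp) hz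
  -- Convexity turns the bound on the unit ball around `z` into a bound of linear growth.
  have hlin : ∀ x ∈ S, ψ z - (ψ z - m) * (1 + ‖x - z‖) ≤ ψ x := by
    intro x hx
    rcases le_total ‖x - z‖ 1 with hle | hge
    · have := hm x (by simpa [dist_eq_norm] using hle) hx
      nlinarith [norm_nonneg (x - z)]
    · set r := ‖x - z‖ with hr
      have hr0 : 0 < r := by linarith
      have hri : r⁻¹ ≤ 1 := inv_le_one_of_one_le₀ hge
      have hri0 : 0 < r⁻¹ := by positivity
      have hmem := h.2.1.1 hz hx (by linarith : (0 : ℝ) ≤ 1 - r⁻¹) hri0.le (by ring)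
      have hconv := h.2.1.2 hz hx (by linarith : (0 : ℝ) ≤ 1 - r⁻¹) hri0.le (by ring)
      have hb : (1 - r⁻¹) • z + r⁻¹ • x ∈ Metric.closedBall z 1 := by
        rw [mem_closedBall_iff_norm]
        have : (1 - r⁻¹) • z + r⁻¹ • x - z = r⁻¹ • (x - z) := by module
        rw [this, norm_smul, Real.norm_of_nonneg hri0.le, ← hr, inv_mul_cancel₀ hr0.ne']
      have h1 := (hm _ hb hmem).trans hconv
      simp only [smul_eq_mul] at h1
      have h2 := mul_le_mul_of_nonneg_left h1 hr0.le
      have h3 : r * ((1 - r⁻¹) * ψ z + r⁻¹ * ψ x) = (r - 1) * ψ z + ψ x := by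
        field_simp
      rw [h3] at h2
      nlinarith
  let f : E × ℝ → ℝ := fun q => t * q.2 + 1 / 2 * ‖q.1 - a‖ ^ 2
  have hf : Continuous f := by fun_prop
  set v := t * ψ z + 1 / 2 * ‖z - a‖ ^ 2 with hv
  set B := t * (ψ z - m) with hB
  have hB0 : 0 ≤ B := mul_nonneg ht.le (by linarith)
  -- Beyond this radius the objective exceeds its value `v` at `z`.
  set ρ := 2 * ‖z - a‖ + 2 * B + 2 with hρ
  have hfar : ∀ x ∈ S, ∀ r, ψ x ≤ r → f (x, r) ≤ v → ‖x - z‖ ≤ ρ := by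
    intro x hx r hr hle
    have h1 := hlin x hx
    simp only [f] at hle
    have h2 : ‖x - z‖ - ‖z - a‖ ≤ ‖x - a‖ := by
      have := norm_sub_le (x - a) (z - a)
      have h' : x - a - (z - a) = x - z := by abel
      rw [h'] at this; linarith
    by_contra! hlt
    have h3 : t * (ψ z - (ψ z - m) * (1 + ‖x - z‖)) ≤ t * r :=
      mul_le_mul_of_nonneg_left (h1.trans hr) ht.le
    have h4 : t * (ψ z - (ψ z - m) * (1 + ‖x - z‖)) = t * ψ z - B * (1 + ‖x - z‖) := by
      rw [hB]; ring
    have hza := norm_nonneg (z - a)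
    have h5 : (‖x - z‖ - ‖z - a‖) ^ 2 ≤ ‖x - a‖ ^ 2 :=
      pow_le_pow_left₀ (by linarith) h2 2
    nlinarith [mul_nonneg hB0 hza]
  have hepi := h.2.2
  set epi := {q : E × ℝ | q.1 ∈ S ∧ ψ q.1 ≤ q.2} with hepidef
  set K := epi ∩ Metric.closedBall z ρ ×ˢ
    Set.Icc (ψ z - (ψ z - m) * (1 + ρ)) (v / t) with hK
  have hKc : IsCompact K := ((isCompact_closedBall z ρ).prod isCompact_Icc).inter_left hepi
  have hin : ∀ x ∈ S, ∀ r, ψ x ≤ r → f (x, r) ≤ v → (x, r) ∈ K := by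
    intro x hx r hr hle
    have h1 := hfar x hx r hr hle
    refine ⟨⟨hx, hr⟩, ?_, ?_, ?_⟩
    · rw [mem_closedBall_iff_norm]; exact h1
    · have := hlin x hx
      simp only
      nlinarith
    · rw [le_div_iff₀ ht]
      simp only [f] at hle
      nlinarith [sq_nonneg ‖x - a‖]
  have hKne : K.Nonempty := ⟨(z, ψ z), hin z hz _ le_rfl le_rfl⟩
  obtain ⟨q, hq, hmin⟩ := hKc.exists_isMinOn hKne hf.continuousOn
  refine ⟨q.1, hq.1.1, fun x' hx' => ?_⟩
  have hqv : f q ≤ v := hmin (hin z hz _ le_rfl le_rfl)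
  have hq2 : t * ψ q.1 + 1 / 2 * ‖q.1 - a‖ ^ 2 ≤ f q := by
    simp only [f]
    have := mul_le_mul_of_nonneg_left hq.1.2 ht.le
    linarith
  rcases le_total (f (x', ψ x')) v with hle | hge
  · exact hq2.trans (hmin (hin x' hx' _ le_rfl hle))
  · exact hq2.trans (hqv.trans hge)

/-- The quadratic upper bound of a function with Lipschitz gradient on a convex set. -/
theorem le_quadratic_of_lipschitz_gradient [CompleteSpace E] {S : Set E} (hS : Convex ℝ S)
    {f : E → ℝ} {g : E → E}
    {L : ℝ} (hf : ∀ x ∈ S, HasGradientAt f (g x) x)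
    (hg : ∀ x ∈ S, ∀ y ∈ S, ‖g x - g y‖ ≤ L * ‖x - y‖) {x y : E} (hx : x ∈ S) (hy : y ∈ S) :
    f x ≤ f y + inner ℝ (g y) (x - y) + L / 2 * ‖x - y‖ ^ 2 := by
  set d := x - y with hd
  have hmem : ∀ t ∈ Set.Icc (0 : ℝ) 1, y + t • d ∈ S := by
    intro t ht
    have := hS hy hx (by linarith [ht.2] : (0 : ℝ) ≤ 1 - t) ht.1 (by ring)
    have h' : (1 - t) • y + t • x = y + t • d := by rw [hd]; module
    rwa [h'] at this
  set φ : ℝ → ℝ := fun t => f (y + t • d) - t * inner ℝ (g y) d - L / 2 * ‖d‖ ^ 2 * t ^ 2 with hφ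
  have hder : ∀ t ∈ Set.Icc (0 : ℝ) 1, HasDerivAt φ
      (inner ℝ (g (y + t • d)) d - inner ℝ (g y) d - L * ‖d‖ ^ 2 * t) t := by
    intro t ht
    have h1 : HasDerivAt (fun t : ℝ => y + t • d) d t := by
      simpa using ((hasDerivAt_id t).smul_const d).const_add y
    have h2 := (hf _ (hmem t ht)).hasFDerivAt.comp_hasDerivAt t h1
    have h3 := (h2.sub ((hasDerivAt_id t).mul_const (inner ℝ (g y) d))).sub
      ((hasDerivAt_pow 2 t).const_mul (L / 2 * ‖d‖ ^ 2))
    refine (h3.congr_deriv ?_)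
    simp
    ring
  have hanti : AntitoneOn φ (Set.Icc 0 1) := by
    refine antitoneOn_of_deriv_nonpos (convex_Icc 0 1)
      (fun t ht => (hder t ht).continuousAt.continuousWithinAt) ?_ ?_
    · intro t ht
      exact (hder t (interior_subset ht)).differentiableAt.differentiableWithinAt
    · intro t ht
      have ht' := interior_subset ht
      rw [(hder t ht').deriv]
      have h1 := hg _ (hmem t ht') y hy
      have h2 : y + t • d - y = t • d := by abel
      rw [h2, norm_smul, Real.norm_of_nonneg ht'.1] at h1
      have h3 := real_inner_le_norm (g (y + t • d) - g y) d
      rw [inner_sub_left] at h3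
      have h4 := mul_le_mul_of_nonneg_right h1 (norm_nonneg d)
      nlinarith
  have h01 := hanti (by simp : (0 : ℝ) ∈ Set.Icc (0 : ℝ) 1) (by simp : (1 : ℝ) ∈ Set.Icc (0 : ℝ) 1)
    zero_le_one
  simp only [hφ, one_smul, zero_smul, add_zero] at h01
  have hxy : y + d = x := by rw [hd]; abel
  rw [hxy] at h01
  linarith

end Convexity

/-! ### The smoothed max function -/

section Danskin

variable {E : Type*} {F : Type*} [NormedAddCommGroup E] [InnerProductSpace ℝ E] [CompleteSpace E]
  [NormedAddCommGroup F]

open Filter Topology in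
/-- Danskin's theorem for a selection `ys` of maximizers that is continuous at `x`: the increment of
the max function lies between the increments of `Ψ(·, ys x)` and `Ψ(·, ys x')`. -/
theorem hasGradientAt_of_maximizer {O : Set E} {Y : Set F} {Ψ : E → F → ℝ} {G : E → F → E}
    {v : E → ℝ} {ys : E → F} {x : E} (hO : IsOpen O) (hx : x ∈ O)
    (hΨ : ∀ x' ∈ O, ∀ y ∈ Y, HasGradientAt (fun x'' => Ψ x'' y) (G x' y) x')
    (hG : ContinuousOn (fun q : E × F => G q.1 q.2) (O ×ˢ Y))
    (hys : ∀ x' ∈ O, ys x' ∈ Y) (hv : ∀ x' ∈ O, v x' = Ψ x' (ys x'))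
    (hle : ∀ x' ∈ O, ∀ y ∈ Y, Ψ x' y ≤ v x') (hcont : Tendsto ys (𝓝 x) (𝓝 (ys x))) :
    HasGradientAt v (G x (ys x)) x := by
  rw [hasGradientAt_iff_isLittleO, Asymptotics.isLittleO_iff]
  intro ε hε
  have hGx := hG (x, ys x) ⟨hx, hys x hx⟩
  rw [Metric.continuousWithinAt_iff] at hGx
  obtain ⟨δ, hδ, hGδ⟩ := hGx ε hε
  obtain ⟨r, hr, hrO⟩ := Metric.isOpen_iff.1 hO x hx
  set s := min r δ with hs
  have hs0 : 0 < s := lt_min hr hδ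
  have hsO : Metric.ball x s ⊆ O := (Metric.ball_subset_ball (min_le_left _ _)).trans hrO
  have hmv : ∀ x' ∈ Metric.ball x s, ∀ y ∈ Y, dist y (ys x) < δ →
      |Ψ x' y - Ψ x y - inner ℝ (G x (ys x)) (x' - x)| ≤ ε * ‖x' - x‖ := by
    intro x' hx' y hy hyd
    have := (convex_ball x s).norm_image_sub_le_of_norm_hasFDerivWithin_le'
      (f := fun x'' => Ψ x'' y) (f' := fun z => InnerProductSpace.toDual ℝ E (G z y))
      (φ := InnerProductSpace.toDual ℝ E (G x (ys x))) (C := ε)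
      (fun z hz => ((hΨ z (hsO hz) y hy).hasFDerivAt).hasFDerivWithinAt)
      (fun z hz => by
        rw [← map_sub, LinearIsometryEquiv.norm_map, ← dist_eq_norm]
        refine (hGδ (x := (z, y)) ⟨hsO hz, hy⟩ ?_).le
        rw [Prod.dist_eq, max_lt_iff]
        exact ⟨lt_of_lt_of_le hz (min_le_right _ _), hyd⟩)
      (Metric.mem_ball_self hs0) hx'
    simpa using this
  filter_upwards [Metric.ball_mem_nhds x hs0, hcont (Metric.ball_mem_nhds _ hδ)] with x' hx' hy'
  have h1 := abs_le.1 (hmv x' hx' (ys x) (hys x hx) (by simpa using hδ))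
  have h2 := abs_le.1 (hmv x' hx' (ys x') (hys x' (hsO hx')) hy')
  have h3 := hle x' (hsO hx') (ys x) (hys x hx)
  have h4 := hle x hx (ys x') (hys x' (hsO hx'))
  rw [Real.norm_eq_abs, abs_le]
  rw [hv x hx] at *
  rw [hv x' (hsO hx')] at *
  constructor <;> linarith

end Danskin

section Smoothing

variable {E : Type*} {F : Type*} {U : Type*}
  [NormedAddCommGroup E] [InnerProductSpace ℝ E] [CompleteSpace E]
  [NormedAddCommGroup F] [InnerProductSpace ℝ F]
  [NormedAddCommGroup U] [InnerProductSpace ℝ U]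

/-- The maximizer `y_ξ(x)` of `Φ(x, y) - ‖y - y₀‖² / (2 ξ)` over `Y`, written as the answer of the
oracle that the scheme calls. -/
noncomputable def smoothArg (P : Problem E F U) (ξ : ℝ) (y₀ : F) (x : E) : F :=
  argminOn P.Y fun y' => -(ξ * P.Φ x y' - 1 / 2 * ‖y' - y₀‖ ^ 2)

/-- The gradient `∇ₓΦ(x, y_ξ(x))` of the smoothed max function. -/
noncomputable def smoothGrad (P : Problem E F U) (ξ : ℝ) (y₀ : F) (x : E) : E :=
  P.gradPhi x (smoothArg P ξ y₀ x)

variable {P : Problem E F U} {m Lx Ly chat ξ : ℝ} {x : E}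

theorem standing_hasGradientAt (hP : P.Standing m Lx Ly chat) {y : F} (hx : x ∈ P.X) (hy : y ∈ P.Y) :
    HasGradientAt (fun x' => P.Φ x' y) (P.gradPhi x y) x := by
  obtain ⟨O, _, hXO, _, hd, _, _⟩ := hP.Φ_regular
  exact (hd x (hXO hx) y hy).hasGradientAt

theorem standing_concave (hP : P.Standing m Lx Ly chat) (hx : x ∈ P.X) : ClosedConvexOn P.Y fun y => -P.Φ x y := by
  obtain ⟨O, _, hXO, _, _, _, hc⟩ := hP.Φ_regular
  exact hc x (hXO hx)

theorem norm_sub_le_Dy (hP : P.Standing m Lx Ly chat) {y y' : F} (hy : y ∈ P.Y) (hy' : y' ∈ P.Y) : ‖y - y'‖ ≤ P.Dy := by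
  rw [← dist_eq_norm]
  exact Metric.dist_le_diam_of_mem hP.Y_compact.isBounded hy hy'

variable [FiniteDimensional ℝ F]

theorem smoothArg_spec (hx : ClosedConvexOn P.Y fun y => -P.Φ x y) (hξ : 0 < ξ) (y₀ : F) :
    smoothArg P ξ y₀ x ∈ P.Y ∧ ∀ y ∈ P.Y,
      ξ * P.Φ x y - 1 / 2 * ‖y - y₀‖ ^ 2 + 1 / 2 * ‖y - smoothArg P ξ y₀ x‖ ^ 2 ≤
        ξ * P.Φ x (smoothArg P ξ y₀ x) - 1 / 2 * ‖smoothArg P ξ y₀ x - y₀‖ ^ 2 := by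
  have hex : ∃ y ∈ P.Y, ∀ y' ∈ P.Y, -(ξ * P.Φ x y - 1 / 2 * ‖y - y₀‖ ^ 2) ≤
      -(ξ * P.Φ x y' - 1 / 2 * ‖y' - y₀‖ ^ 2) := by
    obtain ⟨y, hy, hmin⟩ := hx.exists_prox hξ y₀
    exact ⟨y, hy, fun y' hy' => by linarith [hmin y' hy']⟩
  obtain ⟨hmem, hmin⟩ := argminOn_spec hex
  refine ⟨hmem, fun y hy => ?_⟩
  have hconv : ConvexOn ℝ P.Y fun y => ξ * (-P.Φ x y) := by
    simpa using hx.2.1.smul hξ.le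
  have := hconv.prox_three_point (w := y₀) hmem
    (fun y' hy' => by have := hmin y' hy'; linarith) hy
  unfold smoothArg at *
  linarith

/-- The supremum `p_ξ(x)` is attained at `y_ξ(x)`, with quadratic decay away from it. -/
theorem pSmooth_eq (hx : ClosedConvexOn P.Y fun y => -P.Φ x y) (hξ : 0 < ξ) (y₀ : F) :
    P.pSmooth ξ y₀ x =
        P.Φ x (smoothArg P ξ y₀ x) - 1 / (2 * ξ) * ‖smoothArg P ξ y₀ x - y₀‖ ^ 2 ∧
      ∀ y ∈ P.Y, P.Φ x y - 1 / (2 * ξ) * ‖y - y₀‖ ^ 2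
        + 1 / (2 * ξ) * ‖y - smoothArg P ξ y₀ x‖ ^ 2 ≤ P.pSmooth ξ y₀ x := by
  obtain ⟨hmem, hmax⟩ := smoothArg_spec hx hξ y₀
  have hmax' : ∀ y ∈ P.Y, P.Φ x y - 1 / (2 * ξ) * ‖y - y₀‖ ^ 2
        + 1 / (2 * ξ) * ‖y - smoothArg P ξ y₀ x‖ ^ 2 ≤
        P.Φ x (smoothArg P ξ y₀ x) - 1 / (2 * ξ) * ‖smoothArg P ξ y₀ x - y₀‖ ^ 2 := by
    intro y hy
    have h1 := mul_le_mul_of_nonneg_left (hmax y hy) (inv_pos.2 hξ).le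
    have h2 : ∀ t s : ℝ, ξ⁻¹ * (ξ * t - 1 / 2 * s) = t - 1 / (2 * ξ) * s := by
      intro t s; field_simp
    rw [mul_add, h2, h2] at h1
    have h3 : ∀ s : ℝ, ξ⁻¹ * (1 / 2 * s) = 1 / (2 * ξ) * s := by intro s; field_simp
    rw [h3] at h1
    exact h1
  have heq : P.pSmooth ξ y₀ x =
      P.Φ x (smoothArg P ξ y₀ x) - 1 / (2 * ξ) * ‖smoothArg P ξ y₀ x - y₀‖ ^ 2 := by
    refine IsGreatest.csSup_eq ⟨⟨_, hmem, rfl⟩, ?_⟩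
    rintro _ ⟨y, hy, rfl⟩
    have := hmax' y hy
    have h0 : 0 ≤ 1 / (2 * ξ) * ‖y - smoothArg P ξ y₀ x‖ ^ 2 := by positivity
    simp only
    linarith
  exact ⟨heq, fun y hy => heq ▸ hmax' y hy⟩

open Filter Topology in
/-- The maximizer is unique by strong concavity, and `Φ(x', ·) → Φ(x, ·)` uniformly on the compact
set `Y`, so that the maximizers converge. -/
theorem tendsto_smoothArg {O : Set E} (hO : IsOpen O) (hY : IsCompact P.Y)
    (hΦ : ContinuousOn (fun q : E × F => P.Φ q.1 q.2) (O ×ˢ P.Y))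
    (hc : ∀ x ∈ O, ClosedConvexOn P.Y (fun y => -P.Φ x y)) (hξ : 0 < ξ) (y₀ : F) (hx : x ∈ O) :
    Tendsto (smoothArg P ξ y₀) (𝓝 x) (𝓝 (smoothArg P ξ y₀ x)) := by
  rw [Metric.tendsto_nhds]
  intro ε hε
  obtain ⟨V, hV, hVu⟩ := hY.mem_uniformity_of_prod (f := P.Φ) hΦ hx
    (Metric.dist_mem_uniformity (show 0 < ε ^ 2 / (4 * ξ) by positivity))
  rw [hO.nhdsWithin_eq hx] at hV
  filter_upwards [hV, hO.mem_nhds hx] with x' hx'V hx'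
  obtain ⟨hm, hmax⟩ := smoothArg_spec (hc x hx) hξ y₀
  obtain ⟨hm', hmax'⟩ := smoothArg_spec (hc x' hx') hξ y₀
  set y := smoothArg P ξ y₀ x
  set y' := smoothArg P ξ y₀ x'
  have h1 := hmax y' hm'
  have h2 := hmax' y hm
  have h3 := hVu x' hx'V y hm
  have h4 := hVu x' hx'V y' hm'
  simp only [Set.mem_ofPred_eq, Real.dist_eq, abs_lt] at h3 h4
  rw [norm_sub_rev y y'] at h2
  have h5 : ξ * (P.Φ x y - P.Φ x' y) ≤ ξ * (ε ^ 2 / (4 * ξ)) :=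
    mul_le_mul_of_nonneg_left (by linarith [h3.1]) hξ.le
  have h6 : ξ * (P.Φ x' y' - P.Φ x y') < ξ * (ε ^ 2 / (4 * ξ)) :=
    mul_lt_mul_of_pos_left (by linarith [h4.2]) hξ
  have h7 : ξ * (ε ^ 2 / (4 * ξ)) = ε ^ 2 / 4 := by field_simp
  rw [dist_eq_norm]
  refine lt_of_pow_lt_pow_left₀ 2 hε.le ?_
  nlinarith

theorem hasGradientAt_pSmooth (hP : P.Standing m Lx Ly chat) (hξ : 0 < ξ) (y₀ : F) (hx : x ∈ P.X) :
    HasGradientAt (P.pSmooth ξ y₀) (smoothGrad P ξ y₀ x) x := by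
  obtain ⟨O, hO, hXO, hΦ, hd, hG, hc⟩ := hP.Φ_regular
  refine hasGradientAt_of_maximizer (Ψ := fun x' y => P.Φ x' y - 1 / (2 * ξ) * ‖y - y₀‖ ^ 2)
    (G := P.gradPhi) (ys := smoothArg P ξ y₀) hO (hXO hx) ?_ hG
    (fun x' hx' => (smoothArg_spec (hc x' hx') hξ y₀).1)
    (fun x' hx' => (pSmooth_eq (hc x' hx') hξ y₀).1) ?_
    (tendsto_smoothArg hO hP.Y_compact hΦ hc hξ y₀ (hXO hx))
  · intro x' hx' y hy
    have := (hd x' hx' y hy).hasGradientAt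
    rw [hasGradientAt_iff_hasFDerivAt] at this ⊢
    exact this.sub_const _
  · intro x' hx' y hy
    have := (pSmooth_eq (hc x' hx') hξ y₀).2 y hy
    have h0 : 0 ≤ 1 / (2 * ξ) * ‖y - smoothArg P ξ y₀ x'‖ ^ 2 := by positivity
    linarith

/-- The lower curvature of `Φ(·, y)` passes to the smoothed max function. -/
theorem pSmooth_lower (hP : P.Standing m Lx Ly chat) (hξ : 0 < ξ) (y₀ : F) {x' : E} (hx : x ∈ P.X) (hx' : x' ∈ P.X) :
    P.pSmooth ξ y₀ x' + inner ℝ (smoothGrad P ξ y₀ x') (x - x') - m / 2 * ‖x - x'‖ ^ 2 ≤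
      P.pSmooth ξ y₀ x := by
  have hc' := standing_concave hP hx'
  obtain ⟨hm, -⟩ := smoothArg_spec hc' hξ y₀
  have h1 := (pSmooth_eq (standing_concave hP hx) hξ y₀).2 _ hm
  have h0 : 0 ≤ 1 / (2 * ξ) * ‖smoothArg P ξ y₀ x' - smoothArg P ξ y₀ x‖ ^ 2 := by positivity
  rw [(pSmooth_eq hc' hξ y₀).1]
  have h2 := hP.lower_curvature x hx x' hx' _ hm
  unfold smoothGrad
  linarith

theorem phi_upper (hP : P.Standing m Lx Ly chat) {y : F} {x' : E} (hx : x ∈ P.X) (hx' : x' ∈ P.X) (hy : y ∈ P.Y) :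
    P.Φ x y ≤ P.Φ x' y + inner ℝ (P.gradPhi x' y) (x - x') + Lx / 2 * ‖x - x'‖ ^ 2 :=
  le_quadratic_of_lipschitz_gradient (f := fun x => P.Φ x y) (g := fun x => P.gradPhi x y)
    hP.X_convex (fun _ h => standing_hasGradientAt hP h hy)
    (fun a ha b hb => by simpa using hP.grad_lipschitz a ha b hb y hy y hy) hx hx'

/-- Adding the strong concavity inequalities at `x` and `x'` leaves a difference of increments of `Φ`
in `x`, which the two curvature bounds and the Lipschitz condition in `y` control. -/
theorem smoothArg_lipschitz (hP : P.Standing m Lx Ly chat) (hξ : 0 < ξ) (y₀ : F) {x' : E} (hx : x ∈ P.X) (hx' : x' ∈ P.X) :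
    ‖smoothArg P ξ y₀ x - smoothArg P ξ y₀ x'‖ ≤
      (ξ * Ly + √(ξ * (Lx + m))) * ‖x - x'‖ := by
  obtain ⟨hm, hmax⟩ := smoothArg_spec (standing_concave hP hx) hξ y₀
  obtain ⟨hm', hmax'⟩ := smoothArg_spec (standing_concave hP hx') hξ y₀
  set y := smoothArg P ξ y₀ x
  set y' := smoothArg P ξ y₀ x'
  have h1 := hmax y' hm'
  have h2 := hmax' y hm
  rw [norm_sub_rev y' y] at h1
  have h3 := phi_upper hP hx hx' hm
  have h4 := hP.lower_curvature x hx x' hx' y' hm'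
  have h5 : inner ℝ (P.gradPhi x' y - P.gradPhi x' y') (x - x') ≤
      Ly * ‖y - y'‖ * ‖x - x'‖ := by
    refine (real_inner_le_norm _ _).trans (mul_le_mul_of_nonneg_right ?_ (norm_nonneg _))
    simpa using hP.grad_lipschitz x' hx' x' hx' y hm y' hm'
  rw [inner_sub_left] at h5
  set s := ‖y - y'‖
  set d := ‖x - x'‖
  have hs : 0 ≤ s := norm_nonneg _
  have hd : 0 ≤ d := norm_nonneg _
  have h6 : s ^ 2 ≤ ξ * Ly * (s * d) + ξ * (Lx + m) / 2 * d ^ 2 := by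
    have h7 : P.Φ x y - P.Φ x' y + (P.Φ x' y' - P.Φ x y') ≤
        Ly * (s * d) + (Lx + m) / 2 * d ^ 2 := by linarith
    have := mul_le_mul_of_nonneg_left h7 hξ.le
    linarith
  have hLm : 0 ≤ ξ * (Lx + m) := mul_nonneg hξ.le (by linarith [hP.Lx_pos, hP.m_pos])
  have hsq := Real.sq_sqrt hLm
  have hr := Real.sqrt_nonneg (ξ * (Lx + m))
  set r := √(ξ * (Lx + m))
  -- Now `s` lies below the positive root of a quadratic polynomial.
  by_contra! hlt
  have hLy : 0 ≤ ξ * Ly := mul_nonneg hξ.le hP.Ly_pos.le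
  have h8 : r * d ≤ s := by nlinarith [mul_nonneg hLy hd]
  have h9 : (r * d) ^ 2 ≤ s * (r * d) := by nlinarith [mul_nonneg hr hd]
  have h10 : (ξ * Ly + r) * d * s < s * s ∨ s = 0 := by
    rcases hs.eq_or_lt with h | h
    · exact .inr h.symm
    · exact .inl (mul_lt_mul_of_pos_right hlt h)
  rcases h10 with h | h
  · rw [← hsq] at h6
    nlinarith
  · rw [h] at hlt
    nlinarith [mul_nonneg hLy hd, mul_nonneg hr hd]

theorem smoothGrad_lipschitz (hP : P.Standing m Lx Ly chat) (hξ : 0 < ξ) (y₀ : F) {x' : E} (hx : x ∈ P.X) (hx' : x' ∈ P.X) :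
    ‖smoothGrad P ξ y₀ x - smoothGrad P ξ y₀ x'‖ ≤ Lsmooth m Lx Ly ξ * ‖x - x'‖ := by
  have h1 := hP.grad_lipschitz x hx x' hx' _
    (smoothArg_spec (standing_concave hP hx) hξ y₀).1 _
    (smoothArg_spec (standing_concave hP hx') hξ y₀).1
  have h2 := mul_le_mul_of_nonneg_left (smoothArg_lipschitz hP hξ y₀ hx hx') hP.Ly_pos.le
  unfold smoothGrad Lsmooth
  linarith

theorem pSmooth_le_p (hP : P.Standing m Lx Ly chat) (hξ : 0 < ξ) (y₀ : F) (hx : x ∈ P.X) : P.pSmooth ξ y₀ x ≤ P.p x := by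
  obtain ⟨O, hO, hXO, hΦ, hd, hG, hc⟩ := hP.Φ_regular
  have hcont : ContinuousOn (fun y => P.Φ x y) P.Y :=
    hΦ.comp (Continuous.continuousOn (by fun_prop : Continuous fun y : F => (x, y)))
      fun y hy => ⟨hXO hx, hy⟩
  rw [(pSmooth_eq (hc x (hXO hx)) hξ y₀).1]
  have h1 := le_csSup (hP.Y_compact.image_of_continuousOn hcont).bddAbove
    ⟨_, (smoothArg_spec (hc x (hXO hx)) hξ y₀).1, rfl⟩
  have h0 : 0 ≤ 1 / (2 * ξ) * ‖smoothArg P ξ y₀ x - y₀‖ ^ 2 := by positivity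
  exact (sub_le_self _ h0).trans h1

theorem p_le_pSmooth (hP : P.Standing m Lx Ly chat) (hξ : 0 < ξ) {y₀ : F} (hy₀ : y₀ ∈ P.Y) (hx : x ∈ P.X) :
    P.p x ≤ P.pSmooth ξ y₀ x + P.Dy ^ 2 / (2 * ξ) := by
  refine csSup_le (hP.Y_nonempty.image _) ?_
  rintro _ ⟨y, hy, rfl⟩
  have h1 := (pSmooth_eq (standing_concave hP hx) hξ y₀).2 y hy
  have h0 : 0 ≤ 1 / (2 * ξ) * ‖y - smoothArg P ξ y₀ x‖ ^ 2 := by positivity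
  have h2 : 1 / (2 * ξ) * ‖y - y₀‖ ^ 2 ≤ 1 / (2 * ξ) * P.Dy ^ 2 :=
    mul_le_mul_of_nonneg_left (pow_le_pow_left₀ (norm_nonneg _) (norm_sub_le_Dy hP hy hy₀) 2)
      (by positivity)
  have h3 : 1 / (2 * ξ) * P.Dy ^ 2 = P.Dy ^ 2 / (2 * ξ) := by ring
  simp only
  linarith

end Smoothing

/-! ### The accelerated composite gradient method -/

section AcgMethod

variable {E : Type*} {F : Type*} {U : Type*}
  [NormedAddCommGroup E] [InnerProductSpace ℝ E]
  [NormedAddCommGroup F] [InnerProductSpace ℝ F]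
  [NormedAddCommGroup U] [InnerProductSpace ℝ U]

theorem exec_bind [CompleteSpace E] (P : Problem E F U) {α β : Type*} (p : Prog E F α)
    (f : α → Prog E F β) :
    (p.bind f).exec P =
      (((f (p.exec P).1).exec P).1, (p.exec P).2 + ((f (p.exec P).1).exec P).2) := by
  induction p with
  | ret r => simp [Prog.bind, Prog.exec]
  | evalPhi x y k ih => simp [Prog.bind, Prog.exec, ih]; omega
  | evalGrad x y k ih => simp [Prog.bind, Prog.exec, ih]; omega
  | evalH x k ih => simp [Prog.bind, Prog.exec, ih]; omega
  | proxH l x k ih => simp [Prog.bind, Prog.exec, ih]; omega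
  | proxPhi l x y k ih => simp [Prog.bind, Prog.exec, ih]; omega

/-- The sequence `A_{j+1}` of the ACG method as a function of `A_j`. -/
noncomputable def acgCoeff (μ L A : ℝ) : ℝ :=
  A + (μ * A + 1 + √((μ * A + 1) ^ 2 + 4 * L * (μ * A + 1) * A)) / (2 * L)

/-- One ACG iteration as a function of the state, when the oracle answers are `ψs`, `gs = ∇ψs`, `ψn`
and the resolvent `rs` of `ψn`. -/
noncomputable def acgUpdate (μ L : ℝ) (ψs : E → ℝ) (gs : E → E) (ψn : E → ℝ) (rs : ℝ → E → E)
    (y₀ : E) (s : AcgState E) : AcgState E :=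
  let A' := acgCoeff μ L s.A
  let z' := (s.A / A') • s.z + ((A' - s.A) / A') • s.y
  let α₁ := s.A / A' * s.α + (A' - s.A) / A' * (ψs z' - inner ℝ (gs z') z')
  let β₁ := (s.A / A') • s.β + ((A' - s.A) / A') • gs z'
  let y₁ := rs A' (y₀ - A' • β₁)
  let z₁ := (s.A / A') • s.z + ((A' - s.A) / A') • y₁
  let u₁ := A'⁻¹ • (y₀ - y₁)
  ⟨A', z₁, y₁, α₁, β₁, u₁,
    (ψs z₁ + ψn z₁) - (α₁ + inner ℝ β₁ y₁) - ψn y₁ - inner ℝ u₁ (z₁ - y₁)⟩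

theorem acgStep_exec [CompleteSpace E] (P : Problem E F U) {μ L : ℝ}
    {smooth : E → Prog E F (ℝ × E)}
    {value : E → Prog E F ℝ} {resolvent : ℝ → E → Prog E F E} {ψs ψn : E → ℝ} {gs : E → E}
    {rs : ℝ → E → E} (hs : ∀ x, (smooth x).exec P = ((ψs x, gs x), 3))
    (hv : ∀ x, (value x).exec P = (ψn x, 1)) (hr : ∀ a x, (resolvent a x).exec P = (rs a x, 1))
    (y₀ : E) (s : AcgState E) :
    (acgStep μ L smooth value resolvent y₀ s).exec P = (acgUpdate μ L ψs gs ψn rs y₀ s, 9) := by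
  simp only [acgStep, exec_bind, hs, hv, hr, Prog.exec]
  rfl

/-- What the ACG method requires of `ψs` (convex, with a quadratic upper bound), of `ψn` (convex on
`S`) and of the resolvent (the three-point inequality of a `μ`-strongly convex `ψn`). -/
structure AcgData (S : Set E) (μ L : ℝ) (ψs : E → ℝ) (gs : E → E) (ψn : E → ℝ)
    (rs : ℝ → E → E) : Prop where
  convex : Convex ℝ S
  mu_pos : 0 < μ
  L_pos : 0 < L
  lower : ∀ x ∈ S, ∀ x' ∈ S, ψs x' + inner ℝ (gs x') (x - x') ≤ ψs x
  upper : ∀ x ∈ S, ∀ x' ∈ S, ψs x ≤ ψs x' + inner ℝ (gs x') (x - x') + L / 2 * ‖x - x'‖ ^ 2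
  composite : ConvexOn ℝ S ψn
  resolvent_mem : ∀ a w, 0 < a → rs a w ∈ S
  resolvent : ∀ a w, 0 < a → ∀ x ∈ S,
    ψn (rs a w) + 1 / (2 * a) * ‖rs a w - w‖ ^ 2 + 1 / 2 * (μ + 1 / a) * ‖x - rs a w‖ ^ 2 ≤
      ψn x + 1 / (2 * a) * ‖x - w‖ ^ 2

/-- The invariant of the ACG method: with `Γ = α + ⟨β, ·⟩`, the affine function `Γ` minorizes `ψs`,
`y` minimizes `A (Γ + ψn) + ‖· - y₀‖² / 2` with quadratic growth, and the minimal value is at least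
`A ψ(z)`. The inequalities are multiplied by `A` in order to include the start `A = 0`. -/
structure AcgInv (S : Set E) (μ : ℝ) (ψs ψn : E → ℝ) (y₀ : E) (s : AcgState E) : Prop where
  A_nonneg : 0 ≤ s.A
  z_mem : s.z ∈ S
  y_mem : s.y ∈ S
  minorant : ∀ x ∈ S, s.A * (s.α + inner ℝ s.β x) ≤ s.A * ψs x
  growth : ∀ x ∈ S,
    s.A * (s.α + inner ℝ s.β s.y + ψn s.y) + 1 / 2 * ‖s.y - y₀‖ ^ 2 +
        1 / 2 * (μ * s.A + 1) * ‖x - s.y‖ ^ 2 ≤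
      s.A * (s.α + inner ℝ s.β x + ψn x) + 1 / 2 * ‖x - y₀‖ ^ 2
  value : s.A * (ψs s.z + ψn s.z) ≤
    s.A * (s.α + inner ℝ s.β s.y + ψn s.y) + 1 / 2 * ‖s.y - y₀‖ ^ 2

theorem acgInv_start {S : Set E} {μ : ℝ} {ψs ψn : E → ℝ} {y₀ : E} (h : y₀ ∈ S) :
    AcgInv S μ ψs ψn y₀ (acgStart y₀) where
  A_nonneg := le_rfl
  z_mem := h
  y_mem := h
  minorant := by simp [acgStart]
  growth := by simp [acgStart]
  value := by simp [acgStart]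

/-- `a = A_{j+1} - A_j` is the positive root of `L a² = (μ A_j + 1) (A_j + a)`. -/
theorem acgCoeff_spec {μ L A : ℝ} (hμ : 0 < μ) (hL : 0 < L) (hA : 0 ≤ A) :
    A < acgCoeff μ L A ∧ L * (acgCoeff μ L A - A) ^ 2 = (μ * A + 1) * acgCoeff μ L A := by
  set t := μ * A + 1 with ht
  have ht0 : 0 < t := by positivity
  have hrad : 0 ≤ t ^ 2 + 4 * L * t * A := by positivity
  have hsq := Real.sq_sqrt hrad
  have hr := Real.sqrt_nonneg (t ^ 2 + 4 * L * t * A)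
  have hdef : acgCoeff μ L A = A + (t + √(t ^ 2 + 4 * L * t * A)) / (2 * L) := rfl
  set r := √(t ^ 2 + 4 * L * t * A)
  rw [hdef]
  refine ⟨by linarith [show 0 < (t + r) / (2 * L) by positivity], ?_⟩
  field_simp
  nlinarith

/-- `A_j ≥ j² / (4 L)`. -/
theorem acgCoeff_quadratic {μ L A : ℝ} (hμ : 0 < μ) (hL : 0 < L) (j : ℕ)
    (hA : (j : ℝ) ^ 2 / (4 * L) ≤ A) : ((j + 1 : ℕ) : ℝ) ^ 2 / (4 * L) ≤ acgCoeff μ L A := by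
  have hA0 : 0 ≤ A := le_trans (by positivity) hA
  obtain ⟨h1, h2⟩ := acgCoeff_spec hμ hL hA0
  set A' := acgCoeff μ L A
  rw [div_le_iff₀ (by positivity)] at hA ⊢
  push_cast
  have hj : (0 : ℝ) ≤ j := Nat.cast_nonneg j
  set a := A' - A with ha
  have hA' : A' = A + a := by rw [ha]; ring
  have ha0 : 0 < a := by linarith
  rw [hA'] at h2 ⊢
  have h3 : A + a ≤ L * a ^ 2 := by nlinarith [mul_nonneg hμ.le hA0]
  have h4 : j + 1 ≤ 2 * (L * a) := by
    by_contra! hlt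
    have hLa : 0 < L * a := by positivity
    have h5 : L * A + L * a ≤ (L * a) ^ 2 := by nlinarith
    have h6 : 1 ≤ L * a := by
      by_contra! h
      nlinarith [mul_nonneg hL.le hA0]
    nlinarith
  nlinarith

/-- The sequence `A_j` grows geometrically with rate `1 + √(μ / L)`. -/
theorem acgCoeff_geometric {μ L A r : ℝ} (hμ : 0 < μ) (hL : 0 < L) (hA : 0 ≤ A)
    (hrL : L * r ^ 2 ≤ μ) : A * (1 + r) ≤ acgCoeff μ L A := by
  obtain ⟨h1, h2⟩ := acgCoeff_spec hμ hL hA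
  set A' := acgCoeff μ L A
  have h3 : L * (A * r) ^ 2 ≤ L * (A' - A) ^ 2 := by
    rw [h2]
    have : L * (A * r) ^ 2 ≤ μ * A ^ 2 := by nlinarith [sq_nonneg A]
    nlinarith [mul_nonneg hμ.le hA]
  have h4 : A * r ≤ A' - A :=
    le_of_sq_le_sq (le_of_mul_le_mul_left h3 hL) (by linarith)
  linarith

variable {S : Set E} {μ L : ℝ} {ψs ψn : E → ℝ} {gs : E → E} {rs : ℝ → E → E} {y₀ : E}
  {s : AcgState E}

theorem AcgInv.update (h : AcgData S μ L ψs gs ψn rs) (hs : AcgInv S μ ψs ψn y₀ s) :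
    AcgInv S μ ψs ψn y₀ (acgUpdate μ L ψs gs ψn rs y₀ s) := by
  obtain ⟨hlt, hquad⟩ := acgCoeff_spec h.mu_pos h.L_pos hs.A_nonneg
  have hA := hs.A_nonneg
  simp only [acgUpdate]
  set A := s.A
  set A' := acgCoeff μ L A
  have hA' : 0 < A' := by linarith
  set θ := A / A' with hθ
  set τ := (A' - A) / A' with hτ
  have hθ0 : 0 ≤ θ := by positivity
  have hτ0 : 0 < τ := div_pos (by linarith) hA'
  have hsum : θ + τ = 1 := by rw [hθ, hτ]; field_simp; ring
  have hAθ : A' * θ = A := by rw [hθ]; field_simp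
  have hAτ : A' * τ = A' - A := by rw [hτ]; field_simp
  set zt := θ • s.z + τ • s.y with hzt
  set β := θ • s.β + τ • gs zt with hβ
  set α := θ * s.α + τ * (ψs zt - inner ℝ (gs zt) zt) with hα
  set y := rs A' (y₀ - A' • β) with hy
  set z := θ • s.z + τ • y with hz
  have hyS : y ∈ S := h.resolvent_mem _ _ hA'
  have hztS : zt ∈ S := h.convex hs.z_mem hs.y_mem hθ0 hτ0.le hsum
  have hzS : z ∈ S := h.convex hs.z_mem hyS hθ0 hτ0.le hsum
  have haff : ∀ x, A' * (α + inner ℝ β x) = A * (s.α + inner ℝ s.β x) +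
      (A' - A) * (ψs zt + inner ℝ (gs zt) (x - zt)) := by
    intro x
    rw [hα, hβ, inner_add_left, inner_smul_left, inner_smul_left, inner_sub_right, ← hAτ, ← hAθ]
    simp only [conj_trivial]
    ring
  refine ⟨hA'.le, hzS, hyS, ?_, ?_, ?_⟩
  · intro x hx
    simp only
    rw [haff]
    have h1 := hs.minorant x hx
    have h2 := mul_le_mul_of_nonneg_left (h.lower x hx zt hztS) (by linarith : 0 ≤ A' - A)
    linarith
  · intro x hx
    simp only
    have h1 := mul_le_mul_of_nonneg_left (h.resolvent A' (y₀ - A' • β) hA' x hx) hA'.le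
    rw [← hy] at h1
    have hexp : ∀ v : E, A' * (1 / (2 * A') * ‖v - (y₀ - A' • β)‖ ^ 2) =
        1 / 2 * ‖v - y₀‖ ^ 2 + A' * inner ℝ β (v - y₀) + A' ^ 2 / 2 * ‖β‖ ^ 2 := by
      intro v
      have : v - (y₀ - A' • β) = (v - y₀) + A' • β := by abel
      rw [this, norm_add_sq_real, inner_smul_right, norm_smul, mul_pow, Real.norm_eq_abs, sq_abs,
        real_inner_comm]
      field_simp
    rw [mul_add, mul_add A' (ψn y), mul_add A' (ψn x), hexp, hexp, inner_sub_right,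
      inner_sub_right] at h1
    have h2 : A' * (1 / 2 * (μ + 1 / A') * ‖x - y‖ ^ 2) =
        1 / 2 * (μ * A' + 1) * ‖x - y‖ ^ 2 := by field_simp
    rw [h2] at h1
    linarith
  · simp only
    rw [mul_add A' (α + _), haff]
    have h1 := hs.growth y hyS
    have h2 := hs.value
    have h3 := h.lower s.z hs.z_mem zt hztS
    have h4 := h.upper z hzS zt hztS
    have h5 := h.composite.2 hs.z_mem hyS hθ0 hτ0.le hsum
    rw [← hz] at h5
    simp only [smul_eq_mul] at h5
    have hd : z - zt = τ • (y - s.y) := by rw [hz, hzt]; module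
    have hin : A * inner ℝ (gs zt) (s.z - zt) + (A' - A) * inner ℝ (gs zt) (y - zt) =
        A' * inner ℝ (gs zt) (z - zt) := by
      have hz' : z - zt = θ • (s.z - zt) + τ • (y - zt) := by
        have : zt = θ • zt + τ • zt := by rw [← add_smul, hsum, one_smul]
        nth_rewrite 1 [this]
        rw [hz]; module
      rw [hz', inner_add_right, inner_smul_right, inner_smul_right, ← hAτ, ← hAθ]
      ring
    -- The choice of `A'` makes the strong convexity gain match the quadratic upper bound of `ψs`.
    have hnorm : A' * (L / 2 * ‖z - zt‖ ^ 2) = 1 / 2 * (μ * A + 1) * ‖y - s.y‖ ^ 2 := by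
      rw [hd, norm_smul, mul_pow, Real.norm_eq_abs, sq_abs]
      have : L * (A' * τ) ^ 2 = (μ * A + 1) * A' := by rw [hAτ]; exact hquad
      have h' : A' * (L * τ ^ 2) = μ * A + 1 := by
        have : A' * (A' * (L * τ ^ 2)) = A' * (μ * A + 1) := by linarith
        exact mul_left_cancel₀ hA'.ne' this
      linear_combination (1 / 2 * ‖y - s.y‖ ^ 2) * h'
    have h6 := mul_le_mul_of_nonneg_left h4 hA'.le
    have h7 := mul_le_mul_of_nonneg_left h5 hA'.le
    have h8 := mul_le_mul_of_nonneg_left h3 hA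
    have h9 : A' * (θ * ψn s.z + τ * ψn y) = A * ψn s.z + (A' - A) * ψn y := by
      rw [← hAτ, ← hAθ]; ring
    linarith

/-- The properties of an ACG iterate `(z, u, ε)` for `ψ` on `S` that the outer method uses: `ψ(z)` is
nearly minimal, `u` is an `ε`-subgradient of `ψ` at `z`, and the residual is small compared with the
distance travelled. -/
structure AcgCert (S : Set E) (ψ : E → ℝ) (y₀ : E) (s : AcgState E) : Prop where
  A_pos : 0 < s.A
  z_mem : s.z ∈ S
  near_opt : ∀ x ∈ S, s.A * ψ s.z ≤ s.A * ψ x + 1 / 2 * ‖x - y₀‖ ^ 2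
  subgrad : ∀ x ∈ S, ψ s.z + inner ℝ s.u (x - s.z) - s.ε ≤ ψ x
  residual : ‖s.A • s.u + s.z - y₀‖ ^ 2 + 2 * s.A * s.ε ≤ ‖s.z - y₀‖ ^ 2

theorem AcgInv.cert (h : AcgData S μ L ψs gs ψn rs) (hs : AcgInv S μ ψs ψn y₀ s) :
    AcgCert S (fun x => ψs x + ψn x) y₀ (acgUpdate μ L ψs gs ψn rs y₀ s) := by
  have hinv := hs.update h
  have hA : 0 < (acgUpdate μ L ψs gs ψn rs y₀ s).A :=
    hs.A_nonneg.trans_lt (acgCoeff_spec h.mu_pos h.L_pos hs.A_nonneg).1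
  have hu : (acgUpdate μ L ψs gs ψn rs y₀ s).u = (acgUpdate μ L ψs gs ψn rs y₀ s).A⁻¹ •
    (y₀ - (acgUpdate μ L ψs gs ψn rs y₀ s).y) := rfl
  have hε : (acgUpdate μ L ψs gs ψn rs y₀ s).ε =
      (ψs (acgUpdate μ L ψs gs ψn rs y₀ s).z + ψn (acgUpdate μ L ψs gs ψn rs y₀ s).z) -
      ((acgUpdate μ L ψs gs ψn rs y₀ s).α + inner ℝ (acgUpdate μ L ψs gs ψn rs y₀ s).β
        (acgUpdate μ L ψs gs ψn rs y₀ s).y) - ψn (acgUpdate μ L ψs gs ψn rs y₀ s).y -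
      inner ℝ (acgUpdate μ L ψs gs ψn rs y₀ s).u
        ((acgUpdate μ L ψs gs ψn rs y₀ s).z - (acgUpdate μ L ψs gs ψn rs y₀ s).y) := rfl
  generalize acgUpdate μ L ψs gs ψn rs y₀ s = t at *
  have hAu : t.A • t.u = y₀ - t.y := by rw [hu, smul_smul, mul_inv_cancel₀ hA.ne', one_smul]
  have hin : ∀ v, t.A * inner ℝ t.u v = inner ℝ (y₀ - t.y) v := by
    intro v; rw [← hAu, inner_smul_left]; simp
  have h0 : ∀ x, 0 ≤ 1 / 2 * (μ * t.A + 1) * ‖x - t.y‖ ^ 2 := by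
    intro x; have := mul_pos h.mu_pos hA; positivity
  refine ⟨hA, hinv.z_mem, ?_, ?_, ?_⟩
  · intro x hx
    have h1 := hinv.growth x hx
    have h2 := hinv.minorant x hx
    have h3 := hinv.value
    have := h0 x
    linarith
  · intro x hx
    have h1 := hinv.growth x hx
    have h2 := hinv.minorant x hx
    have h4 : ‖x - y₀‖ ^ 2 = ‖x - t.y‖ ^ 2 - 2 * inner ℝ (y₀ - t.y) (x - t.y) + ‖t.y - y₀‖ ^ 2 := by
      have : x - y₀ = (x - t.y) - (y₀ - t.y) := by abel
      rw [this, norm_sub_sq_real, real_inner_comm, norm_sub_rev y₀]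
    have h5 : inner ℝ t.u (x - t.z) + inner ℝ t.u (t.z - t.y) = inner ℝ t.u (x - t.y) := by
      rw [← inner_add_right]; congr 1; abel
    have h6 := hin (x - t.y)
    have h7 : 0 ≤ μ * t.A * ‖x - t.y‖ ^ 2 := by
      have := mul_pos h.mu_pos hA; positivity
    refine le_of_mul_le_mul_left ?_ hA
    rw [hε]
    have h8 : t.A * (ψs t.z + ψn t.z + inner ℝ t.u (x - t.z) -
        (ψs t.z + ψn t.z - (t.α + inner ℝ t.β t.y) - ψn t.y - inner ℝ t.u (t.z - t.y))) =
        t.A * (t.α + inner ℝ t.β t.y + ψn t.y) +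
          t.A * (inner ℝ t.u (x - t.z) + inner ℝ t.u (t.z - t.y)) := by ring
    rw [h8, h5, h6]
    linarith
  · have h1 := hinv.value
    have h2 : t.A • t.u + t.z - y₀ = t.z - t.y := by rw [hAu]; abel
    have h3 := hin (t.z - t.y)
    have h4 : ‖t.z - y₀‖ ^ 2 = ‖t.z - t.y‖ ^ 2 - 2 * inner ℝ (y₀ - t.y) (t.z - t.y) +
        ‖t.y - y₀‖ ^ 2 := by
      have : t.z - y₀ = (t.z - t.y) - (y₀ - t.y) := by abel
      rw [this, norm_sub_sq_real, real_inner_comm, norm_sub_rev y₀]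
    rw [h2, h4, hε]
    have h5 : 2 * t.A * (ψs t.z + ψn t.z - (t.α + inner ℝ t.β t.y) - ψn t.y -
        inner ℝ t.u (t.z - t.y)) = 2 * (t.A * (ψs t.z + ψn t.z)) -
        2 * (t.A * (t.α + inner ℝ t.β t.y + ψn t.y)) - 2 * (t.A * inner ℝ t.u (t.z - t.y)) := by
      ring
    rw [h5, h3]
    linarith

end AcgMethod

/-! ### The prox subproblems of the scheme -/

section Subproblem

variable {E : Type*} {F : Type*} {U : Type*}
  [NormedAddCommGroup E] [InnerProductSpace ℝ E] [CompleteSpace E]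
  [NormedAddCommGroup F] [InnerProductSpace ℝ F]
  [NormedAddCommGroup U] [InnerProductSpace ℝ U] [CompleteSpace U]

/-- The value of `p_ξ(x)` as the scheme computes it; it equals `p_ξ(x)` for `x ∈ X`. -/
noncomputable def smoothVal (P : Problem E F U) (ξ : ℝ) (y₀ : F) (x : E) : ℝ :=
  P.Φ x (smoothArg P ξ y₀ x) - 1 / (2 * ξ) * ‖smoothArg P ξ y₀ x - y₀‖ ^ 2

/-- The penalized smooth function `f_c = p_ξ + (c/2) ‖A · - b‖²`. -/
noncomputable def penVal (P : Problem E F U) (ξ : ℝ) (y₀ : F) (c : ℝ) (x : E) : ℝ :=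
  smoothVal P ξ y₀ x + c / 2 * ‖P.A x - P.b‖ ^ 2

/-- The gradient of `f_c`. -/
noncomputable def penGrad (P : Problem E F U) (ξ : ℝ) (y₀ : F) (c : ℝ) (x : E) : E :=
  smoothGrad P ξ y₀ x + c • ContinuousLinearMap.adjoint P.A (P.A x - P.b)

/-- One ACG iteration for the prox subproblem of `f_c + h` with prox center `x⁻` and stepsize `l`,
where `M` is the Lipschitz constant of `∇f_c`. -/
noncomputable def proxAcg (P : Problem E F U) (ξ : ℝ) (y₀ : F) (c l M : ℝ) (center : E) :
    AcgState E → AcgState E :=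
  acgUpdate (1 / 2) (l * M + 1 / 2)
    (fun x => l * penVal P ξ y₀ c x + 1 / 4 * ‖x - center‖ ^ 2)
    (fun x => l • penGrad P ξ y₀ c x + (1 / 2 : ℝ) • (x - center))
    (fun x => l * P.h x + 1 / 4 * ‖x - center‖ ^ 2)
    (fun a x => argminOn P.X fun x' => l / (1 / 2 + 1 / a) * P.h x' +
      1 / 2 * ‖x' - (1 / 2 + 1 / a)⁻¹ • ((1 / 2 : ℝ) • center + (1 / a) • x)‖ ^ 2)
    center

variable {P : Problem E F U} {m Lx Ly chat ξ c : ℝ} {x₀ : E} {y₀ : F} {ρx η : ℝ}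

theorem smoothMax_exec (x : E) :
    ((P.input m Lx Ly chat ξ x₀ y₀ ρx η).smoothMax x).exec P =
      ((smoothVal P ξ y₀ x, smoothGrad P ξ y₀ x), 3) := rfl

theorem penalized_exec (x : E) :
    ((P.input m Lx Ly chat ξ x₀ y₀ ρx η).penalized c x).exec P =
      ((penVal P ξ y₀ c x, penGrad P ξ y₀ c x), 3) := rfl

theorem acg_exec (center : E) (s : AcgState E) :
    ((P.input m Lx Ly chat ξ x₀ y₀ ρx η).acg c center s).exec P =
      (proxAcg P ξ y₀ c (1 / (4 * m)) (Lsmooth m Lx Ly ξ + c * ‖P.A‖ ^ 2) center s, 9) :=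
  acgStep_exec P (fun _ => rfl) (fun _ => rfl) (fun _ _ => rfl) _ _

theorem penalty_expand (P : Problem E F U) (c : ℝ) (x x' : E) :
    c / 2 * ‖P.A x - P.b‖ ^ 2 = c / 2 * ‖P.A x' - P.b‖ ^ 2 +
      inner ℝ (c • ContinuousLinearMap.adjoint P.A (P.A x' - P.b)) (x - x') +
      c / 2 * ‖P.A (x - x')‖ ^ 2 := by
  have h : P.A x - P.b = (P.A x' - P.b) + P.A (x - x') := by rw [map_sub]; abel
  rw [h, norm_add_sq_real, inner_smul_left, ContinuousLinearMap.adjoint_inner_left]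
  simp only [conj_trivial]
  ring

theorem sq_norm_expand (x x' w : E) :
    ‖x - w‖ ^ 2 = ‖x' - w‖ ^ 2 + 2 * inner ℝ (x' - w) (x - x') + ‖x - x'‖ ^ 2 := by
  have : x - w = (x' - w) + (x - x') := by abel
  rw [this, norm_add_sq_real]

theorem Lsmooth_ge (hP : P.Standing m Lx Ly chat) (hξ : 0 < ξ) : m ≤ Lsmooth m Lx Ly ξ := by
  have := hP.Ly_pos
  have h : 0 ≤ Ly * (ξ * Ly + √(ξ * (Lx + m))) := by positivity
  unfold Lsmooth
  linarith [hP.m_le]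

variable [FiniteDimensional ℝ F] {x x' : E}

theorem smoothVal_eq (hP : P.Standing m Lx Ly chat) (hξ : 0 < ξ) (hx : x ∈ P.X) :
    smoothVal P ξ y₀ x = P.pSmooth ξ y₀ x :=
  ((pSmooth_eq (standing_concave hP hx) hξ y₀).1).symm

theorem penVal_lower (hP : P.Standing m Lx Ly chat) (hξ : 0 < ξ) (hc : 0 ≤ c) (hx : x ∈ P.X)
    (hx' : x' ∈ P.X) :
    penVal P ξ y₀ c x' + inner ℝ (penGrad P ξ y₀ c x') (x - x') - m / 2 * ‖x - x'‖ ^ 2 ≤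
      penVal P ξ y₀ c x := by
  have h1 := pSmooth_lower hP hξ y₀ hx hx'
  have h2 := penalty_expand P c x x'
  unfold penVal penGrad
  rw [smoothVal_eq hP hξ hx, smoothVal_eq hP hξ hx', inner_add_left]
  have h0 : 0 ≤ c / 2 * ‖P.A (x - x')‖ ^ 2 := by positivity
  linarith

theorem penVal_upper (hP : P.Standing m Lx Ly chat) (hξ : 0 < ξ) (hc : 0 ≤ c) (hx : x ∈ P.X)
    (hx' : x' ∈ P.X) :
    penVal P ξ y₀ c x ≤ penVal P ξ y₀ c x' + inner ℝ (penGrad P ξ y₀ c x') (x - x') +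
      (Lsmooth m Lx Ly ξ + c * ‖P.A‖ ^ 2) / 2 * ‖x - x'‖ ^ 2 := by
  have h1 := le_quadratic_of_lipschitz_gradient hP.X_convex
    (fun _ h => hasGradientAt_pSmooth hP hξ y₀ h)
    (fun a ha b hb => smoothGrad_lipschitz hP hξ y₀ ha hb) hx hx'
  have h2 := penalty_expand P c x x'
  unfold penVal penGrad
  rw [smoothVal_eq hP hξ hx, smoothVal_eq hP hξ hx', inner_add_left]
  have h3 := pow_le_pow_left₀ (norm_nonneg _) (P.A.le_opNorm (x - x')) 2
  have h4 := mul_le_mul_of_nonneg_left h3 (by positivity : 0 ≤ c / 2)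
  rw [mul_pow] at h4
  linarith

theorem penGrad_lipschitz (hP : P.Standing m Lx Ly chat) (hξ : 0 < ξ) (hc : 0 ≤ c)
    (hx : x ∈ P.X) (hx' : x' ∈ P.X) :
    ‖penGrad P ξ y₀ c x - penGrad P ξ y₀ c x'‖ ≤
      (Lsmooth m Lx Ly ξ + c * ‖P.A‖ ^ 2) * ‖x - x'‖ := by
  have h1 := smoothGrad_lipschitz hP hξ y₀ hx hx'
  have h2 : penGrad P ξ y₀ c x - penGrad P ξ y₀ c x' =
      (smoothGrad P ξ y₀ x - smoothGrad P ξ y₀ x') +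
        c • ContinuousLinearMap.adjoint P.A (P.A (x - x')) := by
    unfold penGrad
    rw [add_sub_add_comm, ← smul_sub, ← map_sub, sub_sub_sub_cancel_right, ← map_sub]
  have h3 : ‖c • ContinuousLinearMap.adjoint P.A (P.A (x - x'))‖ ≤ c * ‖P.A‖ ^ 2 * ‖x - x'‖ := by
    rw [norm_smul, Real.norm_of_nonneg hc, mul_assoc]
    refine mul_le_mul_of_nonneg_left ?_ hc
    calc _ ≤ ‖ContinuousLinearMap.adjoint P.A‖ * ‖P.A (x - x')‖ := ContinuousLinearMap.le_opNorm _ _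
      _ ≤ ‖P.A‖ * (‖P.A‖ * ‖x - x'‖) := by
        rw [LinearIsometryEquiv.norm_map]
        exact mul_le_mul_of_nonneg_left (P.A.le_opNorm _) (norm_nonneg _)
      _ = _ := by ring
  rw [h2]
  refine (norm_add_le _ _).trans ?_
  linarith

/-- The answer of the oracle `proxH` satisfies the three-point inequality. -/
theorem proxH_spec [FiniteDimensional ℝ E] (hP : P.Standing m Lx Ly chat) {t : ℝ} (ht : 0 < t)
    (w : E) {y : E}
    (hy : y = argminOn P.X fun x' => t * P.h x' + 1 / 2 * ‖x' - w‖ ^ 2) :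
    y ∈ P.X ∧ ∀ x ∈ P.X, t * P.h y + 1 / 2 * ‖y - w‖ ^ 2 + 1 / 2 * ‖x - y‖ ^ 2 ≤
      t * P.h x + 1 / 2 * ‖x - w‖ ^ 2 := by
  obtain ⟨hmem, hmin⟩ := argminOn_spec (hP.h_mem.exists_prox ht w)
  rw [← hy] at hmem hmin
  have hconv : ConvexOn ℝ P.X fun x => t * P.h x := by
    simpa using hP.h_mem.2.1.smul ht.le
  exact ⟨hmem, fun x hx => hconv.prox_three_point hmem hmin hx⟩

/-- The prox stepsize `1 / (4 m)` makes the subproblem convex: the smooth part gains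
`‖· - x⁻‖² / 4`, and the composite part becomes `1/2`-strongly convex. -/
theorem proxAcg_data [FiniteDimensional ℝ E] (hP : P.Standing m Lx Ly chat) (hξ : 0 < ξ)
    (hc : 0 ≤ c) (y₀ : F) (center : E) :
    AcgData P.X (1 / 2) (1 / (4 * m) * (Lsmooth m Lx Ly ξ + c * ‖P.A‖ ^ 2) + 1 / 2)
      (fun x => 1 / (4 * m) * penVal P ξ y₀ c x + 1 / 4 * ‖x - center‖ ^ 2)
      (fun x => (1 / (4 * m)) • penGrad P ξ y₀ c x + (1 / 2 : ℝ) • (x - center))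
      (fun x => 1 / (4 * m) * P.h x + 1 / 4 * ‖x - center‖ ^ 2)
      (fun a x => argminOn P.X fun x' => 1 / (4 * m) / (1 / 2 + 1 / a) * P.h x' +
        1 / 2 * ‖x' - (1 / 2 + 1 / a)⁻¹ • ((1 / 2 : ℝ) • center + (1 / a) • x)‖ ^ 2) := by
  have hm := hP.m_pos
  have hl : 0 < 1 / (4 * m) := by positivity
  have hlm : 1 / (4 * m) * m = 1 / 4 := by field_simp
  have hM : 0 ≤ Lsmooth m Lx Ly ξ + c * ‖P.A‖ ^ 2 := by
    have := Lsmooth_ge hP hξ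
    have : 0 ≤ c * ‖P.A‖ ^ 2 := by positivity
    linarith
  set l := 1 / (4 * m)
  refine ⟨hP.X_convex, by norm_num, by positivity, ?_, ?_, ?_, ?_, ?_⟩
  · intro x hx x' hx'
    have h1 := mul_le_mul_of_nonneg_left (penVal_lower (y₀ := y₀) hP hξ hc hx hx') hl.le
    have h2 := sq_norm_expand x x' center
    rw [inner_add_left, inner_smul_left, inner_smul_left]
    simp only [conj_trivial]
    have h3 : l * (m / 2 * ‖x - x'‖ ^ 2) = 1 / 8 * ‖x - x'‖ ^ 2 := by
      linear_combination (‖x - x'‖ ^ 2 / 2) * hlm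
    have h0 : 0 ≤ ‖x - x'‖ ^ 2 := by positivity
    linarith
  · intro x hx x' hx'
    have h1 := mul_le_mul_of_nonneg_left (penVal_upper (y₀ := y₀) hP hξ hc hx hx') hl.le
    have h2 := sq_norm_expand x x' center
    rw [inner_add_left, inner_smul_left, inner_smul_left]
    simp only [conj_trivial]
    linarith
  · refine ConvexOn.add (by simpa using hP.h_mem.2.1.smul hl.le) ⟨hP.X_convex, ?_⟩
    intro x _ y _ a b ha hb hab
    simp only [smul_eq_mul]
    rw [norm_sq_combo a b hab x y center]
    have : 0 ≤ a * b * ‖y - x‖ ^ 2 := by positivity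
    linarith
  · intro a w ha
    exact (proxH_spec hP (by positivity) _ rfl).1
  · intro a w ha x hx
    set θ := 1 / 2 + 1 / a with hθ
    have hθ0 : 0 < θ := by positivity
    obtain ⟨-, h1⟩ := proxH_spec hP (t := l / θ) (by positivity)
      (θ⁻¹ • ((1 / 2 : ℝ) • center + (1 / a) • w)) rfl
    have h2 := mul_le_mul_of_nonneg_left (h1 x hx) hθ0.le
    generalize (argminOn P.X fun x' => l / θ * P.h x' +
      1 / 2 * ‖x' - θ⁻¹ • ((1 / 2 : ℝ) • center + (1 / a) • w)‖ ^ 2) = y at *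
    -- Completing the square: the two quadratics of the resolvent merge into one of weight `θ`.
    have hexp : ∀ v, θ * (1 / 2 * ‖v - θ⁻¹ • ((1 / 2 : ℝ) • center + (1 / a) • w)‖ ^ 2) =
        1 / 4 * ‖v - center‖ ^ 2 + 1 / (2 * a) * ‖v - w‖ ^ 2 -
          1 / (4 * a * θ) * ‖w - center‖ ^ 2 := by
      intro v
      rw [norm_sub_rev v, norm_sub_rev v, norm_sub_rev v, smul_add, smul_smul, smul_smul,
        norm_sq_combo _ _ (by rw [← mul_add, ← hθ, inv_mul_cancel₀ hθ0.ne'])]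
      field_simp
      ring
    have hh : ∀ t, θ * (l / θ * t) = l * t := by intro t; field_simp
    rw [mul_add, mul_add θ (l / θ * P.h y), mul_add θ (l / θ * P.h x), hexp, hexp, hh, hh] at h2
    linarith

end Subproblem

/-! ### Inexact solutions of a prox subproblem -/

section Certificate

variable {E : Type*} [NormedAddCommGroup E] [InnerProductSpace ℝ E]
  {S : Set E} {ψ φ : E → ℝ} {y₀ : E} {s t : AcgState E}

theorem AcgCert.eps_nonneg (h : AcgCert S ψ y₀ s) : 0 ≤ s.ε := by
  have := h.subgrad s.z h.z_mem
  simp at this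
  linarith

theorem AcgCert.eps_le (h : AcgCert S ψ y₀ s) : 2 * s.A * s.ε ≤ ‖s.z - y₀‖ ^ 2 := by
  have := h.residual
  have : 0 ≤ ‖s.A • s.u + s.z - y₀‖ ^ 2 := by positivity
  linarith

theorem AcgCert.norm_u_le (h : AcgCert S ψ y₀ s) (hA : 18 ≤ s.A) :
    ‖s.u‖ ≤ ‖s.z - y₀‖ / 9 := by
  have h1 : ‖s.A • s.u + s.z - y₀‖ ^ 2 ≤ ‖s.z - y₀‖ ^ 2 := by
    have := h.residual
    have := mul_nonneg (mul_nonneg zero_le_two h.A_pos.le) h.eps_nonneg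
    linarith
  have h2 := le_of_sq_le_sq h1 (norm_nonneg _)
  have h3 : ‖s.A • s.u‖ ≤ ‖s.A • s.u + s.z - y₀‖ + ‖s.z - y₀‖ := by
    have := norm_sub_le (s.A • s.u + s.z - y₀) (s.z - y₀)
    rwa [show s.A • s.u + s.z - y₀ - (s.z - y₀) = s.A • s.u by abel] at this
  rw [norm_smul, Real.norm_of_nonneg h.A_pos.le] at h3
  nlinarith [norm_nonneg s.u]

theorem AcgCert.norm_v_le (h : AcgCert S ψ y₀ s) (hA : 18 ≤ s.A) :
    ‖y₀ - s.z + s.u‖ ≤ 10 / 9 * ‖s.z - y₀‖ := by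
  have := norm_add_le (y₀ - s.z) s.u
  rw [norm_sub_rev y₀] at this
  linarith [h.norm_u_le hA]

theorem AcgCert.le_norm_v (h : AcgCert S ψ y₀ s) (hA : 18 ≤ s.A) :
    8 / 9 * ‖s.z - y₀‖ ≤ ‖y₀ - s.z + s.u‖ := by
  have := norm_sub_le (y₀ - s.z + s.u) s.u
  rw [show y₀ - s.z + s.u - s.u = y₀ - s.z by abel, norm_sub_rev y₀] at this
  linarith [h.norm_u_le hA]

/-- For `A ≥ 18` the inexactness criterion of the prox method holds automatically. -/
theorem AcgCert.inexact (h : AcgCert S ψ y₀ s) (hA : 18 ≤ s.A) :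
    ‖s.u‖ ^ 2 + 2 * s.ε ≤ 1 / 2 * ‖y₀ - s.z + s.u‖ ^ 2 := by
  have h1 := pow_le_pow_left₀ (norm_nonneg _) (h.norm_u_le hA) 2
  have h2 := pow_le_pow_left₀ (by positivity) (h.le_norm_v hA) 2
  have h3 := h.eps_le
  have h4 := h.eps_nonneg
  nlinarith

/-- Two ACG iterates with `A ≥ 18` have comparable distances from the prox center: both are nearly
minimal, so by strong convexity they are close to each other. -/
theorem AcgCert.dist_le (hs : AcgCert S ψ y₀ s) (ht : AcgCert S ψ y₀ t) (hsA : 18 ≤ s.A)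
    (htA : 18 ≤ t.A)
    (hψ : ∀ x ∈ S, ∀ y ∈ S, ∃ w ∈ S, w - y₀ = (1 / 2 : ℝ) • ((x - y₀) + (y - y₀)) ∧
      ψ w + 3 / 32 * ‖x - y‖ ^ 2 ≤ 1 / 2 * ψ x + 1 / 2 * ψ y) :
    ‖t.z - y₀‖ ≤ 2 * ‖s.z - y₀‖ := by
  obtain ⟨w, hw, hmid, hψw⟩ := hψ s.z hs.z_mem t.z ht.z_mem
  have hopt : ∀ r : AcgState E, AcgCert S ψ y₀ r → 18 ≤ r.A →
      ψ r.z ≤ ψ w + 1 / 36 * ‖w - y₀‖ ^ 2 := by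
    intro r hr hrA
    have h1 := hr.near_opt w hw
    by_contra! hlt
    have h2 := mul_lt_mul_of_pos_left hlt hr.A_pos
    nlinarith [sq_nonneg ‖w - y₀‖]
  have h1 := hopt s hs hsA
  have h2 := hopt t ht htA
  have h3 : ‖w - y₀‖ ≤ 1 / 2 * (‖s.z - y₀‖ + ‖t.z - y₀‖) := by
    rw [hmid, norm_smul, Real.norm_of_nonneg (by norm_num)]
    exact mul_le_mul_of_nonneg_left (norm_add_le _ _) (by norm_num)
  have h4 : ‖s.z - t.z‖ ^ 2 ≤ (5 / 9 * ‖w - y₀‖) ^ 2 := by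
    nlinarith [sq_nonneg ‖w - y₀‖]
  have h5 := le_of_sq_le_sq h4 (by positivity)
  have h6 : ‖t.z - y₀‖ ≤ ‖s.z - y₀‖ + ‖s.z - t.z‖ := by
    have := norm_sub_le (s.z - y₀) (s.z - t.z)
    rwa [show s.z - y₀ - (s.z - t.z) = t.z - y₀ by abel] at this
  linarith [norm_nonneg (s.z - y₀)]

/-- The descent property of inexact proximal steps. -/
theorem AcgCert.descent (h : AcgCert S (fun x => φ x + 1 / 2 * ‖x - y₀‖ ^ 2) y₀ s)
    (hA : 18 ≤ s.A) (hy₀ : y₀ ∈ S) :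
    φ s.z + 1 / 4 * ‖y₀ - s.z + s.u‖ ^ 2 ≤ φ y₀ := by
  have h1 := h.subgrad y₀ hy₀
  have h2 := h.inexact hA
  have h3 : ‖y₀ - s.z + s.u‖ ^ 2 = ‖s.z - y₀‖ ^ 2 + 2 * inner ℝ s.u (y₀ - s.z) + ‖s.u‖ ^ 2 := by
    rw [norm_add_sq_real, norm_sub_rev, real_inner_comm]
  simp only [sub_self, norm_zero] at h1
  linarith

theorem AcgCert.value_le (h : AcgCert S (fun x => φ x + 1 / 2 * ‖x - y₀‖ ^ 2) y₀ s)
    (hA : 18 ≤ s.A) {x : E} (hx : x ∈ S) : φ s.z ≤ φ x + ‖x - y₀‖ ^ 2 := by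
  have h1 := h.near_opt x hx
  by_contra! hlt
  have h2 := mul_lt_mul_of_pos_left hlt h.A_pos
  nlinarith [sq_nonneg ‖x - y₀‖, sq_nonneg ‖s.z - y₀‖, h.A_pos]

end Certificate

section Iterates

variable {E : Type*} {F : Type*} {U : Type*}
  [NormedAddCommGroup E] [InnerProductSpace ℝ E] [FiniteDimensional ℝ E] [CompleteSpace E]
  [NormedAddCommGroup F] [InnerProductSpace ℝ F] [FiniteDimensional ℝ F]
  [NormedAddCommGroup U] [InnerProductSpace ℝ U] [CompleteSpace U]

/-- The `j`-th ACG iterate for the prox subproblem of `f_c + h` with prox center `x⁻`. -/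
noncomputable def proxIter (P : Problem E F U) (m Lx Ly ξ : ℝ) (y₀ : F) (c : ℝ) (center : E)
    (j : ℕ) : AcgState E :=
  (proxAcg P ξ y₀ c (1 / (4 * m)) (Lsmooth m Lx Ly ξ + c * ‖P.A‖ ^ 2) center)^[j] (acgStart center)

/-- The condition number `s = √(2 λ M_c + 1)`; the ACG method for a prox subproblem converges with
the rate `1 + 1 / s`. -/
noncomputable def condNum (P : Problem E F U) (m Lx Ly ξ c : ℝ) : ℝ :=
  √(2 * (1 / (4 * m)) * (Lsmooth m Lx Ly ξ + c * ‖P.A‖ ^ 2) + 1)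

/-- The penalized objective function `p_ξ + (c/2) ‖A · - b‖² + h` times the stepsize `1 / (4 m)`. -/
noncomputable def scaledObj (P : Problem E F U) (m ξ : ℝ) (y₀ : F) (c : ℝ) (x : E) : ℝ :=
  1 / (4 * m) * (penVal P ξ y₀ c x + P.h x)

variable {P : Problem E F U} {m Lx Ly chat ξ c : ℝ} {y₀ : F} {center : E}

theorem proxIter_succ (j : ℕ) : proxIter P m Lx Ly ξ y₀ c center (j + 1) =
    proxAcg P ξ y₀ c (1 / (4 * m)) (Lsmooth m Lx Ly ξ + c * ‖P.A‖ ^ 2) center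
      (proxIter P m Lx Ly ξ y₀ c center j) :=
  Function.iterate_succ_apply' _ _ _

theorem lipschitz_nonneg (hP : P.Standing m Lx Ly chat) (hξ : 0 < ξ) (hc : 0 ≤ c) :
    0 < Lsmooth m Lx Ly ξ + c * ‖P.A‖ ^ 2 := by
  have := Lsmooth_ge hP hξ
  have := hP.m_pos
  have : 0 ≤ c * ‖P.A‖ ^ 2 := by positivity
  linarith

theorem condNum_sq (hP : P.Standing m Lx Ly chat) (hξ : 0 < ξ) (hc : 0 ≤ c) :
    condNum P m Lx Ly ξ c ^ 2 =
      2 * (1 / (4 * m) * (Lsmooth m Lx Ly ξ + c * ‖P.A‖ ^ 2) + 1 / 2) := by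
  have := lipschitz_nonneg hP hξ hc
  have := hP.m_pos
  unfold condNum
  rw [Real.sq_sqrt (by positivity)]
  ring

theorem one_le_condNum (hP : P.Standing m Lx Ly chat) (hξ : 0 < ξ) (hc : 0 ≤ c) :
    1 ≤ condNum P m Lx Ly ξ c := by
  have := lipschitz_nonneg hP hξ hc
  have := hP.m_pos
  unfold condNum
  rw [Real.one_le_sqrt]
  have : 0 ≤ 2 * (1 / (4 * m)) * (Lsmooth m Lx Ly ξ + c * ‖P.A‖ ^ 2) := by positivity
  linarith

theorem proxIter_inv (hP : P.Standing m Lx Ly chat) (hξ : 0 < ξ) (hc : 0 ≤ c)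
    (hcenter : center ∈ P.X) (j : ℕ) :
    AcgInv P.X (1 / 2) (fun x => 1 / (4 * m) * penVal P ξ y₀ c x + 1 / 4 * ‖x - center‖ ^ 2)
      (fun x => 1 / (4 * m) * P.h x + 1 / 4 * ‖x - center‖ ^ 2) center
      (proxIter P m Lx Ly ξ y₀ c center j) := by
  induction j with
  | zero => exact acgInv_start hcenter
  | succ j ih =>
    rw [proxIter_succ]
    exact ih.update (proxAcg_data hP hξ hc y₀ center)

theorem proxIter_cert (hP : P.Standing m Lx Ly chat) (hξ : 0 < ξ) (hc : 0 ≤ c)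
    (hcenter : center ∈ P.X) {j : ℕ} (hj : 1 ≤ j) :
    AcgCert P.X (fun x => scaledObj P m ξ y₀ c x + 1 / 2 * ‖x - center‖ ^ 2) center
      (proxIter P m Lx Ly ξ y₀ c center j) := by
  obtain ⟨j, rfl⟩ := Nat.exists_eq_add_of_le' hj
  rw [proxIter_succ]
  have h := (proxIter_inv (y₀ := y₀) hP hξ hc hcenter j).cert (proxAcg_data hP hξ hc y₀ center)
  have hfun : (fun x => scaledObj P m ξ y₀ c x + 1 / 2 * ‖x - center‖ ^ 2) = fun x =>
      (1 / (4 * m) * penVal P ξ y₀ c x + 1 / 4 * ‖x - center‖ ^ 2) +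
        (1 / (4 * m) * P.h x + 1 / 4 * ‖x - center‖ ^ 2) := by
    funext x; unfold scaledObj; ring
  rw [hfun]
  exact h

theorem proxIter_A_quadratic (hP : P.Standing m Lx Ly chat) (hξ : 0 < ξ) (hc : 0 ≤ c)
    (j : ℕ) : (j : ℝ) ^ 2 / (2 * condNum P m Lx Ly ξ c ^ 2) ≤
      (proxIter P m Lx Ly ξ y₀ c center j).A := by
  have hM := lipschitz_nonneg hP hξ hc
  have hm := hP.m_pos
  have hsq := condNum_sq hP hξ hc
  induction j with
  | zero => simp [proxIter, acgStart]
  | succ j ih =>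
    have := acgCoeff_quadratic (μ := 1 / 2)
      (L := 1 / (4 * m) * (Lsmooth m Lx Ly ξ + c * ‖P.A‖ ^ 2) + 1 / 2)
      (A := (proxIter P m Lx Ly ξ y₀ c center j).A) (by norm_num) (by positivity) j
      (by refine le_trans (le_of_eq ?_) ih; rw [hsq]; ring)
    rw [proxIter_succ]
    refine le_trans (le_of_eq ?_) this
    rw [hsq]; ring

theorem proxIter_A_geometric (hP : P.Standing m Lx Ly chat) (hξ : 0 < ξ) (hc : 0 ≤ c)
    (i j : ℕ) : (proxIter P m Lx Ly ξ y₀ c center i).A * (1 + (condNum P m Lx Ly ξ c)⁻¹) ^ j ≤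
      (proxIter P m Lx Ly ξ y₀ c center (i + j)).A := by
  have hM := lipschitz_nonneg hP hξ hc
  have hm := hP.m_pos
  have hsq := condNum_sq hP hξ hc
  have hs := one_le_condNum hP hξ hc
  induction j with
  | zero => simp
  | succ j ih =>
    have hA : 0 ≤ (proxIter P m Lx Ly ξ y₀ c center (i + j)).A :=
      le_trans (by positivity) (proxIter_A_quadratic hP hξ hc (i + j))
    have := acgCoeff_geometric (μ := 1 / 2)
      (L := 1 / (4 * m) * (Lsmooth m Lx Ly ξ + c * ‖P.A‖ ^ 2) + 1 / 2)
      (r := (condNum P m Lx Ly ξ c)⁻¹) (by norm_num) (by positivity) hA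
      (by
        rw [show 1 / (4 * m) * (Lsmooth m Lx Ly ξ + c * ‖P.A‖ ^ 2) + 1 / 2 =
          condNum P m Lx Ly ξ c ^ 2 / 2 by rw [hsq]; ring]
        field_simp
        norm_num)
    rw [← add_assoc, proxIter_succ, pow_succ, ← mul_assoc]
    exact (mul_le_mul_of_nonneg_right ih (by positivity)).trans this

/-- `A_j ≥ j² / (2 s²) ≥ 18` for `j ≥ 6 s`. -/
theorem proxIter_A_ge (hP : P.Standing m Lx Ly chat) (hξ : 0 < ξ) (hc : 0 ≤ c)
    {j : ℕ} (hj : ⌈6 * condNum P m Lx Ly ξ c⌉₊ ≤ j) :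
    18 ≤ (proxIter P m Lx Ly ξ y₀ c center j).A := by
  refine le_trans ?_ (proxIter_A_quadratic hP hξ hc j)
  have hs := one_le_condNum hP hξ hc
  rw [le_div_iff₀ (by positivity)]
  have := Nat.ceil_le.1 hj
  nlinarith

/-- The objective of the prox subproblem is strongly convex, in midpoint form: the curvature `1` of the
prox term exceeds the negative curvature `λ m = 1/4` of `λ f_c`. -/
theorem scaledObj_midpoint (hP : P.Standing m Lx Ly chat) (hξ : 0 < ξ) (hc : 0 ≤ c)
    {x y : E} (hx : x ∈ P.X) (hy : y ∈ P.X) :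
    ∃ w ∈ P.X, w - center = (1 / 2 : ℝ) • ((x - center) + (y - center)) ∧
      scaledObj P m ξ y₀ c w + 1 / 2 * ‖w - center‖ ^ 2 + 3 / 32 * ‖x - y‖ ^ 2 ≤
        1 / 2 * (scaledObj P m ξ y₀ c x + 1 / 2 * ‖x - center‖ ^ 2) +
          1 / 2 * (scaledObj P m ξ y₀ c y + 1 / 2 * ‖y - center‖ ^ 2) := by
  have hm := hP.m_pos
  have hl : 0 < 1 / (4 * m) := by positivity
  have hlm : 1 / (4 * m) * m = 1 / 4 := by field_simp
  have hw := hP.X_convex hx hy (by norm_num : (0 : ℝ) ≤ 1 / 2) (by norm_num : (0 : ℝ) ≤ 1 / 2)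
    (by norm_num)
  have hconv := hP.h_mem.2.1.2 hx hy (by norm_num : (0 : ℝ) ≤ 1 / 2)
    (by norm_num : (0 : ℝ) ≤ 1 / 2) (by norm_num)
  have hnorm := norm_sq_combo (1 / 2) (1 / 2) (by norm_num) x y center
  set w := (1 / 2 : ℝ) • x + (1 / 2 : ℝ) • y with hwdef
  refine ⟨w, hw, by rw [hwdef]; module, ?_⟩
  have h1 := penVal_lower (y₀ := y₀) hP hξ hc hx hw
  have h2 := penVal_lower (y₀ := y₀) hP hξ hc hy hw
  have hxw : x - w = (1 / 2 : ℝ) • (x - y) := by rw [hwdef]; module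
  have hyw : y - w = -((1 / 2 : ℝ) • (x - y)) := by rw [hwdef]; module
  rw [hyw, inner_neg_right, norm_neg] at h2
  rw [hxw] at h1
  rw [norm_smul, mul_pow, Real.norm_of_nonneg (by norm_num)] at h1 h2
  rw [norm_sub_rev y x] at hnorm
  simp only [smul_eq_mul] at hconv
  have h3 : penVal P ξ y₀ c w + P.h w - m / 8 * ‖x - y‖ ^ 2 ≤
      1 / 2 * (penVal P ξ y₀ c x + P.h x) + 1 / 2 * (penVal P ξ y₀ c y + P.h y) := by linarith
  have h4 := mul_le_mul_of_nonneg_left h3 hl.le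
  have h5 : 1 / (4 * m) * (m / 8 * ‖x - y‖ ^ 2) = 1 / 32 * ‖x - y‖ ^ 2 := by
    linear_combination (‖x - y‖ ^ 2 / 8) * hlm
  unfold scaledObj
  linarith

theorem proxIter_dist_le (hP : P.Standing m Lx Ly chat) (hξ : 0 < ξ) (hc : 0 ≤ c)
    (hcenter : center ∈ P.X) {i j : ℕ} (hi : ⌈6 * condNum P m Lx Ly ξ c⌉₊ ≤ i)
    (hj : ⌈6 * condNum P m Lx Ly ξ c⌉₊ ≤ j) :
    ‖(proxIter P m Lx Ly ξ y₀ c center j).z - center‖ ≤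
      2 * ‖(proxIter P m Lx Ly ξ y₀ c center i).z - center‖ := by
  have hpos : 1 ≤ ⌈6 * condNum P m Lx Ly ξ c⌉₊ :=
    Nat.one_le_ceil_iff.2 (by linarith [one_le_condNum hP hξ hc])
  exact (proxIter_cert hP hξ hc hcenter (hpos.trans hi)).dist_le
    (proxIter_cert hP hξ hc hcenter (hpos.trans hj)) (proxIter_A_ge hP hξ hc hi)
    (proxIter_A_ge hP hξ hc hj) fun x hx y hy => scaledObj_midpoint hP hξ hc hx hy

/-- Once the residual of the iterate `i` is at most `λ ρ / 20`, all later residuals are at most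
`λ ρ / 8`. -/
theorem proxIter_norm_v_le (hP : P.Standing m Lx Ly chat) (hξ : 0 < ξ) (hc : 0 ≤ c)
    (hcenter : center ∈ P.X) {i j : ℕ} (hi : ⌈6 * condNum P m Lx Ly ξ c⌉₊ ≤ i)
    (hj : ⌈6 * condNum P m Lx Ly ξ c⌉₊ ≤ j) {r : ℝ}
    (hv : ‖center - (proxIter P m Lx Ly ξ y₀ c center i).z +
      (proxIter P m Lx Ly ξ y₀ c center i).u‖ ≤ r / 20) :
    ‖(proxIter P m Lx Ly ξ y₀ c center j).z - center‖ ≤ 9 / 80 * r ∧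
    ‖center - (proxIter P m Lx Ly ξ y₀ c center j).z +
      (proxIter P m Lx Ly ξ y₀ c center j).u‖ ≤ r / 8 := by
  have hpos : 1 ≤ ⌈6 * condNum P m Lx Ly ξ c⌉₊ :=
    Nat.one_le_ceil_iff.2 (by linarith [one_le_condNum hP hξ hc])
  have h1 := proxIter_dist_le (y₀ := y₀) hP hξ hc hcenter hi hj
  have h2 := (proxIter_cert (y₀ := y₀) hP hξ hc hcenter (hpos.trans hi)).le_norm_v
    (proxIter_A_ge hP hξ hc hi)
  have h3 := (proxIter_cert (y₀ := y₀) hP hξ hc hcenter (hpos.trans hj)).norm_v_le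
    (proxIter_A_ge hP hξ hc hj)
  constructor <;> linarith

/-- After the residual test has been passed, `ε ≤ λ ε̂` holds as soon as `A ≥ s²`. -/
theorem proxIter_eps_le (hP : P.Standing m Lx Ly chat) (hξ : 0 < ξ) (hc : 0 ≤ c)
    (hcenter : center ∈ P.X) {i j : ℕ} (hi : ⌈6 * condNum P m Lx Ly ξ c⌉₊ ≤ i)
    (hj : ⌈6 * condNum P m Lx Ly ξ c⌉₊ ≤ j) {ρ : ℝ}
    (hv : ‖center - (proxIter P m Lx Ly ξ y₀ c center i).z +
      (proxIter P m Lx Ly ξ y₀ c center i).u‖ ≤ 1 / (4 * m) * ρ / 20)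
    (hA : condNum P m Lx Ly ξ c ^ 2 ≤ (proxIter P m Lx Ly ξ y₀ c center j).A) :
    (proxIter P m Lx Ly ξ y₀ c center j).ε ≤
      ρ ^ 2 / (32 * (Lsmooth m Lx Ly ξ + c * ‖P.A‖ ^ 2 + 1 / (1 / (4 * m)))) * (1 / (4 * m)) := by
  have hpos : 1 ≤ ⌈6 * condNum P m Lx Ly ξ c⌉₊ :=
    Nat.one_le_ceil_iff.2 (by linarith [one_le_condNum hP hξ hc])
  have hM := lipschitz_nonneg hP hξ hc
  have hm := hP.m_pos
  have hl : 0 < 1 / (4 * m) := by positivity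
  have hsq := condNum_sq hP hξ hc
  obtain ⟨hd, -⟩ := proxIter_norm_v_le hP hξ hc hcenter hi hj hv
  have hcert := proxIter_cert (y₀ := y₀) hP hξ hc hcenter (hpos.trans hj)
  have h1 := hcert.eps_le
  have h2 := pow_le_pow_left₀ (norm_nonneg _) hd 2
  have h0 := hcert.eps_nonneg
  set ε := (proxIter P m Lx Ly ξ y₀ c center j).ε
  set A := (proxIter P m Lx Ly ξ y₀ c center j).A
  set M := Lsmooth m Lx Ly ξ + c * ‖P.A‖ ^ 2
  set l := 1 / (4 * m)
  rw [div_mul_eq_mul_div, le_div_iff₀ (by positivity)]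
  have h3 : 2 * condNum P m Lx Ly ξ c ^ 2 * ε ≤ (9 / 80 * (l * ρ)) ^ 2 := by
    nlinarith
  have h4 : l * (ε * (32 * (M + 1 / l))) ≤ l * (ρ ^ 2 * l) := by
    have h5 : l * (ε * (32 * (M + 1 / l))) = 32 * ((l * M + 1) * ε) := by field_simp
    rw [h5]
    rw [hsq] at h3
    have : 0 ≤ l * M * ε := by positivity
    nlinarith [sq_nonneg (l * ρ)]
  exact le_of_mul_le_mul_left h4 hl

/-- The composite gradient step at the end of the AIPP method turns an accurate inexact solution of
the prox subproblem into a nearly stationary point of `f_c + h`. -/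
theorem gradient_step (hP : P.Standing m Lx Ly chat) (hξ : 0 < ξ) (hc : 0 ≤ c) {s : AcgState E}
    (hs : AcgCert P.X (fun x => scaledObj P m ξ y₀ c x + 1 / 2 * ‖x - center‖ ^ 2) center s)
    {ρ M Ml : ℝ} (hM : M = Lsmooth m Lx Ly ξ + c * ‖P.A‖ ^ 2) (hMl : Ml = M + 1 / (1 / (4 * m)))
    (hρ : 0 < ρ) (hv : ‖center - s.z + s.u‖ ≤ 1 / (4 * m) * ρ / 8)
    (hε : s.ε ≤ ρ ^ 2 / (32 * Ml) * (1 / (4 * m))) {x : E}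
    (hx : x = argminOn P.X fun x' => 1 / Ml * P.h x' +
      1 / 2 * ‖x' - (s.z - Ml⁻¹ • penGrad P ξ y₀ c s.z)‖ ^ 2) :
    x ∈ P.X ∧ scaledObj P m ξ y₀ c x ≤ scaledObj P m ξ y₀ c s.z ∧
      Ml • (s.z - x) - penGrad P ξ y₀ c s.z ∈ subdiff P.X P.h x ∧
      ‖Ml • (s.z - x) + penGrad P ξ y₀ c x - penGrad P ξ y₀ c s.z‖ ≤ ρ := by
  have hM0 : 0 < M := hM ▸ lipschitz_nonneg hP hξ hc
  have hm := hP.m_pos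
  have hl : 0 < 1 / (4 * m) := by positivity
  set l := 1 / (4 * m) with hldef
  have hMl0 : 0 < Ml := by rw [hMl]; positivity
  have hlMl : l * Ml = l * M + 1 := by rw [hMl]; field_simp
  obtain ⟨hxX, h3⟩ := proxH_spec hP (by positivity) _ hx
  set g := penGrad P ξ y₀ c s.z with hg
  have hsub : Ml • (s.z - x) - g ∈ subdiff P.X P.h x := by
    refine ⟨hxX, fun x' hx' => ?_⟩
    have h4 := h3 x' hx'
    have h5 := sq_norm_expand x' x (s.z - Ml⁻¹ • g)
    have h6 := mul_le_mul_of_nonneg_left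
      (show 1 / Ml * P.h x ≤ 1 / Ml * P.h x' + inner ℝ (x - (s.z - Ml⁻¹ • g)) (x' - x) by linarith)
      hMl0.le
    have h7 : Ml • (s.z - x) - g = -(Ml • (x - (s.z - Ml⁻¹ • g))) := by
      have : Ml • (Ml⁻¹ • g) = g := by rw [smul_smul, mul_inv_cancel₀ hMl0.ne', one_smul]
      simp only [smul_sub, this]
      abel
    rw [h7, inner_neg_left, inner_smul_left]
    have h8 : ∀ t : ℝ, Ml * (1 / Ml * t) = t := by intro t; field_simp
    rw [mul_add, h8, h8] at h6
    simp only [conj_trivial]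
    linarith
  have hdesc : penVal P ξ y₀ c x + P.h x + (Ml - M / 2) * ‖x - s.z‖ ^ 2 ≤
      penVal P ξ y₀ c s.z + P.h s.z := by
    have h4 := hsub.2 s.z hs.z_mem
    have h5 := penVal_upper (y₀ := y₀) hP hξ hc hxX hs.z_mem
    rw [← hM, ← hg] at h5
    rw [inner_sub_left, inner_smul_left, real_inner_self_eq_norm_sq, norm_sub_rev] at h4
    simp only [conj_trivial] at h4
    have h6 : inner ℝ g (x - s.z) = - inner ℝ g (s.z - x) := by
      rw [← inner_neg_right, neg_sub]
    rw [h6] at h5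
    linarith
  have hcoef : 0 ≤ (Ml - M / 2) * ‖x - s.z‖ ^ 2 := by
    have : 0 ≤ 1 / l := by positivity
    have : 0 ≤ Ml - M / 2 := by rw [hMl]; linarith
    positivity
  refine ⟨hxX, ?_, hsub, ?_⟩
  · unfold scaledObj
    exact mul_le_mul_of_nonneg_left (by linarith) hl.le
  · have h4 := hs.subgrad x hxX
    have h5 := sq_norm_expand x s.z center
    have h6 : -(‖center - s.z + s.u‖ * ‖x - s.z‖) ≤ inner ℝ (center - s.z + s.u) (x - s.z) :=
      (abs_le.1 (abs_real_inner_le_norm _ _)).1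
    have h7 : inner ℝ (s.z - center) (x - s.z) + inner ℝ (center - s.z + s.u) (x - s.z) =
        inner ℝ s.u (x - s.z) := by
      rw [← inner_add_left]; congr 1; abel
    have h8 := mul_le_mul_of_nonneg_left hdesc hl.le
    simp only [scaledObj, ← hldef] at h4
    set δ := ‖x - s.z‖ with hδ
    have hδ0 : 0 ≤ δ := norm_nonneg _
    have h9 : l * Ml / 2 * δ ^ 2 ≤ l * ρ / 8 * δ + ρ ^ 2 / (32 * Ml) * l := by
      have h10 := mul_le_mul_of_nonneg_right hv hδ0
      have h11 : l * ((Ml - M / 2) * δ ^ 2) = (l * Ml / 2 + 1 / 2) * δ ^ 2 := by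
        linear_combination (δ ^ 2 / 2) * hlMl
      linarith
    -- `t = Mλ δ` satisfies `t² / 2 ≤ ρ t / 8 + ρ² / 32`, which fails for `t > ρ / 2`. The bound
    -- `‖v‖ ≤ λ ρ / 8` is what leaves room for `‖ū‖ ≤ 2 t ≤ ρ`.
    have h12 : Ml * δ ≤ ρ / 2 := by
      have h13 : (Ml * δ) ^ 2 / 2 ≤ ρ / 8 * (Ml * δ) + ρ ^ 2 / 32 := by
        have := mul_le_mul_of_nonneg_left h9 (by positivity : 0 ≤ Ml / l)
        have e1 : Ml / l * (l * Ml / 2 * δ ^ 2) = (Ml * δ) ^ 2 / 2 := by field_simp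
        have e2 : Ml / l * (l * ρ / 8 * δ + ρ ^ 2 / (32 * Ml) * l) =
            ρ / 8 * (Ml * δ) + ρ ^ 2 / 32 := by field_simp
        rwa [e1, e2] at this
      by_contra! hlt
      nlinarith
    have h14 := penGrad_lipschitz (y₀ := y₀) hP hξ hc hxX hs.z_mem
    rw [← hM, ← hδ, ← hg] at h14
    have h15 : Ml • (s.z - x) + penGrad P ξ y₀ c x - g =
        Ml • (s.z - x) + (penGrad P ξ y₀ c x - g) := by abel
    have h16 : M * δ ≤ Ml * δ :=
      mul_le_mul_of_nonneg_right (by rw [hMl]; linarith [show 0 ≤ 1 / l by positivity]) hδ0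
    rw [h15]
    refine (norm_add_le _ _).trans ?_
    rw [norm_smul, Real.norm_of_nonneg hMl0.le, norm_sub_rev, ← hδ]
    linarith

end Iterates

/-! ### Runs of the AIPP method -/

section Runs

variable {E : Type*} {F : Type*} {U : Type*}
  [NormedAddCommGroup E] [InnerProductSpace ℝ E] [FiniteDimensional ℝ E] [CompleteSpace E]
  [NormedAddCommGroup F] [InnerProductSpace ℝ F] [FiniteDimensional ℝ F]
  [NormedAddCommGroup U] [InnerProductSpace ℝ U] [CompleteSpace U]

/-- From the state `s`, the scheme terminates with a stationary quintuple after at most `B` single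
oracle evaluations. -/
def SolvesWithin (P : Problem E F U) (I : Input E F U) (ρx ρy η : ℝ) (s : State E) (B : ℝ) : Prop :=
  ∃ (q : Quintuple E F U) (n : ℕ), Runs P I s q n ∧ (n : ℝ) ≤ B ∧ P.IsStationary ρx ρy η q

variable {P : Problem E F U} {m Lx Ly chat ξ c : ℝ} {x₀ center : E} {y₀ : F} {ρx ρy η B : ℝ}

theorem SolvesWithin.mono {I : Input E F U} {s : State E} {B' : ℝ}
    (h : SolvesWithin P I ρx ρy η s B) (hB : B ≤ B') : SolvesWithin P I ρx ρy η s B' := by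
  obtain ⟨q, n, h1, h2, h3⟩ := h
  exact ⟨q, n, h1, h2.trans hB, h3⟩

theorem SolvesWithin.next {I : Input E F U} {s s' : State E} {n : ℕ}
    (hs : (I.step s).exec P = (Sum.inl s', n)) (h : SolvesWithin P I ρx ρy η s' B) :
    SolvesWithin P I ρx ρy η s (B + n) := by
  obtain ⟨q, k, h1, h2, h3⟩ := h
  refine ⟨q, n + k, Runs.next hs h1, ?_, h3⟩
  push_cast
  linarith

open scoped Classical in
theorem step_solve (j : ℕ) :
    ((P.input m Lx Ly chat ξ x₀ y₀ ρx η).step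
      ⟨.solve, c, center, j, proxIter P m Lx Ly ξ y₀ c center j⟩).exec P =
    (Sum.inl (if ⌈6 * condNum P m Lx Ly ξ c⌉₊ ≤ j + 1 ∧
        (P.input m Lx Ly chat ξ x₀ y₀ ρx η).inexact center
          (proxIter P m Lx Ly ξ y₀ c center (j + 1))
      then ⟨.test, c, center, j + 1, proxIter P m Lx Ly ξ y₀ c center (j + 1)⟩
      else ⟨.solve, c, center, j + 1, proxIter P m Lx Ly ξ y₀ c center (j + 1)⟩), 9) := by
  simp only [Input.step, exec_bind, acg_exec, Prog.exec, ← proxIter_succ]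
  rfl

open scoped Classical in
theorem step_test (j : ℕ) (t : AcgState E) :
    ((P.input m Lx Ly chat ξ x₀ y₀ ρx η).step ⟨.test, c, center, j, t⟩).exec P =
    (Sum.inl (if ‖center - t.z + t.u‖ ≤ 1 / (4 * m) * (ρx / 4) / 5
      then ⟨.refine, c, center, j, t⟩ else State.begin c t.z), 0) := rfl

open scoped Classical in
theorem step_refine (j : ℕ) :
    ((P.input m Lx Ly chat ξ x₀ y₀ ρx η).step
      ⟨.refine, c, center, j, proxIter P m Lx Ly ξ y₀ c center j⟩).exec P =
    if (proxIter P m Lx Ly ξ y₀ c center j).ε ≤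
          ρx ^ 2 / (32 * (Lsmooth m Lx Ly ξ + c * ‖P.A‖ ^ 2 + 1 / (1 / (4 * m)))) * (1 / (4 * m)) ∧
        (P.input m Lx Ly chat ξ x₀ y₀ ρx η).inexact center (proxIter P m Lx Ly ξ y₀ c center j)
      then (Sum.inl ⟨.finish, c, center, j, proxIter P m Lx Ly ξ y₀ c center j⟩, 0)
      else (Sum.inl ⟨.refine, c, center, j + 1, proxIter P m Lx Ly ξ y₀ c center (j + 1)⟩, 9) := by
  simp only [Input.step]
  refine (apply_ite (fun p : Prog E F (State E ⊕ Quintuple E F U) => p.exec P) _ _ _).trans ?_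
  simp only [exec_bind, acg_exec, Prog.exec, ← proxIter_succ]
  rfl

open scoped Classical in
theorem step_finish (j : ℕ) (t : AcgState E) {Ml : ℝ} {x : E}
    (hMl : Ml = Lsmooth m Lx Ly ξ + c * ‖P.A‖ ^ 2 + 1 / (1 / (4 * m)))
    (hx : x = argminOn P.X fun x' => 1 / Ml * P.h x' +
      1 / 2 * ‖x' - (t.z - Ml⁻¹ • penGrad P ξ y₀ c t.z)‖ ^ 2) :
    ((P.input m Lx Ly chat ξ x₀ y₀ ρx η).step ⟨.finish, c, center, j, t⟩).exec P =
    if η < ‖P.A x - P.b‖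
      then (Sum.inl (State.begin (2 * c) x₀), 7)
      else (Sum.inr ⟨Ml • (t.z - x) + penGrad P ξ y₀ c x - penGrad P ξ y₀ c t.z,
        ξ⁻¹ • (y₀ - smoothArg P ξ y₀ x), x, smoothArg P ξ y₀ x, c • (P.A x - P.b)⟩, 8) := by
  subst hMl hx
  simp only [Input.step, exec_bind, penalized_exec, Prog.exec]
  by_cases h : η < ‖P.A (argminOn P.X fun x' =>
      1 / (Lsmooth m Lx Ly ξ + c * ‖P.A‖ ^ 2 + 1 / (1 / (4 * m))) * P.h x' +
      1 / 2 * ‖x' - (t.z - (Lsmooth m Lx Ly ξ + c * ‖P.A‖ ^ 2 + 1 / (1 / (4 * m)))⁻¹ •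
        penGrad P ξ y₀ c t.z)‖ ^ 2) - P.b‖
  · rw [if_pos h]
    erw [if_pos h]
    rfl
  · rw [if_neg h]
    erw [if_neg h]
    rfl

/-- Step 1 of the AIPP method stops after exactly `⌈6 s⌉` ACG iterations. -/
theorem solves_solve (hP : P.Standing m Lx Ly chat) (hξ : 0 < ξ) (hc : 0 ≤ c)
    (hcenter : center ∈ P.X)
    (h : SolvesWithin P (P.input m Lx Ly chat ξ x₀ y₀ ρx η) ρx ρy η
      ⟨.test, c, center, ⌈6 * condNum P m Lx Ly ξ c⌉₊,
        proxIter P m Lx Ly ξ y₀ c center ⌈6 * condNum P m Lx Ly ξ c⌉₊⟩ B) :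
    SolvesWithin P (P.input m Lx Ly chat ξ x₀ y₀ ρx η) ρx ρy η (State.begin c center)
      (B + 9 * ⌈6 * condNum P m Lx Ly ξ c⌉₊) := by
  set J := ⌈6 * condNum P m Lx Ly ξ c⌉₊ with hJ
  have hJ1 : 1 ≤ J := Nat.one_le_ceil_iff.2 (by linarith [one_le_condNum hP hξ hc])
  have hinex : (P.input m Lx Ly chat ξ x₀ y₀ ρx η).inexact center
      (proxIter P m Lx Ly ξ y₀ c center J) :=
    (proxIter_cert hP hξ hc hcenter hJ1).inexact (proxIter_A_ge hP hξ hc le_rfl)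
  have key : ∀ d j, j + (d + 1) = J →
      SolvesWithin P (P.input m Lx Ly chat ξ x₀ y₀ ρx η) ρx ρy η
        ⟨.solve, c, center, j, proxIter P m Lx Ly ξ y₀ c center j⟩ (B + 9 * (d + 1)) := by
    intro d
    induction d with
    | zero =>
      intro j hj
      have hj' : j + 1 = J := by omega
      have hstep := step_solve (P := P) (m := m) (Lx := Lx) (Ly := Ly) (chat := chat) (ξ := ξ)
        (c := c) (x₀ := x₀) (center := center) (y₀ := y₀) (ρx := ρx) (η := η) j
      rw [hj', if_pos ⟨le_rfl, hinex⟩] at hstep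
      exact (SolvesWithin.next hstep h).mono (by norm_num)
    | succ d ih =>
      intro j hj
      have hstep := step_solve (P := P) (m := m) (Lx := Lx) (Ly := Ly) (chat := chat) (ξ := ξ)
        (c := c) (x₀ := x₀) (center := center) (y₀ := y₀) (ρx := ρx) (η := η) j
      rw [if_neg (fun hh => by have := hh.1; omega)] at hstep
      refine (SolvesWithin.next hstep (ih (j + 1) (by omega))).mono ?_
      push_cast
      linarith
  obtain ⟨d, hd⟩ := Nat.exists_eq_add_of_le' hJ1
  have := key d 0 (by omega)
  rw [hd]
  push_cast
  exact this

/-- Step 3 of the AIPP method makes at most `d` ACG iterations if `A` exceeds `s²` after `d` of them. -/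
theorem solves_refine (hP : P.Standing m Lx Ly chat) (hξ : 0 < ξ) (hc : 0 ≤ c)
    (hcenter : center ∈ P.X)
    (hv : ‖center - (proxIter P m Lx Ly ξ y₀ c center ⌈6 * condNum P m Lx Ly ξ c⌉₊).z +
      (proxIter P m Lx Ly ξ y₀ c center ⌈6 * condNum P m Lx Ly ξ c⌉₊).u‖ ≤ 1 / (4 * m) * ρx / 20)
    (h : ∀ j, ⌈6 * condNum P m Lx Ly ξ c⌉₊ ≤ j → (proxIter P m Lx Ly ξ y₀ c center j).ε ≤
          ρx ^ 2 / (32 * (Lsmooth m Lx Ly ξ + c * ‖P.A‖ ^ 2 + 1 / (1 / (4 * m)))) * (1 / (4 * m)) →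
      SolvesWithin P (P.input m Lx Ly chat ξ x₀ y₀ ρx η) ρx ρy η
        ⟨.finish, c, center, j, proxIter P m Lx Ly ξ y₀ c center j⟩ B)
    (d : ℕ) : ∀ j, ⌈6 * condNum P m Lx Ly ξ c⌉₊ ≤ j →
      condNum P m Lx Ly ξ c ^ 2 ≤ (proxIter P m Lx Ly ξ y₀ c center (j + d)).A →
      SolvesWithin P (P.input m Lx Ly chat ξ x₀ y₀ ρx η) ρx ρy η
        ⟨.refine, c, center, j, proxIter P m Lx Ly ξ y₀ c center j⟩ (B + 9 * d) := by
  have hJ1 : 1 ≤ ⌈6 * condNum P m Lx Ly ξ c⌉₊ :=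
    Nat.one_le_ceil_iff.2 (by linarith [one_le_condNum hP hξ hc])
  have hinex : ∀ j, ⌈6 * condNum P m Lx Ly ξ c⌉₊ ≤ j →
      (P.input m Lx Ly chat ξ x₀ y₀ ρx η).inexact center (proxIter P m Lx Ly ξ y₀ c center j) :=
    fun j hj => (proxIter_cert hP hξ hc hcenter (hJ1.trans hj)).inexact (proxIter_A_ge hP hξ hc hj)
  induction d with
  | zero =>
    intro j hj hA
    have hε := proxIter_eps_le hP hξ hc hcenter le_rfl hj hv hA
    have hstep := step_refine (P := P) (m := m) (Lx := Lx) (Ly := Ly) (chat := chat) (ξ := ξ)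
        (c := c) (x₀ := x₀) (center := center) (y₀ := y₀) (ρx := ρx) (η := η) j
    rw [if_pos ⟨hε, hinex j hj⟩] at hstep
    exact (SolvesWithin.next hstep (h j hj hε)).mono (by norm_num)
  | succ d ih =>
    intro j hj hA
    have hstep := step_refine (P := P) (m := m) (Lx := Lx) (Ly := Ly) (chat := chat) (ξ := ξ)
        (c := c) (x₀ := x₀) (center := center) (y₀ := y₀) (ρx := ρx) (η := η) j
    by_cases hε : (proxIter P m Lx Ly ξ y₀ c center j).ε ≤
          ρx ^ 2 / (32 * (Lsmooth m Lx Ly ξ + c * ‖P.A‖ ^ 2 + 1 / (1 / (4 * m)))) * (1 / (4 * m))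
    · rw [if_pos ⟨hε, hinex j hj⟩] at hstep
      refine (SolvesWithin.next hstep (h j hj hε)).mono ?_
      push_cast
      have : (0 : ℝ) ≤ d := Nat.cast_nonneg d
      linarith
    · rw [if_neg (fun hh => hε hh.1)] at hstep
      refine (SolvesWithin.next hstep (ih (j + 1) (by omega)
        (by rwa [show j + 1 + d = j + (d + 1) by ring]))).mono ?_
      push_cast
      linarith

/-- The final step of the AIPP method, from an accurate inexact solution: it either outputs a
stationary quintuple or restarts with a larger penalty parameter. -/
theorem solves_finish (hP : P.Standing m Lx Ly chat) (hξ : 0 < ξ) (hc : 0 ≤ c)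
    (hy₀ : y₀ ∈ P.Y) (hρx : 0 < ρx) (hρy : 0 < ρy) (hDy : P.Dy / ρy ≤ ξ)
    (hB : 0 ≤ B) (j : ℕ) {t : AcgState E}
    (ht : AcgCert P.X (fun x => scaledObj P m ξ y₀ c x + 1 / 2 * ‖x - center‖ ^ 2) center t)
    (hv : ‖center - t.z + t.u‖ ≤ 1 / (4 * m) * ρx / 8)
    (hε : t.ε ≤
      ρx ^ 2 / (32 * (Lsmooth m Lx Ly ξ + c * ‖P.A‖ ^ 2 + 1 / (1 / (4 * m)))) * (1 / (4 * m)))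
    (h : ∀ x ∈ P.X, scaledObj P m ξ y₀ c x ≤ scaledObj P m ξ y₀ c t.z → η < ‖P.A x - P.b‖ →
      SolvesWithin P (P.input m Lx Ly chat ξ x₀ y₀ ρx η) ρx ρy η (State.begin (2 * c) x₀) B) :
    SolvesWithin P (P.input m Lx Ly chat ξ x₀ y₀ ρx η) ρx ρy η ⟨.finish, c, center, j, t⟩
      (B + 8) := by
  obtain ⟨Ml, hMl⟩ : ∃ Ml, Ml = Lsmooth m Lx Ly ξ + c * ‖P.A‖ ^ 2 + 1 / (1 / (4 * m)) := ⟨_, rfl⟩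
  obtain ⟨x, hx⟩ : ∃ x, x = argminOn P.X fun x' => 1 / Ml * P.h x' +
      1 / 2 * ‖x' - (t.z - Ml⁻¹ • penGrad P ξ y₀ c t.z)‖ ^ 2 := ⟨_, rfl⟩
  rw [← hMl] at hε
  obtain ⟨hxX, hdesc, hsub, hu⟩ := gradient_step hP hξ hc ht rfl hMl hρx hv hε hx
  have hstep := step_finish (P := P) (m := m) (Lx := Lx) (Ly := Ly) (chat := chat) (ξ := ξ)
        (c := c) (x₀ := x₀) (center := center) (y₀ := y₀) (ρx := ρx) (η := η) j t hMl hx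
  by_cases hfeas : η < ‖P.A x - P.b‖
  · rw [if_pos hfeas] at hstep
    refine (SolvesWithin.next hstep (h x hxX hdesc hfeas)).mono ?_
    norm_num
  · rw [if_neg hfeas] at hstep
    refine ⟨_, 8, Runs.halt hstep, by push_cast; linarith, ?_⟩
    obtain ⟨hyY, hmax⟩ := smoothArg_spec (standing_concave hP hxX) hξ y₀
    refine ⟨⟨_, hsub, ?_⟩, ⟨hyY, fun y hy => ?_⟩, hu, ?_, not_lt.1 hfeas⟩
    · simp only [penGrad, smoothGrad, map_smul]
      abel
    · have h1 := hmax y hy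
      have h2 := sq_norm_expand y (smoothArg P ξ y₀ x) y₀
      have h3 := mul_le_mul_of_nonneg_left
        (show ξ * P.Φ x y ≤ ξ * P.Φ x (smoothArg P ξ y₀ x) +
          inner ℝ (smoothArg P ξ y₀ x - y₀) (y - smoothArg P ξ y₀ x) by linarith)
        (inv_pos.2 hξ).le
      rw [mul_add, inv_mul_cancel_left₀ hξ.ne', inv_mul_cancel_left₀ hξ.ne'] at h3
      simp only
      rw [inner_smul_left, ← neg_sub (smoothArg P ξ y₀ x) y₀, inner_neg_left]
      simp only [conj_trivial]
      linarith
    · simp only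
      rw [norm_smul, Real.norm_of_nonneg (inv_pos.2 hξ).le, inv_mul_le_iff₀ hξ]
      rw [div_le_iff₀ hρy] at hDy
      exact (norm_sub_le_Dy hP hy₀ hyY).trans hDy

/-- One outer iteration of the AIPP method. -/
theorem solves_iteration (hP : P.Standing m Lx Ly chat) (hξ : 0 < ξ) (hc : 0 ≤ c)
    (hcenter : center ∈ P.X)
    (hy₀ : y₀ ∈ P.Y) (hρx : 0 < ρx) (hρy : 0 < ρy) (hDy : P.Dy / ρy ≤ ξ) (hB : 0 ≤ B)
    {V B' : ℝ} {d : ℕ}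
    (hd : condNum P m Lx Ly ξ c ^ 2 ≤ (1 + (condNum P m Lx Ly ξ c)⁻¹) ^ d)
    (hV : ∀ j, ⌈6 * condNum P m Lx Ly ξ c⌉₊ ≤ j →
      scaledObj P m ξ y₀ c (proxIter P m Lx Ly ξ y₀ c center j).z ≤ V)
    (h : ∀ x ∈ P.X, scaledObj P m ξ y₀ c x ≤ V → η < ‖P.A x - P.b‖ →
      SolvesWithin P (P.input m Lx Ly chat ξ x₀ y₀ ρx η) ρx ρy η (State.begin (2 * c) x₀) B)
    (hB' : B + 8 + 9 * d ≤ B')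
    (hnext : 1 / (4 * m) * ρx / 20 <
        ‖center - (proxIter P m Lx Ly ξ y₀ c center ⌈6 * condNum P m Lx Ly ξ c⌉₊).z +
          (proxIter P m Lx Ly ξ y₀ c center ⌈6 * condNum P m Lx Ly ξ c⌉₊).u‖ →
      SolvesWithin P (P.input m Lx Ly chat ξ x₀ y₀ ρx η) ρx ρy η
        (State.begin c (proxIter P m Lx Ly ξ y₀ c center ⌈6 * condNum P m Lx Ly ξ c⌉₊).z) B') :
    SolvesWithin P (P.input m Lx Ly chat ξ x₀ y₀ ρx η) ρx ρy η (State.begin c center)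
      (B' + 9 * ⌈6 * condNum P m Lx Ly ξ c⌉₊) := by
  have hJ1 : 1 ≤ ⌈6 * condNum P m Lx Ly ξ c⌉₊ :=
    Nat.one_le_ceil_iff.2 (by linarith [one_le_condNum hP hξ hc])
  refine solves_solve hP hξ hc hcenter ?_
  have hstep := step_test (P := P) (m := m) (Lx := Lx) (Ly := Ly) (chat := chat) (ξ := ξ)
        (c := c) (x₀ := x₀) (center := center) (y₀ := y₀) (ρx := ρx) (η := η)
        ⌈6 * condNum P m Lx Ly ξ c⌉₊
        (proxIter P m Lx Ly ξ y₀ c center ⌈6 * condNum P m Lx Ly ξ c⌉₊)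
  have h20 : 1 / (4 * m) * (ρx / 4) / 5 = 1 / (4 * m) * ρx / 20 := by ring
  rw [h20] at hstep
  by_cases hv : ‖center - (proxIter P m Lx Ly ξ y₀ c center ⌈6 * condNum P m Lx Ly ξ c⌉₊).z +
      (proxIter P m Lx Ly ξ y₀ c center ⌈6 * condNum P m Lx Ly ξ c⌉₊).u‖ ≤ 1 / (4 * m) * ρx / 20
  · rw [if_pos hv] at hstep
    refine (SolvesWithin.next hstep (solves_refine hP hξ hc hcenter hv (B := B + 8) ?_ d _ le_rfl
      ?_)).mono (by norm_num; linarith)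
    · intro j hj hε
      exact solves_finish hP hξ hc hy₀ hρx hρy hDy hB j
        (proxIter_cert hP hξ hc hcenter (hJ1.trans hj))
        (proxIter_norm_v_le hP hξ hc hcenter le_rfl hj hv).2 hε
        fun x hx hle => h x hx (hle.trans (hV j hj))
    · refine hd.trans (le_trans ?_ (proxIter_A_geometric hP hξ hc _ d))
      have h18 := proxIter_A_ge (y₀ := y₀) (center := center) hP hξ hc le_rfl
      have hs := one_le_condNum hP hξ hc
      have : 0 ≤ (1 + (condNum P m Lx Ly ξ c)⁻¹) ^ d := by positivity
      nlinarith
  · rw [if_neg hv] at hstep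
    exact (SolvesWithin.next hstep (hnext (not_le.1 hv))).mono (by norm_num)

/-- The outer loop of the AIPP method: each unsuccessful iteration decreases the objective by a fixed
amount. -/
theorem solves_loop (hP : P.Standing m Lx Ly chat) (hξ : 0 < ξ) (hc : 0 ≤ c)
    (hy₀ : y₀ ∈ P.Y) (hρx : 0 < ρx) (hρy : 0 < ρy) (hDy : P.Dy / ρy ≤ ξ) (hB : 0 ≤ B)
    {V low : ℝ} {d : ℕ}
    (hd : condNum P m Lx Ly ξ c ^ 2 ≤ (1 + (condNum P m Lx Ly ξ c)⁻¹) ^ d)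
    (hlow : ∀ x ∈ P.X, low ≤ scaledObj P m ξ y₀ c x)
    (h : ∀ x ∈ P.X, scaledObj P m ξ y₀ c x ≤ V → η < ‖P.A x - P.b‖ →
      SolvesWithin P (P.input m Lx Ly chat ξ x₀ y₀ ρx η) ρx ρy η (State.begin (2 * c) x₀) B)
    (N : ℕ) : ∀ center ∈ P.X, scaledObj P m ξ y₀ c center ≤ V →
      scaledObj P m ξ y₀ c center ≤ low + N * (1 / 4 * (1 / (4 * m) * ρx / 20) ^ 2) →
      SolvesWithin P (P.input m Lx Ly chat ξ x₀ y₀ ρx η) ρx ρy η (State.begin c center)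
        (B + 8 + 9 * d + (N + 1) * (9 * ⌈6 * condNum P m Lx Ly ξ c⌉₊)) := by
  have hJ1 : 1 ≤ ⌈6 * condNum P m Lx Ly ξ c⌉₊ :=
    Nat.one_le_ceil_iff.2 (by linarith [one_le_condNum hP hξ hc])
  have hm := hP.m_pos
  have hdesc : ∀ center ∈ P.X, ∀ j, ⌈6 * condNum P m Lx Ly ξ c⌉₊ ≤ j →
      scaledObj P m ξ y₀ c (proxIter P m Lx Ly ξ y₀ c center j).z +
        1 / 4 * ‖center - (proxIter P m Lx Ly ξ y₀ c center j).z +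
          (proxIter P m Lx Ly ξ y₀ c center j).u‖ ^ 2 ≤ scaledObj P m ξ y₀ c center :=
    fun center hcenter j hj => (proxIter_cert hP hξ hc hcenter (hJ1.trans hj)).descent
      (proxIter_A_ge hP hξ hc hj) hcenter
  have hmono : ∀ center ∈ P.X, ∀ j, ⌈6 * condNum P m Lx Ly ξ c⌉₊ ≤ j →
      scaledObj P m ξ y₀ c (proxIter P m Lx Ly ξ y₀ c center j).z ≤
        scaledObj P m ξ y₀ c center :=
    fun center hcenter j hj => le_trans (le_add_of_nonneg_right (by positivity))
      (hdesc center hcenter j hj)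
  induction N with
  | zero =>
    intro center hcenter hV hN
    refine (solves_iteration hP hξ hc hcenter hy₀ hρx hρy hDy hB hd (V := V) ?_ h le_rfl ?_).mono
      (by push_cast; linarith)
    · intro j hj
      exact (hmono center hcenter j hj).trans hV
    · intro hv
      exfalso
      have h1 := hdesc center hcenter _ le_rfl
      have h2 := hlow _ (proxIter_cert (y₀ := y₀) hP hξ hc hcenter hJ1).z_mem
      have h3 : 0 < 1 / (4 * m) * ρx / 20 := by positivity
      have h4 := pow_pos (h3.trans hv) 2
      simp only [Nat.cast_zero, zero_mul, add_zero] at hN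
      linarith
  | succ N ih =>
    intro center hcenter hV hN
    have hV' : ∀ j, ⌈6 * condNum P m Lx Ly ξ c⌉₊ ≤ j →
        scaledObj P m ξ y₀ c (proxIter P m Lx Ly ξ y₀ c center j).z ≤ V := by
      intro j hj
      exact (hmono center hcenter j hj).trans hV
    refine (solves_iteration hP hξ hc hcenter hy₀ hρx hρy hDy hB hd (V := V)
      (B' := B + 8 + 9 * d + (N + 1) * (9 * ⌈6 * condNum P m Lx Ly ξ c⌉₊)) hV' h ?_ ?_).mono
      (by push_cast; linarith)
    · have : (0 : ℝ) ≤ (N + 1) * (9 * ⌈6 * condNum P m Lx Ly ξ c⌉₊) := by positivity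
      linarith
    · intro hv
      refine ih _ (proxIter_cert (y₀ := y₀) hP hξ hc hcenter hJ1).z_mem (hV' _ le_rfl) ?_
      have h1 := hdesc center hcenter _ le_rfl
      have h3 : 0 ≤ 1 / (4 * m) * ρx / 20 := by positivity
      have h4 := pow_le_pow_left₀ h3 hv.le 2
      push_cast at hN
      linarith

/-- The AIPP method for the penalty parameter `c`. -/
theorem solves_aipp (hP : P.Standing m Lx Ly chat) (hξ : 0 < ξ) (hc : 0 ≤ c)
    (hx₀ : x₀ ∈ P.X) (hy₀ : y₀ ∈ P.Y) (hρx : 0 < ρx) (hρy : 0 < ρy) (hDy : P.Dy / ρy ≤ ξ)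
    (hB : 0 ≤ B) {V low : ℝ} {d N : ℕ}
    (hd : condNum P m Lx Ly ξ c ^ 2 ≤ (1 + (condNum P m Lx Ly ξ c)⁻¹) ^ d)
    (hlow : ∀ x ∈ P.X, low ≤ scaledObj P m ξ y₀ c x)
    (hV : ∀ z ∈ P.X, (∀ x ∈ P.X, scaledObj P m ξ y₀ c z ≤
      scaledObj P m ξ y₀ c x + ‖x - x₀‖ ^ 2) → scaledObj P m ξ y₀ c z ≤ V)
    (hN : V ≤ low + N * (1 / 4 * (1 / (4 * m) * ρx / 20) ^ 2))
    (h : ∀ x ∈ P.X, scaledObj P m ξ y₀ c x ≤ V → η < ‖P.A x - P.b‖ →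
      SolvesWithin P (P.input m Lx Ly chat ξ x₀ y₀ ρx η) ρx ρy η (State.begin (2 * c) x₀) B) :
    SolvesWithin P (P.input m Lx Ly chat ξ x₀ y₀ ρx η) ρx ρy η (State.begin c x₀)
      (B + 8 + 9 * d + (N + 2) * (9 * ⌈6 * condNum P m Lx Ly ξ c⌉₊)) := by
  have hJ1 : 1 ≤ ⌈6 * condNum P m Lx Ly ξ c⌉₊ :=
    Nat.one_le_ceil_iff.2 (by linarith [one_le_condNum hP hξ hc])
  have hV' : ∀ j, ⌈6 * condNum P m Lx Ly ξ c⌉₊ ≤ j →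
      scaledObj P m ξ y₀ c (proxIter P m Lx Ly ξ y₀ c x₀ j).z ≤ V := by
    intro j hj
    have hcert := proxIter_cert (y₀ := y₀) hP hξ hc hx₀ (hJ1.trans hj)
    exact hV _ hcert.z_mem fun x hx => hcert.value_le (proxIter_A_ge hP hξ hc hj) hx
  refine (solves_iteration hP hξ hc hx₀ hy₀ hρx hρy hDy hB hd (V := V)
      (B' := B + 8 + 9 * d + (N + 1) * (9 * ⌈6 * condNum P m Lx Ly ξ c⌉₊)) hV' h ?_ ?_).mono
      (by linarith)
  · have : (0 : ℝ) ≤ (N + 1) * (9 * ⌈6 * condNum P m Lx Ly ξ c⌉₊) := by positivity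
    linarith
  · intro _
    exact solves_loop hP hξ hc hy₀ hρx hρy hDy hB hd hlow h N _
      (proxIter_cert (y₀ := y₀) hP hξ hc hx₀ hJ1).z_mem (hV' _ le_rfl)
      ((hV' _ le_rfl).trans hN)

end Runs

/-! ### The penalty method and the complexity bound -/

section Penalty

variable {E : Type*} {F : Type*} {U : Type*}
  [NormedAddCommGroup E] [InnerProductSpace ℝ E] [FiniteDimensional ℝ E] [CompleteSpace E]
  [NormedAddCommGroup F] [InnerProductSpace ℝ F] [FiniteDimensional ℝ F]
  [NormedAddCommGroup U] [InnerProductSpace ℝ U] [CompleteSpace U]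

variable {P : Problem E F U} {m Lx Ly chat ξ c : ℝ} {x₀ : E} {y₀ : F} {ρx ρy η B : ℝ}

/-- A lower bound of the scaled penalized objective, with the part of the penalty beyond `ĉ` left
over. -/
theorem scaledObj_lower (hP : P.Standing m Lx Ly chat) (hξ : 0 < ξ) (hy₀ : y₀ ∈ P.Y) {x : E}
    (hx : x ∈ P.X) :
    1 / (4 * m) * (P.penaltyValue P.phat chat - P.Dy ^ 2 / (2 * ξ)) +
      1 / (4 * m) * ((c - chat) / 2 * ‖P.A x - P.b‖ ^ 2) ≤ scaledObj P m ξ y₀ c x := by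
  have hm := hP.m_pos
  have h1 : P.penaltyValue P.phat chat ≤ P.phat x + chat / 2 * ‖P.A x - P.b‖ ^ 2 :=
    csInf_le hP.penalty_bddBelow ⟨x, hx, rfl⟩
  have h2 := p_le_pSmooth hP hξ hy₀ hx
  unfold scaledObj penVal
  rw [smoothVal_eq hP hξ hx, ← mul_add]
  refine mul_le_mul_of_nonneg_left ?_ (by positivity)
  have h3 : P.phat x = P.p x + P.h x := rfl
  linarith

theorem penaltyValue_le (hP : P.Standing m Lx Ly chat) {x : E} (hx : x ∈ P.X)
    (hAx : P.A x = P.b) : P.penaltyValue P.phat chat ≤ P.phat x := by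
  have h1 : P.penaltyValue P.phat chat ≤ P.phat x + chat / 2 * ‖P.A x - P.b‖ ^ 2 :=
    csInf_le hP.penalty_bddBelow ⟨x, hx, rfl⟩
  simpa [hAx] using h1

theorem R_nonneg (hP : P.Standing m Lx Ly chat) (x₀ : E) :
    0 ≤ P.R chat P.phat (1 / (4 * m)) x₀ := by
  have hm := hP.m_pos
  refine Real.sInf_nonneg ?_
  rintro _ ⟨x, ⟨hx, hAx⟩, rfl⟩
  have := sub_nonneg.2 (penaltyValue_le hP hx hAx)
  positivity

theorem gap_nonneg (hP : P.Standing m Lx Ly chat) (hξ : 0 < ξ) (x₀ : E) :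
    0 ≤ P.R chat P.phat (1 / (4 * m)) x₀ + P.Dy ^ 2 / (m * ξ) := by
  have := hP.m_pos
  have := R_nonneg hP x₀
  positivity

/-- A point whose objective value competes with those of all feasible points up to the squared
distance from `x₀` has an objective value that is controlled by `R`, uniformly in `c`. -/
theorem scaledObj_le_of_competes (hP : P.Standing m Lx Ly chat) (hξ : 0 < ξ) {z : E}
    (hz : ∀ x ∈ P.X, scaledObj P m ξ y₀ c z ≤ scaledObj P m ξ y₀ c x + ‖x - x₀‖ ^ 2) :
    scaledObj P m ξ y₀ c z ≤
      1 / (4 * m) * (P.penaltyValue P.phat chat - P.Dy ^ 2 / (2 * ξ)) +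
        2 * (P.R chat P.phat (1 / (4 * m)) x₀ + P.Dy ^ 2 / (m * ξ)) := by
  have hm := hP.m_pos
  have hl : 0 < 1 / (4 * m) := by positivity
  have hD : 1 / (4 * m) * (P.Dy ^ 2 / (2 * ξ)) = 1 / 8 * (P.Dy ^ 2 / (m * ξ)) := by
    field_simp; ring
  have hD0 : 0 ≤ P.Dy ^ 2 / (m * ξ) := by positivity
  have key : (scaledObj P m ξ y₀ c z - 1 / (4 * m) * P.penaltyValue P.phat chat) / 2 ≤
      P.R chat P.phat (1 / (4 * m)) x₀ := by
    obtain ⟨x, hx, hAx⟩ := hP.feasible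
    refine le_csInf (Set.Nonempty.image _ ⟨x, hx, hAx⟩) ?_
    rintro _ ⟨x, ⟨hx, hAx⟩, rfl⟩
    have h1 := hz x hx
    have h2 : scaledObj P m ξ y₀ c x ≤ 1 / (4 * m) * P.phat x := by
      unfold scaledObj penVal Problem.phat
      rw [smoothVal_eq hP hξ hx, hAx]
      refine mul_le_mul_of_nonneg_left ?_ hl.le
      have := pSmooth_le_p hP hξ y₀ hx
      simp only [sub_self, norm_zero]
      linarith
    have h3 := mul_nonneg hl.le (sub_nonneg.2 (penaltyValue_le hP hx hAx))
    rw [norm_sub_rev] at h1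
    simp only
    linarith
  linarith

/-- `A` reaches `s²` within `O(s (1 + log s))` iterations at the rate `1 + 1/s`, because
`log (1 + 1/s) ≥ 1 / (s + 1)`. -/
theorem exists_geometric_exponent {s : ℝ} (hs : 1 ≤ s) :
    ∃ d : ℕ, s ^ 2 ≤ (1 + s⁻¹) ^ d ∧ (d : ℝ) ≤ 4 * s * Real.log s + 1 := by
  have hs0 : 0 < s := by linarith
  have hlog := Real.log_nonneg hs
  refine ⟨⌈2 * (s + 1) * Real.log s⌉₊, ?_, ?_⟩
  · have h1 : 0 < 1 + s⁻¹ := by positivity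
    rw [← Real.log_le_log_iff (by positivity) (by positivity), Real.log_pow, Real.log_pow]
    have h2 : 1 / (s + 1) ≤ Real.log (1 + s⁻¹) := by
      have := Real.one_sub_inv_le_log_of_pos h1
      have h' : 1 - (1 + s⁻¹)⁻¹ = 1 / (s + 1) := by field_simp; ring
      rwa [h'] at this
    have h3 := Nat.le_ceil (2 * (s + 1) * Real.log s)
    calc _ = 2 * (s + 1) * Real.log s * (1 / (s + 1)) := by push_cast; field_simp
      _ ≤ _ := mul_le_mul h3 h2 (by positivity) (by positivity)
  · have := (Nat.ceil_lt_add_one (show 0 ≤ 2 * (s + 1) * Real.log s by positivity)).le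
    nlinarith

/-- The cost of the AIPP method for one penalty parameter `c`; a restart with `2 c` is needed only
as long as `c` is below the threshold `ĉ + 16 m (R + D_y² / (m ξ)) / η²`. -/
theorem solves_penalty (hP : P.Standing m Lx Ly chat) (hξ : 0 < ξ) (hc : chat < c)
    (hx₀ : x₀ ∈ P.X) (hy₀ : y₀ ∈ P.Y) (hρx : 0 < ρx) (hρy : 0 < ρy) (hη : 0 < η)
    (hDy : P.Dy / ρy ≤ ξ) (hB : 0 ≤ B) {W g : ℝ}
    (hg : g = P.R chat P.phat (1 / (4 * m)) x₀ + P.Dy ^ 2 / (m * ξ))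
    (hW : condNum P m Lx Ly ξ c ≤ W)
    (h : c < chat + 16 * m * g / η ^ 2 →
      SolvesWithin P (P.input m Lx Ly chat ξ x₀ y₀ ρx η) ρx ρy η (State.begin (2 * c) x₀) B) :
    SolvesWithin P (P.input m Lx Ly chat ξ x₀ y₀ ρx η) ρx ρy η (State.begin c x₀)
      (B + condNum P m Lx Ly ξ c *
        (206 + 36 * Real.log W + 3225600 * (m ^ 2 * g / ρx ^ 2))) := by
  have hm := hP.m_pos
  have hc0 : 0 ≤ c := hP.chat_nonneg.trans hc.le
  have hg0 : 0 ≤ g := hg ▸ gap_nonneg hP hξ x₀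
  have hs := one_le_condNum hP hξ hc0
  obtain ⟨d, hd, hd'⟩ := exists_geometric_exponent hs
  obtain ⟨low, hlow⟩ : ∃ low, low =
    1 / (4 * m) * (P.penaltyValue P.phat chat - P.Dy ^ 2 / (2 * ξ)) := ⟨_, rfl⟩
  have hlow' : ∀ x ∈ P.X, low + 1 / (4 * m) * ((c - chat) / 2 * ‖P.A x - P.b‖ ^ 2) ≤
      scaledObj P m ξ y₀ c x := fun x hx => hlow ▸ scaledObj_lower hP hξ hy₀ hx
  have hgap : 0 < c - chat := sub_pos.2 hc
  set Q := m ^ 2 * g / ρx ^ 2 with hQ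
  -- An unsuccessful iteration gains `(λ ρ_x / 20)² / 4 = ρ_x² / (25600 m²)`, out of at most `2 g`.
  have hN := Nat.le_ceil (51200 * Q)
  have hN' := (Nat.ceil_lt_add_one (show 0 ≤ 51200 * Q by positivity)).le
  refine (solves_aipp hP hξ hc0 hx₀ hy₀ hρx hρy hDy hB (V := low + 2 * g) (low := low)
    (N := ⌈51200 * Q⌉₊) hd ?_ ?_ ?_ ?_).mono ?_
  · exact fun x hx => le_trans (le_add_of_nonneg_right (by positivity)) (hlow' x hx)
  · intro z _ hz
    rw [hg, hlow]
    exact scaledObj_le_of_competes hP hξ hz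
  · have h1 : 2 * g = 51200 * Q * (1 / 4 * (1 / (4 * m) * ρx / 20) ^ 2) := by
      rw [hQ]; field_simp; ring
    rw [h1]
    exact add_le_add_right (mul_le_mul_of_nonneg_right hN (by positivity)) _
  · intro x hx hxV hinfeas
    refine h ?_
    have h1 := (hlow' x hx).trans hxV
    have h2 : η ^ 2 < ‖P.A x - P.b‖ ^ 2 := pow_lt_pow_left₀ hinfeas hη.le (by norm_num)
    have h3 : (c - chat) / 2 * η ^ 2 < (c - chat) / 2 * ‖P.A x - P.b‖ ^ 2 :=
      mul_lt_mul_of_pos_left h2 (by positivity)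
    have h4 := mul_le_mul_of_nonneg_left
      (show 1 / (4 * m) * ((c - chat) / 2 * ‖P.A x - P.b‖ ^ 2) ≤ 2 * g by linarith)
      (show 0 ≤ 4 * m by positivity)
    have h5 : ∀ t : ℝ, 4 * m * (1 / (4 * m) * t) = t := by intro t; field_simp
    rw [h5] at h4
    have h6 : c - chat < 16 * m * g / η ^ 2 := by
      rw [lt_div_iff₀ (by positivity)]
      linarith
    linarith
  · set s := condNum P m Lx Ly ξ c
    have hJ := (Nat.ceil_lt_add_one (show 0 ≤ 6 * s by positivity)).le
    have hlog : Real.log s ≤ Real.log W := Real.log_le_log (by linarith) hW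
    have hQ0 : 0 ≤ Q := by positivity
    have h1 : ((⌈51200 * Q⌉₊ : ℝ) + 2) * (9 * ⌈6 * s⌉₊) ≤ (51200 * Q + 3) * (63 * s) :=
      mul_le_mul (by linarith) (by linarith) (by positivity) (by positivity)
    have h2 : s * Real.log s ≤ s * Real.log W := mul_le_mul_of_nonneg_left hlog (by linarith)
    linarith

/-- A proxy for the condition number that scales exactly when `c` is doubled. -/
noncomputable def condProxy (P : Problem E F U) (m c : ℝ) : ℝ := √(2 * ‖P.A‖ ^ 2 * c / m)

theorem norm_A_pos (hP : P.Standing m Lx Ly chat) : 0 < ‖P.A‖ := norm_pos_iff.2 hP.A_ne_zero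

/-- The initial penalty parameter is so large that `c ‖A‖² ≥ L_ξ ≥ m`. -/
theorem condNum_le_condProxy (hP : P.Standing m Lx Ly chat) (hξ : 0 < ξ)
    (hc : chat + Lsmooth m Lx Ly ξ / ‖P.A‖ ^ 2 ≤ c) :
    condNum P m Lx Ly ξ c ≤ condProxy P m c := by
  have hm := hP.m_pos
  have hA := norm_A_pos hP
  refine Real.sqrt_le_sqrt ?_
  have h1 : Lsmooth m Lx Ly ξ ≤ c * ‖P.A‖ ^ 2 := by
    have := mul_le_mul_of_nonneg_right
      (show Lsmooth m Lx Ly ξ / ‖P.A‖ ^ 2 ≤ c by linarith [hP.chat_nonneg]) (sq_nonneg ‖P.A‖)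
    rwa [div_mul_cancel₀ _ (by positivity)] at this
  have h2 := Lsmooth_ge hP hξ
  rw [le_div_iff₀ hm]
  have h3 : (2 * (1 / (4 * m)) * (Lsmooth m Lx Ly ξ + c * ‖P.A‖ ^ 2) + 1) * m =
      1 / 2 * (Lsmooth m Lx Ly ξ + c * ‖P.A‖ ^ 2) + m := by field_simp; ring
  rw [h3]
  linarith

theorem condProxy_mono (hP : P.Standing m Lx Ly chat) {c c' : ℝ} (h : c ≤ c') :
    condProxy P m c ≤ condProxy P m c' := by
  have hm := hP.m_pos
  exact Real.sqrt_le_sqrt (by gcongr)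

theorem condProxy_double (P : Problem E F U) (m c : ℝ) :
    condProxy P m (2 * c) = √2 * condProxy P m c := by
  unfold condProxy
  rw [← Real.sqrt_mul (by norm_num)]
  congr 1
  ring

/-- The costs for the penalty parameters `c, 2 c, 4 c, …` grow geometrically, so that their sum is
dominated by the last one. The bound is linear in `condProxy` with a negative coefficient in order to
telescope. -/
theorem solves_doubling (hP : P.Standing m Lx Ly chat) (hξ : 0 < ξ)
    (hx₀ : x₀ ∈ P.X) (hy₀ : y₀ ∈ P.Y) (hρx : 0 < ρx) (hρy : 0 < ρy) (hη : 0 < η)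
    (hDy : P.Dy / ρy ≤ ξ) {g cmax : ℝ}
    (hg : g = P.R chat P.phat (1 / (4 * m)) x₀ + P.Dy ^ 2 / (m * ξ))
    (hcmax : 2 * (chat + 16 * m * g / η ^ 2) ≤ cmax) (k : ℕ) :
    ∀ c, chat + Lsmooth m Lx Ly ξ / ‖P.A‖ ^ 2 ≤ c → c ≤ cmax →
      chat + 16 * m * g / η ^ 2 ≤ 2 ^ k * c →
      SolvesWithin P (P.input m Lx Ly chat ξ x₀ y₀ ρx η) ρx ρy η (State.begin c x₀)
        ((206 + 36 * Real.log (condProxy P m cmax) + 3225600 * (m ^ 2 * g / ρx ^ 2)) *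
          (7 / 2 * condProxy P m cmax - 5 / 2 * condProxy P m c)) := by
  have hm := hP.m_pos
  have hA := norm_A_pos hP
  have hg0 : 0 ≤ g := hg ▸ gap_nonneg hP hξ x₀
  have hL : 0 < Lsmooth m Lx Ly ξ / ‖P.A‖ ^ 2 :=
    div_pos (hm.trans_le (Lsmooth_ge hP hξ)) (by positivity)
  have hcn := hP.chat_nonneg
  have hfacts : ∀ c, chat + Lsmooth m Lx Ly ξ / ‖P.A‖ ^ 2 ≤ c → c ≤ cmax →
      chat < c ∧ 1 ≤ condNum P m Lx Ly ξ c ∧ condNum P m Lx Ly ξ c ≤ condProxy P m c ∧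
      condProxy P m c ≤ condProxy P m cmax ∧
      0 ≤ 206 + 36 * Real.log (condProxy P m cmax) + 3225600 * (m ^ 2 * g / ρx ^ 2) := by
    intro c hc hcm
    have h1 := one_le_condNum (c := c) hP hξ (by linarith)
    have h2 := condNum_le_condProxy hP hξ hc
    have h3 := condProxy_mono hP hcm
    have h4 : 0 ≤ Real.log (condProxy P m cmax) := Real.log_nonneg (by linarith)
    exact ⟨by linarith, h1, h2, h3, by positivity⟩
  induction k with
  | zero =>
    intro c hc hcm hT
    obtain ⟨h1, h2, h3, h4, hG⟩ := hfacts c hc hcm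
    refine (solves_penalty hP hξ h1 hx₀ hy₀ hρx hρy hη hDy le_rfl hg (h3.trans h4) ?_).mono ?_
    · intro hlt
      rw [pow_zero, one_mul] at hT
      exact absurd hT (not_le.2 hlt)
    · rw [zero_add, mul_comm]
      exact mul_le_mul_of_nonneg_left (by linarith) hG
  | succ k ih =>
    intro c hc hcm hT
    obtain ⟨h1, h2, h3, h4, hG⟩ := hfacts c hc hcm
    by_cases hlt : c < chat + 16 * m * g / η ^ 2
    · have hc2 : chat + Lsmooth m Lx Ly ξ / ‖P.A‖ ^ 2 ≤ 2 * c := by linarith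
      have hcm2 : 2 * c ≤ cmax := by linarith
      have hrec := ih (2 * c) hc2 hcm2 (by rw [pow_succ (2 : ℝ)] at hT; linarith)
      obtain ⟨-, h2', h3', h4', -⟩ := hfacts (2 * c) hc2 hcm2
      refine (solves_penalty hP hξ h1 hx₀ hy₀ hρx hρy hη hDy
        (mul_nonneg hG (by linarith)) hg (h3.trans h4) (fun _ => hrec)).mono ?_
      rw [mul_comm (condNum P m Lx Ly ξ c), ← mul_add]
      refine mul_le_mul_of_nonneg_left ?_ hG
      rw [condProxy_double]
      have hsqrt : 7 / 5 ≤ √2 := Real.le_sqrt_of_sq_le (by norm_num)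
      nlinarith
    · refine (solves_penalty hP hξ h1 hx₀ hy₀ hρx hρy hη hDy le_rfl hg (h3.trans h4)
        (fun h => absurd h hlt)).mono ?_
      rw [zero_add, mul_comm]
      exact mul_le_mul_of_nonneg_left (by linarith) hG

theorem Lsmooth_le (hP : P.Standing m Lx Ly chat) (hξ : 0 < ξ) :
    Lsmooth m Lx Ly ξ ≤ (√ξ * Ly + √Lx) ^ 2 := by
  have hLx := hP.Lx_pos
  have hLy := hP.Ly_pos
  have h1 : √(ξ * (Lx + m)) ≤ √ξ * (2 * √Lx) := by
    rw [Real.sqrt_mul hξ.le]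
    refine mul_le_mul_of_nonneg_left ?_ (Real.sqrt_nonneg _)
    rw [Real.sqrt_le_left (by positivity), mul_pow, Real.sq_sqrt hLx.le]
    linarith [hP.m_le]
  have h2 := Real.sq_sqrt hξ.le
  have h3 := Real.sq_sqrt hLx.le
  have h4 := mul_le_mul_of_nonneg_left h1 hLy.le
  unfold Lsmooth
  have h5 : (√ξ * Ly + √Lx) ^ 2 = ξ * Ly ^ 2 + Ly * (√ξ * (2 * √Lx)) + Lx := by
    rw [add_sq, mul_pow, h2, h3]; ring
  rw [h5]
  linarith

theorem one_le_omega (hP : P.Standing m Lx Ly chat) (hη : 0 < η) :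
    1 ≤ P.omega m Lx Ly chat ξ x₀ η := by
  have := hP.Ly_pos
  have h1 : 0 ≤ (√ξ * Ly + √Lx) / √m := by positivity
  have h2 : 0 ≤ √(P.R chat P.phat (1 / (4 * m)) x₀ + P.Dy ^ 2 / (m * ξ)) * ‖P.A‖ / η := by
    positivity
  unfold Problem.omega omegaXi
  linarith

theorem condProxy_le_omega (hP : P.Standing m Lx Ly chat) (hξ : 0 < ξ) (hη : 0 < η) {g : ℝ}
    (hg : g = P.R chat P.phat (1 / (4 * m)) x₀ + P.Dy ^ 2 / (m * ξ)) :
    condProxy P m (max (chat + Lsmooth m Lx Ly ξ / ‖P.A‖ ^ 2)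
      (2 * (chat + 16 * m * g / η ^ 2))) ≤
      8 * √(1 + chat * ‖P.A‖ ^ 2 / m) * P.omega m Lx Ly chat ξ x₀ η := by
  have hm := hP.m_pos
  have hA := norm_A_pos hP
  have hcn := hP.chat_nonneg
  have hLy := hP.Ly_pos
  have hg0 : 0 ≤ g := hg ▸ gap_nonneg hP hξ x₀
  have hom := one_le_omega (x₀ := x₀) (ξ := ξ) hP hη
  unfold condProxy
  rw [Real.sqrt_le_left (by positivity), mul_pow, mul_pow, Real.sq_sqrt (by positivity)]
  have hL0 : 0 < Lsmooth m Lx Ly ξ := hm.trans_le (Lsmooth_ge hP hξ)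
  have hmax : max (chat + Lsmooth m Lx Ly ξ / ‖P.A‖ ^ 2) (2 * (chat + 16 * m * g / η ^ 2)) ≤
      (chat + Lsmooth m Lx Ly ξ / ‖P.A‖ ^ 2) + 2 * (chat + 16 * m * g / η ^ 2) :=
    max_le (le_add_of_nonneg_right (by positivity)) (le_add_of_nonneg_left (by positivity))
  set a := (√ξ * Ly + √Lx) / √m with ha
  set b := √g * ‖P.A‖ / η with hb
  have ha0 : 0 ≤ a := by positivity
  have hb0 : 0 ≤ b := by positivity
  have homega : P.omega m Lx Ly chat ξ x₀ η = 1 + a + b := by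
    unfold Problem.omega omegaXi
    rw [← hg]
  have ha2 : Lsmooth m Lx Ly ξ / m ≤ a ^ 2 := by
    rw [ha, div_pow, Real.sq_sqrt hm.le]
    exact div_le_div_of_nonneg_right (Lsmooth_le hP hξ) hm.le
  have hb2 : b ^ 2 = g * ‖P.A‖ ^ 2 / η ^ 2 := by
    rw [hb, div_pow, mul_pow, Real.sq_sqrt hg0]
  set e := chat * ‖P.A‖ ^ 2 / m with he
  have he0 : 0 ≤ e := by positivity
  calc 2 * ‖P.A‖ ^ 2 * max (chat + Lsmooth m Lx Ly ξ / ‖P.A‖ ^ 2)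
        (2 * (chat + 16 * m * g / η ^ 2)) / m
      ≤ 2 * ‖P.A‖ ^ 2 * ((chat + Lsmooth m Lx Ly ξ / ‖P.A‖ ^ 2) +
        2 * (chat + 16 * m * g / η ^ 2)) / m := by gcongr
    _ = 6 * e + 2 * (Lsmooth m Lx Ly ξ / m) + 64 * b ^ 2 := by
      rw [hb2, he]; field_simp; ring
    _ ≤ 6 * e + 2 * a ^ 2 + 64 * b ^ 2 := by linarith
    _ ≤ 8 ^ 2 * (1 + e) * P.omega m Lx Ly chat ξ x₀ η ^ 2 := by
      rw [homega]
      have h1 : 1 ≤ (1 + a + b) ^ 2 := one_le_pow₀ (by linarith)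
      have h2 : a ^ 2 + b ^ 2 ≤ (1 + a + b) ^ 2 := by nlinarith [mul_nonneg ha0 hb0]
      have h3 : e ≤ e * (1 + a + b) ^ 2 := le_mul_of_one_le_right he0 h1
      nlinarith [sq_nonneg a]

/-- The scheme solves the problem within the asserted number of oracle evaluations. -/
theorem solves_scheme (hP : P.Standing m Lx Ly chat) (hξ : 0 < ξ)
    (hx₀ : x₀ ∈ P.X) (hy₀ : y₀ ∈ P.Y) (hρx : 0 < ρx) (hρy : 0 < ρy) (hη : 0 < η)
    (hDy : P.Dy / ρy ≤ ξ) :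
    SolvesWithin P (P.input m Lx Ly chat ξ x₀ y₀ ρx η) ρx ρy η
      (State.begin (chat + Lsmooth m Lx Ly ξ / ‖P.A‖ ^ 2) x₀)
      (10 ^ 8 * (1 + chat * ‖P.A‖ ^ 2 / m) * P.callBound m Lx Ly chat ξ x₀ ρx η) := by
  have hm := hP.m_pos
  have hA := norm_A_pos hP
  have hcn := hP.chat_nonneg
  obtain ⟨g, hg⟩ : ∃ g, g = P.R chat P.phat (1 / (4 * m)) x₀ + P.Dy ^ 2 / (m * ξ) := ⟨_, rfl⟩
  have hg0 : 0 ≤ g := hg ▸ gap_nonneg hP hξ x₀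
  have hL : 0 < Lsmooth m Lx Ly ξ / ‖P.A‖ ^ 2 :=
    div_pos (hm.trans_le (Lsmooth_ge hP hξ)) (by positivity)
  set c₀ := chat + Lsmooth m Lx Ly ξ / ‖P.A‖ ^ 2 with hc₀
  have hc₀0 : 0 < c₀ := by positivity
  set T := chat + 16 * m * g / η ^ 2 with hT
  obtain ⟨k, hk⟩ := pow_unbounded_of_one_lt (T / c₀) (one_lt_two (α := ℝ))
  have hkT : T ≤ 2 ^ k * c₀ := ((div_lt_iff₀ hc₀0).1 hk).le
  refine (solves_doubling hP hξ hx₀ hy₀ hρx hρy hη hDy hg (cmax := max c₀ (2 * T))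
    (le_max_right _ _) k c₀ le_rfl (le_max_left _ _) hkT).mono ?_
  have hW := condProxy_le_omega (x₀ := x₀) hP hξ hη hg
  rw [← hc₀, ← hT] at hW
  have hW1 : 1 ≤ condProxy P m (max c₀ (2 * T)) :=
    (one_le_condNum hP hξ hc₀0.le).trans
      ((condNum_le_condProxy hP hξ hc₀.symm.le).trans (condProxy_mono hP (le_max_left _ _)))
  have hw0 : 0 ≤ condProxy P m c₀ := Real.sqrt_nonneg _
  set W := condProxy P m (max c₀ (2 * T))
  have hom := one_le_omega (x₀ := x₀) (ξ := ξ) hP hη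
  have hcall : P.callBound m Lx Ly chat ξ x₀ ρx η = P.omega m Lx Ly chat ξ x₀ η *
      (m ^ 2 * g / ρx ^ 2 + logPlus (P.omega m Lx Ly chat ξ x₀ η)) := by
    unfold Problem.callBound
    rw [hg]
    congr 2
    field_simp
  rw [hcall]
  set Om := P.omega m Lx Ly chat ξ x₀ η
  set Q := m ^ 2 * g / ρx ^ 2
  have hQ0 : 0 ≤ Q := by positivity
  have hlp1 : 1 ≤ logPlus Om := le_max_left _ _
  have hlp2 : Real.log Om ≤ logPlus Om := le_max_right _ _
  set lp := logPlus Om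
  set H := 1 + chat * ‖P.A‖ ^ 2 / m with hH
  have hH1 : 1 ≤ H := by
    have : 0 ≤ chat * ‖P.A‖ ^ 2 / m := by positivity
    linarith
  have hr1 : 1 ≤ √H := Real.one_le_sqrt.2 hH1
  have hrr : √H * √H = H := Real.mul_self_sqrt (by linarith)
  set r := √H
  -- The factor `√H` of `W` enters twice, through `W` and through `log W`, hence the factor `H`.
  have hlogW : Real.log W ≤ 7 + r + lp := by
    have h1 := Real.log_le_log (by linarith) hW
    rw [Real.log_mul (by positivity) (by positivity), Real.log_mul (by norm_num) (by positivity)]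
      at h1
    have h2 := Real.log_le_sub_one_of_pos (show (0 : ℝ) < 8 by norm_num)
    have h3 := Real.log_le_sub_one_of_pos (show 0 < r by linarith)
    linarith
  have hlogW0 : 0 ≤ Real.log W := Real.log_nonneg hW1
  have hG : 206 + 36 * Real.log W + 3225600 * Q ≤ r * (3225600 * (Q + lp)) := by
    have h1 : Q ≤ r * Q := le_mul_of_one_le_left hQ0 hr1
    have h2 : r ≤ r * lp := le_mul_of_one_le_right (by linarith) hlp1
    have h3 : lp ≤ r * lp := le_mul_of_one_le_left (by linarith) hr1
    linarith
  calc (206 + 36 * Real.log W + 3225600 * Q) * (7 / 2 * W - 5 / 2 * condProxy P m c₀)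
      ≤ (206 + 36 * Real.log W + 3225600 * Q) * (7 / 2 * W) :=
        mul_le_mul_of_nonneg_left (by linarith) (by positivity)
    _ ≤ (r * (3225600 * (Q + lp))) * (7 / 2 * (8 * r * Om)) :=
        mul_le_mul hG (by linarith) (by linarith) (by positivity)
    _ = 90316800 * (r * r) * (Om * (Q + lp)) := by ring
    _ ≤ 10 ^ 8 * H * (Om * (Q + lp)) := by
      rw [hrr]
      have : 0 ≤ H * (Om * (Q + lp)) := by positivity
      linarith

/-- For fixed problem data, the complexity bound is `O(ρ_x⁻² ρ_y^{-1/2} + ρ_x⁻² η⁻¹)`. -/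
theorem exists_callBound_le (hP : P.Standing m Lx Ly chat) (x₀ : E) (K : ℝ) :
    ∃ C : ℝ, 0 ≤ C ∧ ∀ ρx ρy η ξ : ℝ, 0 < ρx → 0 < ρy → 0 < η → 0 < ξ → P.Dy / ρy ≤ ξ →
      ξ ≤ K / ρy → ρy ≤ K → logPlus (P.omega m Lx Ly chat ξ x₀ η) ≤ K / ρx ^ 2 →
      P.callBound m Lx Ly chat ξ x₀ ρx η ≤ C * (1 / (ρx ^ 2 * √ρy) + 1 / (ρx ^ 2 * η)) := by
  have hm := hP.m_pos
  have hLy := hP.Ly_pos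
  have hR := R_nonneg hP x₀
  set R := P.R chat P.phat (1 / (4 * m)) x₀ with hRdef
  have hD0 : 0 ≤ P.Dy := Metric.diam_nonneg
  set c₁ := √K + (√K * Ly + √Lx * √K) / √m with hc₁
  set c₂ := √(R + P.Dy * K / m) * ‖P.A‖ with hc₂
  set c₃ := m ^ 2 * R + m * (P.Dy * |K|) + |K| with hc₃
  have hc₁0 : 0 ≤ c₁ := by positivity
  have hc₂0 : 0 ≤ c₂ := by positivity
  have hc₃0 : 0 ≤ c₃ := by positivity
  refine ⟨(c₁ + c₂) * c₃, by positivity, ?_⟩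
  intro ρx ρy η ξ hρx hρy hη hξ hDy hξK hρK hlog
  have hK : 0 < K := hρy.trans_le hρK
  have hsρ : 0 < √ρy := Real.sqrt_pos.2 hρy
  have hDξ : P.Dy ^ 2 / ξ ≤ P.Dy * K := by
    rw [div_le_iff₀ hρy] at hDy
    rw [div_le_iff₀ hξ, sq, mul_assoc]
    refine mul_le_mul_of_nonneg_left (hDy.trans ?_) hD0
    rw [mul_comm]
    exact mul_le_mul_of_nonneg_right hρK hξ.le
  have hsξ : √ξ ≤ √K / √ρy := by
    rw [← Real.sqrt_div hK.le]
    exact Real.sqrt_le_sqrt hξK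
  have hone : 1 ≤ √K / √ρy := by
    rw [le_div_iff₀ hsρ, one_mul]
    exact Real.sqrt_le_sqrt hρK
  have hom : P.omega m Lx Ly chat ξ x₀ η ≤ c₁ / √ρy + c₂ / η := by
    unfold Problem.omega omegaXi
    have h1 : (√ξ * Ly + √Lx) / √m ≤ (√K / √ρy * Ly + √Lx * (√K / √ρy)) / √m := by
      have := mul_le_mul_of_nonneg_right hsξ hLy.le
      have := le_mul_of_one_le_right (Real.sqrt_nonneg Lx) hone
      gcongr
    have h2 : √(R + P.Dy ^ 2 / (m * ξ)) * ‖P.A‖ / η ≤ c₂ / η := by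
      rw [hc₂]
      have h3 : P.Dy ^ 2 / (m * ξ) = P.Dy ^ 2 / ξ / m := by field_simp
      rw [h3]
      gcongr
    have h4 : c₁ / √ρy = √K / √ρy + (√K / √ρy * Ly + √Lx * (√K / √ρy)) / √m := by
      rw [hc₁]; field_simp
    rw [h4]
    linarith
  have hbr : m ^ 2 * R / ρx ^ 2 + m * P.Dy ^ 2 / (ξ * ρx ^ 2) +
      logPlus (P.omega m Lx Ly chat ξ x₀ η) ≤ c₃ / ρx ^ 2 := by
    have h1 : m * P.Dy ^ 2 / (ξ * ρx ^ 2) = m * (P.Dy ^ 2 / ξ) / ρx ^ 2 := by field_simp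
    have h2 : m * (P.Dy ^ 2 / ξ) / ρx ^ 2 ≤ m * (P.Dy * K) / ρx ^ 2 := by gcongr
    have h3 : c₃ / ρx ^ 2 = m ^ 2 * R / ρx ^ 2 + m * (P.Dy * K) / ρx ^ 2 + K / ρx ^ 2 := by
      rw [hc₃, abs_of_pos hK]; ring
    rw [h1, h3]
    linarith
  have hlp : 0 ≤ logPlus (P.omega m Lx Ly chat ξ x₀ η) := zero_le_one.trans (le_max_left _ _)
  unfold Problem.callBound
  calc _ ≤ (c₁ / √ρy + c₂ / η) * (c₃ / ρx ^ 2) :=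
        mul_le_mul hom hbr (by positivity) (by positivity)
    _ ≤ ((c₁ + c₂) / √ρy + (c₁ + c₂) / η) * (c₃ / ρx ^ 2) := by
      gcongr <;> linarith
    _ = _ := by field_simp

end Penalty

theorem proposition4p2 :
    -- complexity and correctness, with one universal constant `C`
    (∃ C : ℝ, ∀ (E : Type*) (F : Type*) (U : Type*)
      [NormedAddCommGroup E] [InnerProductSpace ℝ E] [FiniteDimensional ℝ E] [CompleteSpace E]
      [NormedAddCommGroup F] [InnerProductSpace ℝ F] [FiniteDimensional ℝ F]
      [NormedAddCommGroup U] [InnerProductSpace ℝ U] [FiniteDimensional ℝ U] [CompleteSpace U]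
      (P : Problem E F U) (m Lx Ly chat : ℝ), P.Standing m Lx Ly chat →
      ∀ x₀ ∈ P.X, ∀ y₀ ∈ P.Y, ∀ ρx ρy η ξ : ℝ,
        0 < ρx → 0 < ρy → 0 < η → 0 < ξ → P.Dy / ρy ≤ ξ →
        (∀ x ∈ P.X, ∃ g : E, HasGradientAt (P.pSmooth ξ y₀) g x ∧
          (((P.input m Lx Ly chat ξ x₀ y₀ ρx η).smoothMax x).exec P).1 =
            (P.pSmooth ξ y₀ x, g)) ∧
        ∃ (q : Quintuple E F U) (n : ℕ),
          SchemeOutputs P (P.input m Lx Ly chat ξ x₀ y₀ ρx η) q n ∧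
          (n : ℝ) ≤ C * (1 + chat * ‖P.A‖ ^ 2 / m) * P.callBound m Lx Ly chat ξ x₀ ρx η ∧
          P.IsStationary ρx ρy η q) ∧
    -- the rate in the tolerances, for a fixed problem
    (∀ (E : Type*) (F : Type*) (U : Type*)
      [NormedAddCommGroup E] [InnerProductSpace ℝ E] [FiniteDimensional ℝ E] [CompleteSpace E]
      [NormedAddCommGroup F] [InnerProductSpace ℝ F] [FiniteDimensional ℝ F]
      [NormedAddCommGroup U] [InnerProductSpace ℝ U] [FiniteDimensional ℝ U] [CompleteSpace U]
      (P : Problem E F U) (m Lx Ly chat : ℝ), P.Standing m Lx Ly chat →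
      ∀ x₀ ∈ P.X, ∀ y₀ ∈ P.Y, ∀ K : ℝ, ∃ C : ℝ, ∀ ρx ρy η ξ : ℝ,
        0 < ρx → 0 < ρy → 0 < η → 0 < ξ → P.Dy / ρy ≤ ξ →
        ξ ≤ K / ρy → ρy ≤ K → logPlus (P.omega m Lx Ly chat ξ x₀ η) ≤ K / ρx ^ 2 →
        ∃ (q : Quintuple E F U) (n : ℕ),
          SchemeOutputs P (P.input m Lx Ly chat ξ x₀ y₀ ρx η) q n ∧
          (n : ℝ) ≤ C * (1 / (ρx ^ 2 * √ρy) + 1 / (ρx ^ 2 * η)) ∧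
          P.IsStationary ρx ρy η q) := by
  refine ⟨⟨10 ^ 8, ?_⟩, ?_⟩
  · intro E F U _ _ _ _ _ _ _ _ _ _ _ P m Lx Ly chat hP x₀ hx₀ y₀ hy₀ ρx ρy η ξ hρx hρy hη hξ hDy
    refine ⟨fun x hx => ⟨smoothGrad P ξ y₀ x, hasGradientAt_pSmooth hP hξ y₀ hx, ?_⟩,
      solves_scheme hP hξ hx₀ hy₀ hρx hρy hη hDy⟩
    rw [smoothMax_exec, smoothVal_eq hP hξ hx]
  · intro E F U _ _ _ _ _ _ _ _ _ _ _ P m Lx Ly chat hP x₀ hx₀ y₀ hy₀ K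
    obtain ⟨C, hC, hbound⟩ := exists_callBound_le hP x₀ K
    refine ⟨10 ^ 8 * (1 + chat * ‖P.A‖ ^ 2 / m) * C, ?_⟩
    intro ρx ρy η ξ hρx hρy hη hξ hDy hξK hρK hlog
    refine (solves_scheme hP hξ hx₀ hy₀ hρx hρy hη hDy).mono ?_
    have := hP.m_pos
    have := hP.chat_nonneg
    rw [mul_assoc _ C]
    exact mul_le_mul_of_nonneg_left (hbound ρx ρy η ξ hρx hρy hη hξ hDy hξK hρK hlog)
      (by positivity)
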